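/- Let $r>a\geq 1$ be coprime integers, let $\varepsilon$ be a primitive $r$-th root of unity in $\mathbb{C}$, and let $G=\frac1r(1,a)$ be the cyclic subgroup of $GL(2,\mathbb{C})$ generated by $\zeta=\mathrm{diag}(\varepsilon,\varepsilon^a)$, acting on $\mathbb{C}[x,y]$ by $\zeta x=\varepsilon x$, $\zeta y=\varepsilon^a y$. Let $$\frac ra=[\alpha_1,\dots,\alpha_n]=\alpha_1-\cfrac{1}{\alpha_2-\cfrac{1}{\cdots-\cfrac1{\alpha_n}}},\qquad \alpha_i\geq 2,$$ be the Jung–Hirzebruch continued fraction expansion. **The module.** For $t\in\mathbb{Z}$ put $S_t=\{f\in\mathbb{C}[x,y]:\zeta f=\varepsilon^t f\}$, a module over $\mathbb{C}[x,y]^G$. Put $i_0=r$, $i_1=a$, $i_t=\alpha_{t-1}i_{t-1}-i_{t-2}$ for $2\le t\le n+1$, and $T_{r,a}=\bigoplus_{p=1}^{n+1}S_{i_p}$. **The quiver.** Let $Q$ have vertices $0,1,\dots,n$ (read modulo $n+1$), a clockwise arrow $c_{i,i-1}:i\to i-1$ and an anticlockwise arrow $a_{i,i+1}:i\to i+1$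 for every vertex $i$ (so $c_{0,n}:0\to n$ and $a_{n,0}:n\to 0$), and in addition $\alpha_i-2$ arrows from $i$ to $0$ for each $1\le i\le n$. Put $N=\sum_i(\alpha_i-2)$. The additional arrows are numbered $k_1,\dots,k_N$, first those leaving $1$, then those leaving $2$, and so on. For $n=1$ the two non-additional arrows $0\to1$ are called $a_1,a_2$ and the two non-additional arrows $1\to0$ are called $c_1,c_2$. Products of arrows are read from left to right: $pq$ means $p$ followed by $q$. For $n\geq2$ put $k_0=c_{1,0}$ and $k_{N+1}=a_{n,0}$. For $1\le t\le n$ let $C_{0,t}=c_{0,n}c_{n,n-1}\cdots c_{t+1,t}$ and $A_{0,t}=a_{0,1}a_{1,2}\cdots a_{t-1,t}$. Let $l_s$ be the vertex at which $k_s$ starts ($0\le s\le N+1$), and let $u_t=\max\{s:l_s=t\}$, $v_t=\min\{s:l_s=t\}$ (where these exist), and $V_t=\max\{s:l_s<t\}$ for $2\le t\le n$. **The reconstruction algebra.** $A_{r,a}$ is the path algebra $\mathbb{C}Q$ modulo the two-sided ideal generated by the following relations. * If $n=1$: $c_2a_1=c_1a_2$ and $a_1c_2=a_2c_1$; if moreover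 $\alpha_1>2$, $k_1a_1=c_2a_2$ and $a_1k_1=a_2c_2$, and $k_ta_1=k_{t-1}a_2$ and $a_1k_t=a_2k_{t-1}$ for $2\le t\le\alpha_1-2$. * If $n\ge2$, for the vertex $1$: if $\alpha_1=2$, $c_{1,0}a_{0,1}=a_{1,2}c_{2,1}$; if $\alpha_1>2$, $k_sa_{0,1}=k_{s+1}C_{0,1}$ and $a_{0,1}k_s=C_{0,1}k_{s+1}$ for $0\le s<u_1$, and $k_{u_1}a_{0,1}=a_{1,2}c_{2,1}$. * If $n\ge2$, for each $1<t<n$: if $\alpha_t=2$, $c_{t,t-1}a_{t-1,t}=a_{t,t+1}c_{t+1,t}$; if $\alpha_t>2$, $c_{t,t-1}a_{t-1,t}=k_{v_t}C_{0,t}$ and $C_{0,t}k_{v_t}=A_{0,l_{V_t}}k_{V_t}$, further $k_sA_{0,t}=k_{s+1}C_{0,t}$ and $A_{0,t}k_s=C_{0,t}k_{s+1}$ for $v_t\le s<u_t$, and $k_{u_t}A_{0,t}=a_{t,t+1}c_{t+1,t}$. * If $n\ge2$, for the vertex $n$: if $\alpha_n=2$, $c_{n,n-1}a_{n-1,n}=a_{n,0}c_{0,n}$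 and $c_{0,n}a_{n,0}=A_{0,l_{V_n}}k_{V_n}$; if $\alpha_n>2$, $c_{n,n-1}a_{n-1,n}=k_{v_n}c_{0,n}$ and $c_{0,n}k_{v_n}=A_{0,l_{V_n}}k_{V_n}$, further $k_sA_{0,n}=k_{s+1}c_{0,n}$ and $A_{0,n}k_s=c_{0,n}k_{s+1}$ for $v_n\le s<u_n$. **Theorem.** There is an isomorphism of $\mathbb{C}$-algebras $$A_{r,a}\;\cong\;\mathrm{End}_{\mathbb{C}[x,y]^G}(T_{r,a}),$$ where endomorphisms, like paths, are multiplied from left to right ($fg$ means $f$ followed by $g$); that is, $A_{r,a}$ is isomorphic to the opposite of the endomorphism ring taken with the usual composition $(f\circ g)(m)=f(g(m))$. -/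

import Mathlib

open MvPolynomial

noncomputable section

/-! ## Path algebras -/

namespace Reconstruction

universe u v

/-- A path of a quiver together with its two end points. -/
abbrev AnyPath (V : Type u) [Quiver.{v} V] := Σ i j : V, Quiver.Path i j

/-- The path algebra over `k` of a quiver with vertex set `V`: the `k`-vector space with basis all
paths (including the trivial path at every vertex).  The product `p * q` of two paths is
`p` followed by `q` if `p` ends where `q` starts, and `0` otherwise. -/
def PathAlgebra (k : Type*) [Field k] (V : Type u) [Quiver.{v} V] : Type _ :=
  AnyPath V →₀ k

namespace PathAlgebra

variable (k : Type*) [Field k] (V : Type u) [Quiver.{v} V]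

instance : AddCommGroup (PathAlgebra k V) := inferInstanceAs (AddCommGroup (AnyPath V →₀ k))

instance : Module k (PathAlgebra k V) := inferInstanceAs (Module k (AnyPath V →₀ k))

variable {V}

/-- A path, seen as an element of the path algebra. -/
def ofPath (p : AnyPath V) : PathAlgebra k V := Finsupp.single p (1 : k)

open Classical in
/-- The product of two paths: `p` followed by `q`, or `0` if they cannot be composed. -/
def mulPath (p q : AnyPath V) : PathAlgebra k V :=
  if h : p.2.1 = q.1 then ofPath k ⟨p.1, q.2.1, p.2.2.comp (q.2.2.cast h.symm rfl)⟩ else 0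

variable (V) in
/-- The bilinear extension of the product of paths. -/
def mulLin : PathAlgebra k V →ₗ[k] PathAlgebra k V →ₗ[k] PathAlgebra k V :=
  Finsupp.linearCombination k fun p : AnyPath V =>
    (Finsupp.linearCombination k fun q : AnyPath V => mulPath k p q :
      PathAlgebra k V →ₗ[k] PathAlgebra k V)

instance : Mul (PathAlgebra k V) := ⟨fun f g => mulLin k V f g⟩

instance [Fintype V] : One (PathAlgebra k V) :=
  ⟨∑ i : V, ofPath k (⟨i, i, Quiver.Path.nil⟩ : AnyPath V)⟩

variable {k}

theorem mul_def (f g : PathAlgebra k V) : f * g = mulLin k V f g := rfl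

theorem ofPath_mul_ofPath (p q : AnyPath V) :
    (ofPath k p * ofPath k q : PathAlgebra k V) = mulPath k p q := by
  rw [mul_def, mulLin, ofPath, ofPath]
  erw [Finsupp.linearCombination_single, one_smul, Finsupp.linearCombination_single, one_smul]

theorem ofPath_mul_of_eq {i j l : V} (p : Quiver.Path i j) (q : Quiver.Path j l) :
    (ofPath k ⟨i, j, p⟩ * ofPath k ⟨j, l, q⟩ : PathAlgebra k V) = ofPath k ⟨i, l, p.comp q⟩ := by
  rw [ofPath_mul_ofPath, mulPath, dif_pos rfl]
  rfl

theorem ofPath_mul_of_ne (p q : AnyPath V) (h : p.2.1 ≠ q.1) :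
    (ofPath k p * ofPath k q : PathAlgebra k V) = 0 := by
  rw [ofPath_mul_ofPath, mulPath, dif_neg h]

/-- To prove an additive and homogeneous property of all elements, check it on paths. -/
theorem induction_paths {P : PathAlgebra k V → Prop} (hz : P 0)
    (ha : ∀ f g, P f → P g → P (f + g)) (hs : ∀ (c : k) f, P f → P (c • f))
    (hp : ∀ p, P (ofPath k p)) (f : PathAlgebra k V) : P f := by
  refine Finsupp.induction_linear (motive := P) f hz ha fun p c => ?_
  have h := hs c _ (hp p)
  rw [ofPath] at h
  erw [Finsupp.smul_single, smul_eq_mul, mul_one] at h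
  exact h

theorem zero_mul' (f : PathAlgebra k V) : 0 * f = 0 := by simp [mul_def]
theorem mul_zero' (f : PathAlgebra k V) : f * 0 = 0 := by simp [mul_def]
theorem add_mul' (f g h : PathAlgebra k V) : (f + g) * h = f * h + g * h := by
  simp [mul_def]
theorem mul_add' (f g h : PathAlgebra k V) : f * (g + h) = f * g + f * h := by
  simp [mul_def]
theorem smul_mul' (c : k) (f g : PathAlgebra k V) : (c • f) * g = c • (f * g) := by
  simp [mul_def]
theorem mul_smul' (c : k) (f g : PathAlgebra k V) : f * (c • g) = c • (f * g) := by
  simp [mul_def]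

theorem mul_assoc' (f g h : PathAlgebra k V) : f * g * h = f * (g * h) := by
  refine induction_paths (P := fun f => f * g * h = f * (g * h)) ?_ ?_ ?_ ?_ f
  · simp only [zero_mul']
  · intro a b ha hb; simp only [add_mul', ha, hb]
  · intro c a ha; simp only [smul_mul', ha]
  intro p
  refine induction_paths (P := fun g => ofPath k p * g * h = ofPath k p * (g * h)) ?_ ?_ ?_ ?_ g
  · simp only [zero_mul', mul_zero']
  · intro a b ha hb; simp only [add_mul', mul_add', ha, hb]
  · intro c a ha; simp only [smul_mul', mul_smul', ha]
  intro q
  refine induction_paths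
    (P := fun h => ofPath k p * ofPath k q * h = ofPath k p * (ofPath k q * h)) ?_ ?_ ?_ ?_ h
  · simp only [mul_zero']
  · intro a b ha hb; simp only [mul_add', ha, hb]
  · intro c a ha; simp only [mul_smul', ha]
  intro s
  obtain ⟨i, j, p⟩ := p
  obtain ⟨j', l, q⟩ := q
  obtain ⟨l', m, s⟩ := s
  by_cases h1 : j = j'
  · subst h1
    by_cases h2 : l = l'
    · subst h2
      simp only [ofPath_mul_of_eq, Quiver.Path.comp_assoc]
    · rw [ofPath_mul_of_eq, ofPath_mul_of_ne ⟨j, l, q⟩ ⟨l', m, s⟩ h2, mul_zero',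
        ofPath_mul_of_ne _ _ h2]
  · rw [ofPath_mul_of_ne _ _ h1, zero_mul']
    by_cases h2 : l = l'
    · subst h2
      rw [ofPath_mul_of_eq, ofPath_mul_of_ne _ _ h1]
    · rw [ofPath_mul_of_ne ⟨j', l, q⟩ ⟨l', m, s⟩ h2, mul_zero']

theorem sum_mul'' (s : Finset V) (F : V → PathAlgebra k V) (g : PathAlgebra k V) :
    (∑ i ∈ s, F i) * g = ∑ i ∈ s, F i * g := by
  simp [mul_def]

theorem mul_sum'' (s : Finset V) (F : V → PathAlgebra k V) (g : PathAlgebra k V) :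
    g * (∑ i ∈ s, F i) = ∑ i ∈ s, g * F i := by
  simp [mul_def]

variable [Fintype V]

theorem one_def :
    (1 : PathAlgebra k V) = ∑ i : V, ofPath k (⟨i, i, Quiver.Path.nil⟩ : AnyPath V) := rfl

theorem one_mul' (f : PathAlgebra k V) : 1 * f = f := by
  refine induction_paths (P := fun f => 1 * f = f) (mul_zero' _) ?_ ?_ ?_ f
  · intro a b ha hb; rw [mul_add', ha, hb]
  · intro c a ha; rw [mul_smul', ha]
  rintro ⟨i, j, p⟩
  rw [one_def, sum_mul'', Finset.sum_eq_single i]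
  · rw [ofPath_mul_of_eq, Quiver.Path.nil_comp]
  · intro b _ hb
    exact ofPath_mul_of_ne _ _ hb
  · intro h; exact absurd (Finset.mem_univ i) h

theorem mul_one' (f : PathAlgebra k V) : f * 1 = f := by
  refine induction_paths (P := fun f => f * 1 = f) (zero_mul' _) ?_ ?_ ?_ f
  · intro a b ha hb; rw [add_mul', ha, hb]
  · intro c a ha; rw [smul_mul', ha]
  rintro ⟨i, j, p⟩
  rw [one_def, mul_sum'', Finset.sum_eq_single j]
  · rw [ofPath_mul_of_eq, Quiver.Path.comp_nil]
  · intro b _ hb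
    exact ofPath_mul_of_ne _ _ hb.symm
  · intro h; exact absurd (Finset.mem_univ j) h

instance : Ring (PathAlgebra k V) :=
  { (inferInstance : AddCommGroup (PathAlgebra k V)),
    (inferInstance : Mul (PathAlgebra k V)),
    (inferInstance : One (PathAlgebra k V)) with
    zero_mul := zero_mul'
    mul_zero := mul_zero'
    left_distrib := mul_add'
    right_distrib := add_mul'
    mul_assoc := mul_assoc'
    one_mul := one_mul'
    mul_one := mul_one' }

instance : Algebra k (PathAlgebra k V) :=
  Algebra.ofModule smul_mul' mul_smul'

end PathAlgebra

/-! ## The quiver of labels `[α₁, …, αₙ]`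

The labels are given by a list `α` of length `n`. -/

/-- The label `α_t` (for `1 ≤ t ≤ n`). -/
def label (α : List ℕ) (t : ℕ) : ℕ := α.getD (t - 1) 0

/-- The number `∑ (α_i - 2)` of extra arrows. -/
def numExtra (α : List ℕ) : ℕ := (α.map fun x => x - 2).sum

/-- `l_s`, the vertex at the tail of the arrow `k_s`, for `0 ≤ s ≤ 1 + ∑ (α_i - 2)`.
Here `l_0 = 1`, `l_{1 + ∑ (α_i - 2)} = n`, and the extra arrows `k_1, k_2, …` are numbered
anticlockwise: first the `α₁ - 2` ones leaving vertex `1`, then the `α₂ - 2` ones leaving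
vertex `2`, and so on. -/
def kTail (α : List ℕ) (s : ℕ) : ℕ :=
  if s = 0 then 1
  else if s = numExtra α + 1 then α.length
  else sInf {t : ℕ | s ≤ numExtra (α.take t)}

/-- `u_i`, the largest `s` such that `k_s` leaves vertex `i`. -/
def uIdx (α : List ℕ) (i : ℕ) : ℕ := sSup {s : ℕ | s ≤ numExtra α + 1 ∧ kTail α s = i}

/-- `v_i`, the smallest `s` such that `k_s` leaves vertex `i`. -/
def vIdx (α : List ℕ) (i : ℕ) : ℕ := sInf {s : ℕ | s ≤ numExtra α + 1 ∧ kTail α s = i}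

/-- `V_1 = 0`, and `V_i` is the largest `s` such that `k_s` leaves a vertex smaller than `i`,
for `2 ≤ i ≤ n`. -/
def VIdx (α : List ℕ) (i : ℕ) : ℕ :=
  if i = 1 then 0 else sSup {s : ℕ | s ≤ numExtra α + 1 ∧ kTail α s < i}

/-- The vertices `0, 1, …, n`; addition is modulo `n + 1`. -/
def Vertex (α : List ℕ) : Type := Fin (α.length + 1)

instance (α : List ℕ) : Fintype (Vertex α) := inferInstanceAs (Fintype (Fin (α.length + 1)))

instance (α : List ℕ) : DecidableEq (Vertex α) :=
  inferInstanceAs (DecidableEq (Fin (α.length + 1)))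

/-- The vertex with number `t`, read modulo `n + 1`. -/
def vertex (α : List ℕ) (t : ℕ) : Vertex α := Fin.ofNat (α.length + 1) t

/-- The arrows of the quiver: for every vertex `i` a clockwise arrow `i → i - 1` and
an anticlockwise arrow `i → i + 1` (modulo `n + 1`), and the extra arrows;
`extra s` is the arrow `k_{s+1}` from its tail to the vertex `0`. -/
inductive Arrow (α : List ℕ) : Type
  | clock (i : Fin (α.length + 1)) : Arrow α
  | anti (i : Fin (α.length + 1)) : Arrow α
  | extra (s : Fin (numExtra α)) : Arrow α

/-- The vertex at which an arrow starts. -/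
def Arrow.start {α : List ℕ} : Arrow α → Vertex α
  | clock i => i
  | anti i => i
  | extra s => vertex α (kTail α (s + 1))

/-- The vertex at which an arrow ends. -/
def Arrow.finish {α : List ℕ} : Arrow α → Vertex α
  | clock i => (i - 1 : Fin (α.length + 1))
  | anti i => (i + 1 : Fin (α.length + 1))
  | extra _ => vertex α 0

instance (α : List ℕ) : Quiver.{0} (Vertex α) :=
  ⟨fun i j => {e : Arrow α // e.start = i ∧ e.finish = j}⟩

/-- The complex path algebra of the quiver. -/
abbrev FreePaths (α : List ℕ) : Type := PathAlgebra ℂ (Vertex α)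

/-- An arrow, as an element of the path algebra. -/
def arrow {α : List ℕ} (e : Arrow α) : FreePaths α :=
  PathAlgebra.ofPath ℂ
    ⟨e.start, e.finish, Quiver.Hom.toPath (⟨e, rfl, rfl⟩ : e.start ⟶ e.finish)⟩

/-- The clockwise arrow leaving vertex `t`: `c_{t,t-1}`, and `c_{0,n}` for `t = 0`. -/
def cl (α : List ℕ) (t : ℕ) : FreePaths α := arrow (Arrow.clock (Fin.ofNat _ t))

/-- The anticlockwise arrow leaving vertex `t`: `a_{t,t+1}`, and `a_{n,0}` for `t = n`. -/
def an (α : List ℕ) (t : ℕ) : FreePaths α := arrow (Arrow.anti (Fin.ofNat _ t))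

/-- `k_s` for `0 ≤ s ≤ 1 + ∑ (α_i - 2)`, where `k_0 = c_{1,0}` and
`k_{1 + ∑ (α_i - 2)} = a_{n,0}`. -/
def kk (α : List ℕ) (s : ℕ) : FreePaths α :=
  if s = 0 then cl α 1
  else if h : s - 1 < numExtra α then arrow (Arrow.extra ⟨s - 1, h⟩)
  else an α α.length

/-- `C_{0,t} = c_{0,n} c_{n,n-1} ⋯ c_{t+1,t}`, for `1 ≤ t ≤ n`. -/
def clPath (α : List ℕ) (t : ℕ) : FreePaths α :=
  cl α 0 * ((List.range (α.length - t)).map fun m => cl α (α.length - m)).prod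

/-- `A_{0,t} = a_{0,1} a_{1,2} ⋯ a_{t-1,t}`, for `1 ≤ t ≤ n`. -/
def anPath (α : List ℕ) (t : ℕ) : FreePaths α := ((List.range t).map fun m => an α m).prod

/-- The defining relations of the reconstruction algebra of type `A` with labels
`[α₁, …, αₙ]`.  For `n = 1` the arrows `0 → 1` are `a_1 = cl 0`, `a_2 = an 0`, and the arrows
`c_1, c_2 : 1 → 0` are `c_1 = cl 1`, `c_2 = an 1`. -/
inductive Rel (α : List ℕ) : FreePaths α → FreePaths α → Prop
  -- the case of one label
  | one_a (hn : α.length = 1) : Rel α (an α 1 * cl α 0) (cl α 1 * an α 0)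
  | one_b (hn : α.length = 1) : Rel α (cl α 0 * an α 1) (an α 0 * cl α 1)
  | one_c (hn : α.length = 1) (h : 2 < label α 1) : Rel α (kk α 1 * cl α 0) (an α 1 * an α 0)
  | one_d (hn : α.length = 1) (h : 2 < label α 1) : Rel α (cl α 0 * kk α 1) (an α 0 * an α 1)
  | one_e (hn : α.length = 1) (t : ℕ) (h₁ : 2 ≤ t) (h₂ : t ≤ label α 1 - 2) :
      Rel α (kk α t * cl α 0) (kk α (t - 1) * an α 0)
  | one_f (hn : α.length = 1) (t : ℕ) (h₁ : 2 ≤ t) (h₂ : t ≤ label α 1 - 2) :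
      Rel α (cl α 0 * kk α t) (an α 0 * kk α (t - 1))
  -- the first step
  | first_a (hn : 2 ≤ α.length) (h : label α 1 = 2) :
      Rel α (cl α 1 * an α 0) (an α 1 * cl α 2)
  | first_b (hn : 2 ≤ α.length) (h : 2 < label α 1) (s : ℕ) (hs : s < uIdx α 1) :
      Rel α (kk α s * an α 0) (kk α (s + 1) * clPath α 1)
  | first_c (hn : 2 ≤ α.length) (h : 2 < label α 1) (s : ℕ) (hs : s < uIdx α 1) :
      Rel α (an α 0 * kk α s) (clPath α 1 * kk α (s + 1))
  | first_d (hn : 2 ≤ α.length) (h : 2 < label α 1) :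
      Rel α (kk α (uIdx α 1) * an α 0) (an α 1 * cl α 2)
  -- the steps `1 < t < n`
  | mid_a (t : ℕ) (h₁ : 1 < t) (hn : t < α.length) (h : label α t = 2) :
      Rel α (cl α t * an α (t - 1)) (an α t * cl α (t + 1))
  | mid_b (t : ℕ) (h₁ : 1 < t) (hn : t < α.length) (h : 2 < label α t) :
      Rel α (cl α t * an α (t - 1)) (kk α (vIdx α t) * clPath α t)
  | mid_c (t : ℕ) (h₁ : 1 < t) (hn : t < α.length) (h : 2 < label α t) :
      Rel α (clPath α t * kk α (vIdx α t)) (anPath α (kTail α (VIdx α t)) * kk α (VIdx α t))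
  | mid_d (t : ℕ) (h₁ : 1 < t) (hn : t < α.length) (h : 2 < label α t)
      (s : ℕ) (hv : vIdx α t ≤ s) (hu : s < uIdx α t) :
      Rel α (kk α s * anPath α t) (kk α (s + 1) * clPath α t)
  | mid_e (t : ℕ) (h₁ : 1 < t) (hn : t < α.length) (h : 2 < label α t)
      (s : ℕ) (hv : vIdx α t ≤ s) (hu : s < uIdx α t) :
      Rel α (anPath α t * kk α s) (clPath α t * kk α (s + 1))
  | mid_f (t : ℕ) (h₁ : 1 < t) (hn : t < α.length) (h : 2 < label α t) :
      Rel α (kk α (uIdx α t) * anPath α t) (an α t * cl α (t + 1))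
  -- the last step
  | last_a (n : ℕ) (hn : α.length = n) (h₁ : 2 ≤ n) (h : label α n = 2) :
      Rel α (cl α n * an α (n - 1)) (an α n * cl α 0)
  | last_b (n : ℕ) (hn : α.length = n) (h₁ : 2 ≤ n) (h : label α n = 2) :
      Rel α (cl α 0 * an α n) (anPath α (kTail α (VIdx α n)) * kk α (VIdx α n))
  | last_c (n : ℕ) (hn : α.length = n) (h₁ : 2 ≤ n) (h : 2 < label α n) :
      Rel α (cl α n * an α (n - 1)) (kk α (vIdx α n) * cl α 0)
  | last_d (n : ℕ) (hn : α.length = n) (h₁ : 2 ≤ n) (h : 2 < label α n) :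
      Rel α (cl α 0 * kk α (vIdx α n)) (anPath α (kTail α (VIdx α n)) * kk α (VIdx α n))
  | last_e (n : ℕ) (hn : α.length = n) (h₁ : 2 ≤ n) (h : 2 < label α n)
      (s : ℕ) (hv : vIdx α n ≤ s) (hu : s < uIdx α n) :
      Rel α (kk α s * anPath α n) (kk α (s + 1) * cl α 0)
  | last_f (n : ℕ) (hn : α.length = n) (h₁ : 2 ≤ n) (h : 2 < label α n)
      (s : ℕ) (hv : vIdx α n ≤ s) (hu : s < uIdx α n) :
      Rel α (anPath α n * kk α s) (cl α 0 * kk α (s + 1))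

/-- The reconstruction algebra of type `A` with labels `[α₁, …, αₙ]`. -/
abbrev ReconstructionAlgebra (α : List ℕ) : Type := RingQuot (Rel α)

/-! ## Continued fractions, the group `1/r(1,a)` and the modules `S_t` -/

/-- The value `α₁ - 1/(α₂ - 1/(⋯ - 1/αₙ))` of the continued fraction `[α₁, …, αₙ]`
(the empty list has the junk value `0`). -/
def fractionValue : List ℕ → ℚ
  | [] => 0
  | [x] => x
  | x :: y :: l => x - 1 / fractionValue (y :: l)

/-- `α` is the Jung–Hirzebruch continued fraction expansion of `r / a`. -/
def IsJungHirzebruch (r a : ℕ) (α : List ℕ) : Prop :=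
  (∀ x ∈ α, 2 ≤ x) ∧ (r : ℚ) / a = fractionValue α

/-- The `i`-series: `i_0 = r`, `i_1 = a`, `i_t = α_{t-1} i_{t-1} - i_{t-2}`. -/
def iSeries (r a : ℕ) (α : List ℕ) : ℕ → ℤ
  | 0 => r
  | 1 => a
  | t + 2 => label α (t + 1) * iSeries r a α (t + 1) - iSeries r a α t

/-- The polynomial ring `ℂ[x, y]`, with `x = X 0` and `y = X 1`. -/
abbrev Poly : Type := MvPolynomial (Fin 2) ℂ

/-- The linear substitution on `ℂ[x, y]` by a `2 × 2` matrix `g`: the variable `x_j` is replaced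
by `∑ i, g i j * x_i`. -/
def substitute (g : GL (Fin 2) ℂ) : Poly →ₐ[ℂ] Poly :=
  aeval fun j => ∑ i, C (g.1 i j) * X i

/-- The diagonal matrix `ζ` with entries `ε` and `ε ^ a`. -/
def zeta (ε : ℂˣ) (a : ℕ) : GL (Fin 2) ℂ :=
  Units.map (Matrix.diagonalRingHom (Fin 2) ℂ).toMonoidHom
    (MulEquiv.piUnits.symm ![ε, ε ^ a])

/-- The cyclic group `1/r(1,a)` generated by `ζ`, where `ε` is a primitive `r`-th root of
unity. -/
def cyclicGroup (ε : ℂˣ) (a : ℕ) : Subgroup (GL (Fin 2) ℂ) := Subgroup.zpowers (zeta ε a)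

/-- The ring of invariants `ℂ[x, y]^G`. -/
def invariants (G : Subgroup (GL (Fin 2) ℂ)) : Subalgebra ℂ Poly where
  carrier := {f | ∀ g ∈ G, substitute g f = f}
  mul_mem' hf hg σ hσ := by rw [map_mul, hf σ hσ, hg σ hσ]
  add_mem' hf hg σ hσ := by rw [map_add, hf σ hσ, hg σ hσ]
  algebraMap_mem' c σ _ := (substitute σ).commutes c

/-- The module `S_t = {f ∈ ℂ[x, y] : ζ f = ε ^ t f}` over the ring of invariants. -/
def semiInvariants (ε : ℂˣ) (a : ℕ) (t : ℤ) : Submodule (invariants (cyclicGroup ε a)) Poly where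
  carrier := {f | substitute (zeta ε a) f = C ((ε ^ t : ℂˣ) : ℂ) * f}
  add_mem' {f g} hf hg := by
    simp only [Set.mem_ofPred_eq] at hf hg ⊢
    rw [map_add, hf, hg, mul_add]
  zero_mem' := by simp
  smul_mem' := by
    rintro ⟨c, hc⟩ f hf
    simp only [Set.mem_ofPred_eq, Subalgebra.smul_def, smul_eq_mul] at hf ⊢
    rw [map_mul, hf, hc _ (Subgroup.mem_zpowers _)]
    ring

/-- `T_{r,a} = S_{i_1} ⊕ S_{i_2} ⊕ ⋯ ⊕ S_{i_{n+1}}`. -/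
abbrev specialSum (r a : ℕ) (ε : ℂˣ) (α : List ℕ) : Type :=
  DirectSum (Fin (α.length + 1)) fun p => semiInvariants ε a (iSeries r a α (p + 1))

end Reconstruction

end

/-! Each `S_t` contains a power of `x` and a power of `y`. Hence a linear map from `S_s` to `S_t`
over the invariants is multiplication by a polynomial (`exists_eq_mul_of_linearMap`), and the
opposite of `End(T)` becomes the algebra of matrices spanned by the `x^u y^v` at places `(p, q)`
with `i_p + u + a v ≡ i_q` mod `r`; such `(u, v)` are called admissible.

The arrows are given monomial weights. Vertex `0` is renumbered `n + 1`; the arrows `x` (to `n`) and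
`y` (to `1`) leave it. With the series `j_0 = 0`, `j_1 = 1`, `j_{t+1} = α_t j_t - j_{t-1}`, the
`α_t` arrows leaving `t ≤ n` are ordered by `m = 0, …, α_t - 1` and weighted by `x^(i_{t-1} - (m+1)
i_t) y^(m j_t - j_{t-1})`. A negative exponent can occur only at the two ends of this chain and is
then read as `0`. For `n ≥ 2` the chain runs from the clockwise arrow through the extra arrows to
the anticlockwise one; for `n = 1` it is `c_1, c_2, k_1, k_2, …`. Both sides of every defining
relation have the same ends and the same weight (`weightHom_rel`), so weights define a homomorphism
from the reconstruction algebra to matrices of polynomials.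

Its image is the matrix algebra above. The point is `exists_step`: a nontrivial admissible monomial
leaving `t` is divisible by the weight of some arrow leaving `t`. This uses that consecutive vectors
`(i_t, -j_t)` form a basis of the lattice `u + a v ≡ 0` mod `r`. Stripping arrows one by one gives
`exists_isPath`.

It is injective because two paths with the same ends and weight are equal modulo the relations
(`IsPath.unique`). By induction on the degree only the first arrows matter. Neighbouring arrows `m`,
`m + 1` of a chain are exchanged by a relation `arr m · (power of y) = arr (m+1) · (power of x)`,
and the arrows `x`, `y` by a relation between loops at `0`. In both cases `exists_isPath` supplies
the common remainder, to which the induction hypothesis applies. The defining relations are shown to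
contain these exchanges in `laws`. -/

noncomputable section

namespace Reconstruction

/-! ## Lattice combinatorics of the two series of a continued fraction -/

/-- The arithmetic of the `i`-series and the `j`-series of a continued fraction with
labels `α 1, …, α n`. -/
structure SeriesData (n r : ℕ) (α i j : ℕ → ℕ) : Prop where
  n_pos : 1 ≤ n
  two_le : ∀ t, 1 ≤ t → t ≤ n → 2 ≤ α t
  i_rec : ∀ t, 1 ≤ t → t ≤ n → i (t + 1) + i (t - 1) = α t * i t
  j_rec : ∀ t, 1 ≤ t → t ≤ n → j (t + 1) + j (t - 1) = α t * j t
  i_lt : ∀ t, t ≤ n → i (t + 1) < i t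
  j_lt : ∀ t, t ≤ n → j t < j (t + 1)
  i_zero : i 0 = r
  i_n : i n = 1
  i_last : i (n + 1) = 0
  j_zero : j 0 = 0
  j_one : j 1 = 1
  det : ∀ t, t ≤ n → i t * j (t + 1) = i (t + 1) * j t + r
  cong : ∀ t, t ≤ n + 1 → (r : ℤ) ∣ i 1 * j t - i t

/-- The exponent of `x` of the `m`-th arrow leaving vertex `t`. -/
def wx (i : ℕ → ℕ) (t m : ℕ) : ℕ := i (t - 1) - (m + 1) * i t

/-- The exponent of `y` of the `m`-th arrow leaving vertex `t`. -/
def wy (j : ℕ → ℕ) (t m : ℕ) : ℕ := m * j t - j (t - 1)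

/-- The vertex at which the `m`-th arrow leaving vertex `t` ends; the vertices are numbered
`1, …, n + 1`. -/
def target (n : ℕ) (α : ℕ → ℕ) (t m : ℕ) : ℕ :=
  if m = 0 then (if t = 1 then n + 1 else t - 1) else if m = α t - 1 then t + 1 else n + 1

/-- Multiplication by `x ^ u * y ^ v` maps `S_{i_p}` into `S_{i_q}`. -/
def Admissible (r : ℕ) (i : ℕ → ℕ) (p q u v : ℕ) : Prop :=
  (r : ℤ) ∣ i p + u + i 1 * v - i q

/-- The index is `m = B - A + 1`: then `u` exceeds `I₀ - (m+1) I₁` by `D + (A-1)(I₀ - I₁)` and `v`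
exceeds `m J₁ - J₀` by `(A-1)(J₁ - J₀)`. Both are nonnegative once `A ≥ 1`, which holds because `A ≤
0` would make the first coordinate negative or the monomial trivial. The bounds on `m` say that
neither end of the chain fits. -/
theorem exists_chain_index {I₀ I₁ J₀ J₁ α u v D A B : ℤ} (hI : I₁ < I₀) (hI₁ : 0 < I₁)
    (hJ : J₀ < J₁) (hJ₀ : 0 ≤ J₀) (hD : 0 ≤ D) (hDI : D ≤ I₁)
    (hu : 0 ≤ u) (hv : 0 ≤ v) (huv : u ≠ 0 ∨ v ≠ 0)
    (hU : u + I₁ = D + A * I₀ - B * I₁) (hV : v = B * J₁ - A * J₀)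
    (hu' : u + I₁ < I₀) (hv' : v + J₁ < α * J₁ - J₀) :
    ∃ m, 1 ≤ m ∧ m ≤ α - 2 ∧ I₀ - (m + 1) * I₁ ≤ u ∧ m * J₁ - J₀ ≤ v := by
  have hA : 1 ≤ A := by
    by_contra hA
    have hA : A ≤ 0 := by omega
    have hB : A ≤ B := by
      by_contra hB
      have hB : B + 1 ≤ A := by omega
      nlinarith
    rcases hA.lt_or_eq with hA | rfl
    · nlinarith
    · rcases hB.lt_or_eq with hB | rfl
      · nlinarith
      · simp at hV hU; omega
  refine ⟨B - A + 1, ?_, ?_, ?_, ?_⟩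
  · have : A - 1 < B := by
      by_contra h
      have h : B ≤ A - 1 := by omega
      nlinarith
    omega
  · have : B + 1 < α + A - 1 := by
      by_contra h
      have h : α + A - 1 ≤ B + 1 := by omega
      nlinarith
    omega
  · nlinarith
  · nlinarith

/-- The vectors `(I₀, -J₀)` and `(-I₁, J₁)` lie in the lattice `U + e V ≡ 0` mod `r`, and their
determinant `r` is its index, so they form a basis. -/
theorem exists_lattice_coordinates {r I₀ I₁ J₀ J₁ e a b k U V : ℤ} (hr : r ≠ 0)
    (hdet : I₀ * J₁ = I₁ * J₀ + r) (h₀ : e * J₀ - I₀ = r * b) (h₁ : e * J₁ - I₁ = r * a)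
    (hk : U + e * V = r * k) : ∃ A B : ℤ, U = A * I₀ - B * I₁ ∧ V = B * J₁ - A * J₀ := by
  have hA : r * (k * J₁ - V * a) = U * J₁ + V * I₁ := by
    linear_combination -J₁ * hk + V * h₁
  have hB : r * (k * J₀ - V * b) = U * J₀ + V * I₀ := by
    linear_combination -J₀ * hk + V * h₀
  -- Cramer's rule, with the division by `r` already carried out in `hA` and `hB`.
  refine ⟨k * J₁ - V * a, k * J₀ - V * b, mul_left_cancel₀ hr ?_, mul_left_cancel₀ hr ?_⟩
  · linear_combination -I₀ * hA + I₁ * hB - U * hdet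
  · linear_combination J₀ * hA - J₁ * hB - V * hdet

section Numeric

variable {n r : ℕ} {α i j : ℕ → ℕ}

namespace SeriesData

theorem i_le (h : SeriesData n r α i j) {s t : ℕ} (hst : s ≤ t) (ht : t ≤ n + 1) :
    i t ≤ i s := by
  induction t, hst using Nat.le_induction with
  | base => exact le_rfl
  | succ t hst ih => exact (h.i_lt t (by omega)).le.trans (ih (by omega))

theorem j_le (h : SeriesData n r α i j) {s t : ℕ} (hst : s ≤ t) (ht : t ≤ n + 1) :
    j s ≤ j t := by
  induction t, hst using Nat.le_induction with
  | base => exact le_rfl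
  | succ t hst ih => exact (ih (by omega)).trans (h.j_lt t (by omega)).le

theorem i_lt' (h : SeriesData n r α i j) {s t : ℕ} (hst : s < t) (ht : t ≤ n + 1) :
    i t < i s :=
  (h.i_le (Nat.succ_le_of_lt hst) ht).trans_lt (h.i_lt s (by omega))

theorem wx_cast (h : SeriesData n r α i j) {t m : ℕ} (ht : 1 ≤ t) (htn : t ≤ n)
    (hm : m + 1 < α t) : (wx i t m : ℤ) = i (t - 1) - (m + 1) * i t := by
  have h1 := h.i_rec t ht htn
  have h2 := h.i_lt t htn
  have h3 : (m + 2) * i t ≤ α t * i t := Nat.mul_le_mul_right _ hm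
  have : (m + 1) * i t ≤ i (t - 1) := by nlinarith
  rw [wx, Nat.cast_sub this]; push_cast; ring

theorem wx_pos (h : SeriesData n r α i j) {t m : ℕ} (ht : 1 ≤ t) (htn : t ≤ n)
    (hm : m + 1 < α t) : 0 < wx i t m := by
  have h1 := h.i_rec t ht htn
  have h2 := h.i_lt t htn
  have h3 : (m + 2) * i t ≤ α t * i t := Nat.mul_le_mul_right _ hm
  have := h.wx_cast ht htn hm
  zify at *
  nlinarith

/-- The integer value is `i_{t-1} - α_t i_t = -i_{t+1}`; truncated subtraction turns it into the
wanted `0`. The same device makes `wy_zero` true. -/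
theorem wx_last (h : SeriesData n r α i j) {t m : ℕ} (ht : 1 ≤ t) (htn : t ≤ n)
    (hm : m + 1 = α t) : wx i t m = 0 := by
  have h1 := h.i_rec t ht htn
  rw [wx, hm]; omega

theorem wx_zero (t : ℕ) : wx i t 0 = i (t - 1) - i t := by simp [wx]

theorem wy_zero (t : ℕ) : wy j t 0 = 0 := by simp [wy]

theorem wy_cast (h : SeriesData n r α i j) {t m : ℕ} (htn : t ≤ n)
    (hm : 1 ≤ m) : (wy j t m : ℤ) = m * j t - j (t - 1) := by
  have h2 := h.j_le (Nat.sub_le t 1) (by omega)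
  have : j (t - 1) ≤ m * j t := by nlinarith
  rw [wy, Nat.cast_sub this]; push_cast; ring

theorem wy_last (h : SeriesData n r α i j) {t m : ℕ} (ht : 1 ≤ t) (htn : t ≤ n)
    (hm : m + 1 = α t) : wy j t m = j (t + 1) - j t := by
  have h1 := h.j_rec t ht htn
  have h2 := h.two_le t ht htn
  have h3 := h.wy_cast htn (m := m) (by omega)
  have h4 := h.j_lt t htn
  zify [h4.le] at *
  rw [h3]; rw [← hm] at h1; linarith

theorem wx_anti (t : ℕ) {m m' : ℕ} (hm : m ≤ m') : wx i t m' ≤ wx i t m := by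
  unfold wx; gcongr

theorem wy_mono (t : ℕ) {m m' : ℕ} (hm : m ≤ m') : wy j t m ≤ wy j t m' := by
  unfold wy; gcongr

theorem weight_pos (h : SeriesData n r α i j) {t m : ℕ} (ht : 1 ≤ t) (htn : t ≤ n)
    (hm : m < α t) : 0 < wx i t m + wy j t m := by
  rcases Nat.lt_or_ge (m + 1) (α t) with h1 | h1
  · have := h.wx_pos ht htn h1; omega
  · have := h.wy_last ht htn (m := m) (by omega)
    have := h.j_lt t htn; omega

theorem target_mem {t m : ℕ} (ht : 1 ≤ t) (htn : t ≤ n) :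
    1 ≤ target n α t m ∧ target n α t m ≤ n + 1 := by
  unfold target; split_ifs <;> omega

theorem admissible_step (h : SeriesData n r α i j) {t m : ℕ} (ht : 1 ≤ t) (htn : t ≤ n)
    (hm : m < α t) : Admissible r i t (target n α t m) (wx i t m) (wy j t m) := by
  unfold Admissible
  have h2 := h.two_le t ht htn
  obtain ⟨a, ha⟩ := h.cong t (by omega)
  obtain ⟨b, hb⟩ := h.cong (t - 1) (by omega)
  obtain ⟨c, hc⟩ := h.cong (t + 1) (by omega)
  rcases Nat.eq_zero_or_pos m with rfl | hm0
  · rw [h.wx_cast ht htn (by omega), wy_zero]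
    by_cases h1 : t = 1
    · subst h1
      simp [target, h.i_last, h.i_zero]
    · simp [target, h1]
  · rcases Nat.lt_or_ge (m + 1) (α t) with h1 | h1
    · rw [h.wx_cast ht htn h1, h.wy_cast htn hm0]
      rw [target, if_neg (by omega), if_neg (by omega), h.i_last]
      refine ⟨m * a - b, ?_⟩
      push_cast
      linear_combination m * ha - hb
    · rw [h.wx_last ht htn (by omega), h.wy_last ht htn (by omega)]
      rw [target, if_neg (by omega), if_pos (by omega), Nat.cast_sub (h.j_lt t htn).le]
      refine ⟨c - a, ?_⟩
      push_cast
      linear_combination hc - ha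

/-- If the arrows at both ends of the chain fail to divide `x^u y^v`, the monomial is small in both
directions, and its lattice coordinates single out an inner arrow by `exists_chain_index`. -/
theorem exists_step (h : SeriesData n r α i j) {t q u v : ℕ} (ht : 1 ≤ t) (htn : t ≤ n)
    (hqn : q ≤ n + 1) (hv : Admissible r i t q u v) (huv : u ≠ 0 ∨ v ≠ 0) :
    ∃ m < α t, wx i t m ≤ u ∧ wy j t m ≤ v := by
  have h2 := h.two_le t ht htn
  by_cases hc : i (t - 1) - i t ≤ u
  · exact ⟨0, by omega, by rwa [wx_zero], by simp [wy_zero]⟩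
  by_cases ha : j (t + 1) - j t ≤ v
  · exact ⟨α t - 1, by omega, by rw [h.wx_last ht htn (by omega)]; omega,
      by rwa [h.wy_last ht htn (by omega)]⟩
  have hr : (r : ℤ) ≠ 0 := by
    have := h.i_lt 0 (by omega); rw [h.i_zero] at this; omega
  have hi0 : i t < i (t - 1) := h.i_lt' (by omega) (by omega)
  have hi1 := h.i_lt t htn
  have hj0 : j (t - 1) < j t := by
    have := h.j_lt (t - 1) (by omega)
    rwa [Nat.sub_add_cancel ht] at this
  have hj1 := h.j_lt t htn
  have hir := h.i_rec t ht htn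
  have hjr := h.j_rec t ht htn
  have hd0 := h.det (t - 1) (by omega)
  rw [Nat.sub_add_cancel ht] at hd0
  have hd1 := h.det t htn
  obtain ⟨k, hk⟩ := hv
  obtain ⟨a, ha'⟩ := h.cong t (by omega)
  obtain ⟨b, hb⟩ := h.cong (t - 1) (by omega)
  obtain ⟨c, hc'⟩ := h.cong (t + 1) (by omega)
  obtain ⟨d, hd⟩ := h.cong q (by omega)
  -- `exists_chain_index` needs an offset `D` between `0` and `I₁`. For `q ≥ t` it is `i_q ≤ i_t`;
  -- for `q < t` the roles of `x` and `y` are exchanged and it is `j_q ≤ j_t`.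
  rcases Nat.lt_or_ge q t with hqt | hqt
  · have hjq := h.j_le hqt.le (by omega)
    obtain ⟨B, A, hU, hV⟩ := exists_lattice_coordinates (r := r) (I₀ := i t) (I₁ := i (t + 1))
      (J₀ := j t) (J₁ := j (t + 1)) (e := i 1) (a := c) (b := a) (k := k + a - d) (U := u)
      (V := v + j t - j q) hr (by exact_mod_cast hd1) (by linarith) (by linarith)
      (by linear_combination hk + ha' - hd)
    obtain ⟨m, hm1, hm2, hm3, hm4⟩ := exists_chain_index (I₀ := j (t + 1)) (I₁ := j t)
      (J₀ := i (t + 1)) (J₁ := i t) (α := α t) (u := v) (v := u) (D := j q) (A := A) (B := B)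
      (by omega) (by omega) (by omega) (by omega) (by omega) (by omega) (by omega) (by omega)
      (by omega) (by linarith) hU (by omega) (by zify at hir; omega)
    lift m to ℕ using (by omega)
    -- With `x` and `y` exchanged the chain at `t` is traversed from its other end, hence the
    -- reversed index.
    refine ⟨α t - 1 - m, by omega, ?_, ?_⟩
    · have := h.wx_cast ht htn (m := α t - 1 - m) (by omega)
      zify at *
      rw [this, Nat.cast_sub (by omega), Nat.cast_sub (by omega)]
      push_cast
      linarith
    · have := h.wy_cast htn (m := α t - 1 - m) (by omega)
      zify at *
      rw [this, Nat.cast_sub (by omega), Nat.cast_sub (by omega)]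
      push_cast
      linarith
  · have hiq := h.i_le hqt (by omega)
    obtain ⟨A, B, hU, hV⟩ := exists_lattice_coordinates (r := r) (I₀ := i (t - 1)) (I₁ := i t)
      (J₀ := j (t - 1)) (J₁ := j t) (e := i 1) (a := a) (b := b) (k := k)
      (U := u + i t - i q) (V := v) hr (by exact_mod_cast hd0) (by linarith) (by linarith)
      (by linear_combination hk)
    obtain ⟨m, hm1, hm2, hm3, hm4⟩ := exists_chain_index (I₀ := i (t - 1)) (I₁ := i t)
      (J₀ := j (t - 1)) (J₁ := j t) (α := α t) (u := u) (v := v) (D := i q) (A := A) (B := B)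
      (by omega) (by omega) (by omega) (by omega) (by omega) (by omega) (by omega) (by omega)
      (by omega) (by linarith) hV (by omega) (by zify at hjr; omega)
    lift m to ℕ using (by omega)
    refine ⟨m, by omega, ?_, ?_⟩
    · have := h.wx_cast ht htn (m := m) (by omega)
      zify; rw [this]; exact hm3
    · have := h.wy_cast htn (m := m) (by omega)
      zify; rw [this]; exact hm4

theorem admissible_sub (h : SeriesData n r α i j) {t m q u v : ℕ} (ht : 1 ≤ t) (htn : t ≤ n)
    (hm : m < α t) (hu : wx i t m ≤ u) (hv : wy j t m ≤ v) (hadm : Admissible r i t q u v) :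
    Admissible r i (target n α t m) q (u - wx i t m) (v - wy j t m) := by
  have h1 := dvd_sub hadm (h.admissible_step ht htn hm)
  unfold Admissible at *
  rw [Nat.cast_sub hu, Nat.cast_sub hv]
  exact h1.trans (dvd_of_eq (by ring))

/-- The numbers `i_1 > ⋯ > i_{n+1} = 0` are all smaller than `r`, hence pairwise incongruent. -/
theorem eq_of_admissible_zero (h : SeriesData n r α i j) {p q : ℕ} (hp : 1 ≤ p)
    (hpn : p ≤ n + 1) (hq : 1 ≤ q) (hqn : q ≤ n + 1) (hadm : Admissible r i p q 0 0) :
    p = q := by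
  have h1 := h.i_lt' (s := 0) hp hpn
  have h2 := h.i_lt' (s := 0) hq hqn
  rw [h.i_zero] at h1 h2
  have h3 : (i p : ℤ) = i q := by
    have h4 := Int.eq_zero_of_abs_lt_dvd hadm (by rw [abs_lt]; push_cast; constructor <;> omega)
    push_cast at h4
    linarith
  rcases lt_trichotomy p q with h4 | h4 | h4
  · have := h.i_lt' h4 hqn; omega
  · exact h4
  · have := h.i_lt' h4 hpn; omega

end SeriesData

end Numeric

/-! ## Arrow systems -/

/-- Idempotents `e t` (for `1 ≤ t ≤ n + 1`) and arrows of a monoid: `X` and `Y` leave the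
vertex `n + 1`, and `arr t m`, for `m < α t`, leave the vertex `t`. -/
structure ArrowSystem (A : Type*) where
  e : ℕ → A
  X : A
  Y : A
  arr : ℕ → ℕ → A

section Paths

variable {A : Type*} [Monoid A] (n : ℕ) (α i j : ℕ → ℕ) (S : ArrowSystem A)

/-- `IsPath n α i j S p q u v z` says that `z` is a product of arrows leading from `p` to `q`, of
total weight `(u, v)`. -/
inductive IsPath : ℕ → ℕ → ℕ → ℕ → A → Prop
  | nil (p : ℕ) (hp : 1 ≤ p) (hpn : p ≤ n + 1) : IsPath p p 0 0 (S.e p)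
  | consX (q u v : ℕ) (z : A) (h : IsPath n q u v z) : IsPath (n + 1) q (u + 1) v (S.X * z)
  | consY (q u v : ℕ) (z : A) (h : IsPath 1 q u v z) : IsPath (n + 1) q u (v + 1) (S.Y * z)
  | cons (t m q u v : ℕ) (z : A) (ht : 1 ≤ t) (htn : t ≤ n) (hm : m < α t)
      (h : IsPath (target n α t m) q u v z) :
      IsPath t q (u + wx i t m) (v + wy j t m) (S.arr t m * z)

variable {n α i j S} {r : ℕ}

theorem IsPath.mem {p q u v : ℕ} {z : A} (h : IsPath n α i j S p q u v z) :
    (1 ≤ p ∧ p ≤ n + 1) ∧ 1 ≤ q ∧ q ≤ n + 1 := by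
  induction h with
  | nil p hp hpn => omega
  | consX q u v z h ih => omega
  | consY q u v z h ih => omega
  | cons t m q u v z ht htn hm h ih => omega

/-- Strip off a first arrow and induct on the degree. At vertex `n + 1` any factor `x` or `y` can be
stripped; elsewhere `exists_step` provides the arrow. The statement is used both for surjectivity
and, in the uniqueness proof, to produce common remainders. -/
theorem exists_isPath (hd : SeriesData n r α i j) {p q u v : ℕ} (hp : 1 ≤ p) (hpn : p ≤ n + 1)
    (hq : 1 ≤ q) (hqn : q ≤ n + 1) (hadm : Admissible r i p q u v) :
    ∃ z, IsPath n α i j S p q u v z := by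
  induction hN : u + v using Nat.strong_induction_on generalizing p u v with
  | _ N ih =>
  subst hN
  by_cases h0 : u = 0 ∧ v = 0
  · obtain ⟨rfl, rfl⟩ := h0
    obtain rfl := hd.eq_of_admissible_zero hp hpn hq hqn hadm
    exact ⟨_, .nil p hp hpn⟩
  rcases hpn.eq_or_lt with rfl | hpn
  · rcases Nat.eq_zero_or_pos u with rfl | hu
    · obtain ⟨v, rfl⟩ := Nat.exists_eq_succ_of_ne_zero (n := v) (by omega)
      obtain ⟨z, hz⟩ := ih (0 + v) (by omega) (p := 1) (u := 0) (v := v) (by omega) (by omega)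
        (by unfold Admissible at *; rw [hd.i_last] at hadm; push_cast at *
            convert hadm using 1; ring) rfl
      exact ⟨_, .consY _ _ _ _ hz⟩
    · obtain ⟨u, rfl⟩ := Nat.exists_eq_succ_of_ne_zero hu.ne'
      obtain ⟨z, hz⟩ := ih (u + v) (by omega) (p := n) (u := u) (v := v) hd.n_pos (by omega)
        (by unfold Admissible at *; rw [hd.i_last] at hadm; rw [hd.i_n]; push_cast at *
            convert hadm using 1; ring) rfl
      exact ⟨_, .consX _ _ _ _ hz⟩
  · obtain ⟨m, hm, hu, hv⟩ := hd.exists_step hp (by omega) hqn hadm (by omega)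
    have h1 := hd.weight_pos hp (by omega) hm
    obtain ⟨z, hz⟩ := ih (u - wx i p m + (v - wy j p m)) (by omega)
      (SeriesData.target_mem hp (by omega)).1 (SeriesData.target_mem hp (by omega)).2
      (hd.admissible_sub hp (by omega) hm hu hv hadm) rfl
    have := IsPath.cons p m q _ _ z hp (by omega) hm hz
    rw [Nat.sub_add_cancel hu, Nat.sub_add_cancel hv] at this
    exact ⟨_, this⟩

theorem IsPath.admissible (hd : SeriesData n r α i j) {p q u v : ℕ} {z : A}
    (h : IsPath n α i j S p q u v z) : Admissible r i p q u v := by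
  induction h with
  | nil p hp hpn => simp [Admissible]
  | consX q u v z h ih =>
    unfold Admissible at *; rw [hd.i_last]; rw [hd.i_n] at ih; push_cast at *
    convert ih using 1; ring
  | consY q u v z h ih =>
    unfold Admissible at *; rw [hd.i_last]; push_cast at *
    convert ih using 1; ring
  | cons t m q u v z ht htn hm h ih =>
    have := dvd_add ih (hd.admissible_step ht htn hm)
    unfold Admissible at *; push_cast at *
    exact this.trans (dvd_of_eq (by ring))

/-- The idempotents are left units for the arrows. -/
structure ArrowSystem.UnitLaws (S : ArrowSystem A) (n : ℕ) (α : ℕ → ℕ) : Prop where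
  e_mul_e : ∀ p, 1 ≤ p → p ≤ n + 1 → S.e p * S.e p = S.e p
  e_mul_X : S.e (n + 1) * S.X = S.X
  e_mul_Y : S.e (n + 1) * S.Y = S.Y
  e_mul_arr : ∀ t m, 1 ≤ t → t ≤ n → m < α t → S.e t * S.arr t m = S.arr t m

/-- The relations between the arrows that make parallel paths of the same weight equal. -/
structure ArrowSystem.Laws (S : ArrowSystem A) (n : ℕ) (α i j : ℕ → ℕ) : Prop
    extends S.UnitLaws n α where
  swap : ∀ t m, 1 ≤ t → t ≤ n → m + 1 < α t → ∃ y x v u,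
    IsPath n α i j S (target n α t m) t 0 v y ∧ IsPath n α i j S (target n α t (m + 1)) t u 0 x ∧
    v + wy j t m = wy j t (m + 1) ∧ u + wx i t (m + 1) = wx i t m ∧
    S.arr t m * y = S.arr t (m + 1) * x
  swap_XY : ∀ t m, 1 ≤ t → t ≤ n → m + 1 < α t → (1 ≤ m ∨ t = 1) → ∃ y z u v,
    IsPath n α i j S 1 t 0 (j t - 1) y ∧ IsPath n α i j S n (n + 1) u v z ∧
    u + 1 = wx i t m ∧ v = j t + wy j t m ∧ S.Y * (y * S.arr t m) = S.X * z

theorem IsPath.e_mul (hS : S.UnitLaws n α) {p q u v : ℕ} {z : A}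
    (h : IsPath n α i j S p q u v z) : S.e p * z = z := by
  cases h with
  | nil p hp hpn => exact hS.e_mul_e _ hp hpn
  | consX q u v z h => rw [← mul_assoc, hS.e_mul_X]
  | consY q u v z h => rw [← mul_assoc, hS.e_mul_Y]
  | cons t m q u v z ht htn hm h => rw [← mul_assoc, hS.e_mul_arr _ _ ht htn hm]

theorem IsPath.mul (hS : S.UnitLaws n α) {p q s u v u' v' : ℕ} {z z' : A}
    (h : IsPath n α i j S p q u v z) (h' : IsPath n α i j S q s u' v' z') :
    IsPath n α i j S p s (u + u') (v + v') (z * z') := by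
  induction h with
  | nil p hp hpn => rwa [h'.e_mul hS, zero_add, zero_add]
  | consX q u v z h ih => rw [mul_assoc, add_right_comm]; exact .consX _ _ _ _ (ih h')
  | consY q u v z h ih => rw [mul_assoc, add_right_comm]; exact .consY _ _ _ _ (ih h')
  | cons t m q u v z ht htn hm h ih =>
    rw [mul_assoc, add_right_comm, add_right_comm v]; exact .cons _ _ _ _ _ _ ht htn hm (ih h')

theorem IsPath.congr {p q u v u' v' : ℕ} {z : A} (h : IsPath n α i j S p q u v z)
    (hu : u = u') (hv : v = v') : IsPath n α i j S p q u' v' z := hu ▸ hv ▸ h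

end Paths

/-! ### Uniqueness of paths with given ends and weight. -/

section Uniqueness

variable {A : Type*} [Monoid A] {n r : ℕ} {α i j : ℕ → ℕ} {S : ArrowSystem A}

theorem Admissible.sub_left {p s q u v u' v' : ℕ} (h : Admissible r i p q (u + u') (v + v'))
    (h' : Admissible r i p s u v) : Admissible r i s q u' v' := by
  have := dvd_sub h h'
  unfold Admissible at *; push_cast at *
  exact this.trans (dvd_of_eq (by ring))

/-- The two sides of the exchange relation `arr m · y = arr (m+1) · x` are loops at `t` whose weight
divides `x^u y^v`. A path `w` realising the quotient exists, and the induction hypothesis gives `z =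
y w` and `z' = x w`. -/
theorem arr_mul_eq_succ (hd : SeriesData n r α i j) (hS : S.Laws n α i j) {q u v t m : ℕ}
    (ih : ∀ p u' v' z z', u' + v' < u + v → IsPath n α i j S p q u' v' z →
      IsPath n α i j S p q u' v' z' → z = z')
    (ht : 1 ≤ t) (htn : t ≤ n) (hm : m + 1 < α t) (hu : wx i t m ≤ u)
    (hv : wy j t (m + 1) ≤ v) {z z' : A}
    (hz : IsPath n α i j S (target n α t m) q (u - wx i t m) (v - wy j t m) z)
    (hz' : IsPath n α i j S (target n α t (m + 1)) q (u - wx i t (m + 1))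
      (v - wy j t (m + 1)) z') :
    S.arr t m * z = S.arr t (m + 1) * z' := by
  obtain ⟨y, x, dv, du, hy, hx, hdv, hdu, hrel⟩ := hS.swap t m ht htn hm
  have hv0 : wy j t m ≤ v := (SeriesData.wy_mono t (Nat.le_succ m)).trans hv
  have hu1 : wx i t (m + 1) ≤ u := (SeriesData.wx_anti t (Nat.le_succ m)).trans hu
  have e1 : u - wx i t m = 0 + (u - wx i t m) := by omega
  have e2 : v - wy j t m = dv + (v - wy j t (m + 1)) := by omega
  have e3 : u - wx i t (m + 1) = du + (u - wx i t m) := by omega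
  have e4 : v - wy j t (m + 1) = 0 + (v - wy j t (m + 1)) := by omega
  have hadm := hz.admissible hd
  rw [e1, e2] at hadm
  obtain ⟨w, hw⟩ := exists_isPath (S := S) hd ht (by omega) hz.mem.2.1 hz.mem.2.2
    (hadm.sub_left (hy.admissible hd))
  have p1 := hd.weight_pos ht htn (m := m) (by omega)
  have p2 := hd.weight_pos ht htn (m := m + 1) (by omega)
  rw [ih _ _ _ _ _ (by omega) hz ((hy.mul hS.toUnitLaws hw).congr e1.symm e2.symm),
    ih _ _ _ _ _ (by omega) hz' ((hx.mul hS.toUnitLaws hw).congr e3.symm e4.symm),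
    ← mul_assoc, hrel, mul_assoc]

/-- Along the chain the `x`-exponent decreases and the `y`-exponent increases, so every arrow
between `m` and `m'` also divides the monomial, and one moves from `m` to `m'` by neighbouring
exchanges. -/
theorem arr_mul_eq (hd : SeriesData n r α i j) (hS : S.Laws n α i j) {q u v t m m' : ℕ}
    (ih : ∀ p u' v' z z', u' + v' < u + v → IsPath n α i j S p q u' v' z →
      IsPath n α i j S p q u' v' z' → z = z')
    (ht : 1 ≤ t) (htn : t ≤ n) (hmm : m ≤ m') (hm : m' < α t) (hu : wx i t m ≤ u)
    (hv : wy j t m' ≤ v) {z z' : A}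
    (hz : IsPath n α i j S (target n α t m) q (u - wx i t m) (v - wy j t m) z)
    (hz' : IsPath n α i j S (target n α t m') q (u - wx i t m') (v - wy j t m') z') :
    S.arr t m * z = S.arr t m' * z' := by
  induction m', hmm using Nat.le_induction generalizing z' with
  | base =>
    have p1 := hd.weight_pos ht htn (m := m) (by omega)
    rw [ih _ _ _ _ _ (by omega) hz hz']
  | succ k hmk ihk =>
    have hvk : wy j t k ≤ v := (SeriesData.wy_mono t (Nat.le_succ k)).trans hv
    have huk : wx i t k ≤ u := (SeriesData.wx_anti t hmk).trans hu
    have hadm := (hz'.cons _ _ _ _ _ _ ht htn hm).admissible hd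
    rw [Nat.sub_add_cancel hv,
      Nat.sub_add_cancel ((SeriesData.wx_anti t (Nat.le_succ k)).trans huk)] at hadm
    obtain ⟨w, hw⟩ := exists_isPath (S := S) hd (SeriesData.target_mem ht htn).1
      (SeriesData.target_mem ht htn).2 hz.mem.2.1 hz.mem.2.2
      (hd.admissible_sub ht htn (by omega) huk hvk hadm)
    exact (ihk (by omega) hvk hw).trans
      (arr_mul_eq_succ hd hS ih ht htn hm huk hv hw hz')

/-- The relation `swap_XY` writes one loop at `n + 1`, of weight `x^(wx) y^(j_t + wy)`, as a path
beginning with `Y` and as one beginning with `X`. When this weight divides the monomial, both given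
paths are that loop followed by the same remainder. -/
theorem X_mul_eq_of_le (hd : SeriesData n r α i j) (hS : S.Laws n α i j) {q u v t m : ℕ}
    (ih : ∀ p u' v' z z', u' + v' < u + 1 + (v + 1) → IsPath n α i j S p q u' v' z →
      IsPath n α i j S p q u' v' z' → z = z')
    (ht : 1 ≤ t) (htn : t ≤ n) (hm : m + 1 < α t) (hmt : 1 ≤ m ∨ t = 1)
    (hu : wx i t m ≤ u + 1) (hv : j t + wy j t m ≤ v + 1) {z z' : A}
    (hz : IsPath n α i j S n q u (v + 1) z) (hz' : IsPath n α i j S 1 q (u + 1) v z') :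
    S.X * z = S.Y * z' := by
  obtain ⟨y, x, du, dv, hy, hx, hdu, hdv, hrel⟩ := hS.swap_XY t m ht htn hm hmt
  have hj : 1 ≤ j t := by have := hd.j_le ht (by omega); rwa [hd.j_one] at this
  have e1 : u = du + (u - du) := by omega
  have e2 : v + 1 = dv + (v + 1 - dv) := by omega
  have hadm := hz.admissible hd
  rw [e1, e2] at hadm
  obtain ⟨w, hw⟩ := exists_isPath (S := S) hd (by omega) le_rfl hz.mem.2.1 hz.mem.2.2
    (hadm.sub_left (hx.admissible hd))
  have ht' : target n α t m = n + 1 := by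
    unfold target
    rcases hmt with h | h
    · rw [if_neg (by omega), if_neg (by omega)]
    · rw [if_pos h]; split_ifs <;> omega
  have harr : IsPath n α i j S t q _ _ (S.arr t m * w) :=
    .cons t m q _ _ w ht htn (by omega) (ht' ▸ hw)
  rw [ih _ _ _ _ _ (by omega) hz ((hx.mul hS.toUnitLaws hw).congr e1.symm e2.symm),
    ih _ _ _ _ _ (by omega) hz' ((hy.mul hS.toUnitLaws harr).congr (by omega) (by omega)),
    ← mul_assoc, ← hrel, mul_assoc, mul_assoc]

/-- A loop of weight `(i_{t-1} - i_t, j_t)` is available for `t = 1` through the arrow `m = 0` at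
vertex `1`. Passing to `t + 1`, the weight `(i_t - i_{t+1}, j_{t+1})` is that of the loop through
the last but one arrow `m = α_t - 2` at `t`. -/
theorem X_mul_eq_of_series_le (hd : SeriesData n r α i j) (hS : S.Laws n α i j) {q u v t : ℕ}
    (ih : ∀ p u' v' z z', u' + v' < u + 1 + (v + 1) → IsPath n α i j S p q u' v' z →
      IsPath n α i j S p q u' v' z' → z = z')
    (ht : 1 ≤ t) (htn : t ≤ n + 1)
    (hu : i (t - 1) ≤ i t + (u + 1)) (hv : j t ≤ v + 1) {z z' : A}
    (hz : IsPath n α i j S n q u (v + 1) z) (hz' : IsPath n α i j S 1 q (u + 1) v z') :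
    S.X * z = S.Y * z' := by
  induction t, ht using Nat.le_induction with
  | base =>
    exact X_mul_eq_of_le hd hS ih le_rfl hd.n_pos (m := 0)
      (by have := hd.two_le 1 le_rfl hd.n_pos; omega) (Or.inr rfl)
      (by rw [SeriesData.wx_zero]; omega) (by rwa [SeriesData.wy_zero]) hz hz'
  | succ t ht iht =>
    have h2 := hd.two_le t ht (by omega)
    have hi := hd.i_rec t ht (by omega)
    have hj := hd.j_rec t ht (by omega)
    rw [Nat.add_sub_cancel] at hu
    by_cases h : 1 ≤ α t - 2 ∨ t = 1
    · refine X_mul_eq_of_le hd hS ih ht (by omega) (m := α t - 2) (by omega) h ?_ ?_ hz hz'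
      · have := hd.wx_cast ht (by omega) (m := α t - 2) (by omega)
        zify [h2] at *
        rw [this]; linarith
      · rcases Nat.eq_zero_or_pos (α t - 2) with h0 | h0
        · rw [h0, SeriesData.wy_zero]
          exact (hd.j_lt t (by omega)).le.trans hv
        · have := hd.wy_cast (t := t) (by omega) (m := α t - 2) (by omega)
          zify [h2] at *
          rw [this]; linarith
    -- There is no extra arrow at `t`, but then `i_{t-1} - i_t = i_t - i_{t+1}`, so the bounds hold
    -- for `t` as well and one descends.
    · have h2' : α t = 2 := by omega
      rw [h2'] at hi
      exact iht (by omega) (by omega) ((hd.j_lt t (by omega)).le.trans hv)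

/-- It remains to find a loop whose weight divides the monomial. Choose `t` with `j_t ≤ v + 1 <
j_{t+1}`, remove `y^(j_t)` to arrive at vertex `t`, and let `exists_step` choose the arrow. If `v +
1 ≥ j_{n+1}`, the case `t = n + 1` works since `i_n - i_{n+1} = 1`. -/
theorem X_mul_eq (hd : SeriesData n r α i j) (hS : S.Laws n α i j) {q u v : ℕ}
    (ih : ∀ p u' v' z z', u' + v' < u + 1 + (v + 1) → IsPath n α i j S p q u' v' z →
      IsPath n α i j S p q u' v' z' → z = z') {z z' : A}
    (hz : IsPath n α i j S n q u (v + 1) z) (hz' : IsPath n α i j S 1 q (u + 1) v z') :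
    S.X * z = S.Y * z' := by
  by_cases hr : j (n + 1) ≤ v + 1
  · exact X_mul_eq_of_series_le hd hS ih (by omega) le_rfl
      (by simp [hd.i_last, hd.i_n]) hr hz hz'
  obtain ⟨t, ht, htn, htv, htv'⟩ : ∃ t, 1 ≤ t ∧ t ≤ n ∧ j t ≤ v + 1 ∧ v + 1 < j (t + 1) := by
    have h1 := Nat.find_spec (⟨_, not_le.1 hr⟩ : ∃ t, v + 1 < j t)
    set k := Nat.find (⟨_, not_le.1 hr⟩ : ∃ t, v + 1 < j t) with hk
    have h2 : k ≤ n + 1 := Nat.find_min' _ (not_le.1 hr)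
    have h3 : 2 ≤ k := by
      by_contra h
      have := hd.j_le (s := k) (t := 1) (by omega) (by omega)
      rw [hd.j_one] at this; omega
    refine ⟨k - 1, by omega, by omega, ?_, by rwa [Nat.sub_add_cancel (by omega)]⟩
    by_contra h
    exact Nat.find_min (⟨_, not_le.1 hr⟩ : ∃ t, v + 1 < j t) (by omega : k - 1 < k) (not_le.1 h)
  have hadm : Admissible r i t q (u + 1) (v + 1 - j t) := by
    have h1 := (IsPath.consX _ _ _ _ hz).admissible hd
    have h2 := hd.cong t (by omega)
    unfold Admissible at *
    rw [hd.i_last] at h1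
    rw [Nat.cast_sub htv]
    have := dvd_sub h1 h2
    push_cast at *
    exact this.trans (dvd_of_eq (by ring))
  obtain ⟨m, hm, hmu, hmv⟩ := hd.exists_step ht htn hz.mem.2.2 hadm (by omega)
  -- The anticlockwise end of the chain would require `v + 1 ≥ j_{t+1}`.
  have hm' : m + 1 < α t := by
    by_contra h
    have := hd.wy_last ht htn (m := m) (by omega)
    omega
  rcases Nat.eq_zero_or_pos m with rfl | h0
  · rw [SeriesData.wx_zero] at hmu
    exact X_mul_eq_of_series_le hd hS ih ht (by omega) (by omega) htv hz hz'
  · exact X_mul_eq_of_le hd hS ih ht htn hm' (Or.inl h0) hmu (by omega) hz hz'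

/-- Parallel paths of the same weight are equal. -/
theorem IsPath.unique (hd : SeriesData n r α i j) (hS : S.Laws n α i j) {p q u v : ℕ} {z z' : A}
    (h : IsPath n α i j S p q u v z) (h' : IsPath n α i j S p q u v z') : z = z' := by
  induction hN : u + v using Nat.strong_induction_on generalizing p u v z z' with
  | _ N ih =>
  subst hN
  have ih : ∀ p u' v' z z', u' + v' < u + v → IsPath n α i j S p q u' v' z →
      IsPath n α i j S p q u' v' z' → z = z' :=
    fun p u' v' z z' hlt h h' => ih _ hlt h h' rfl
  generalize hp' : p = p' at h'
  generalize hu' : u = u' at h'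
  generalize hv' : v = v' at h'
  cases h with
  | nil _ hp hpn =>
    cases h' with
    | nil => rw [hp']
    | consX => omega
    | consY => omega
    | cons t m q u v z ht htn hm h => have := hd.weight_pos ht htn hm; omega
  | consX _ u v z h =>
    cases h' with
    | nil => omega
    | consX _ u' v' z' h' =>
      obtain rfl : u = u' := by omega
      subst hv'
      rw [ih _ _ _ _ _ (by omega) h h']
    -- The only pair of different first arrows at vertex `n + 1`.
    | consY _ u' v' z' h' =>
      subst hu' hv'
      exact X_mul_eq hd hS ih h h'
    | cons t m q u v z ht htn hm h => omega
  | consY _ u v z h =>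
    cases h' with
    | nil => omega
    | consX _ u' v' z' h' =>
      subst hu' hv'
      exact (X_mul_eq hd hS ih h' h).symm
    | consY _ u' v' z' h' =>
      obtain rfl : v = v' := by omega
      subst hu'
      rw [ih _ _ _ _ _ (by omega) h h']
    | cons t m q u v z ht htn hm h => omega
  | cons t m q u v z ht htn hm h =>
    cases h' with
    | nil => have := hd.weight_pos ht htn hm; omega
    | consX => omega
    | consY => omega
    | cons _ m' _ u' v' z' _ _ hm' h' =>
      subst hp'
      have h0 : IsPath n α i j S (target n α p m) q (u + wx i p m - wx i p m)
        (v + wy j p m - wy j p m) z := h.congr (by omega) (by omega)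
      have h0' : IsPath n α i j S (target n α p m') q (u + wx i p m - wx i p m')
        (v + wy j p m - wy j p m') z' := h'.congr (by omega) (by omega)
      rcases le_total m m' with hmm | hmm
      · exact arr_mul_eq hd hS ih ht htn hmm hm' (by omega) (by omega) h0 h0'
      · exact (arr_mul_eq hd hS ih ht htn hmm hm (by omega) (by omega) h0' h0).symm

end Uniqueness

section Monomials

/-! ## Monomials and semi-invariants -/

/-- The exponent of `x ^ u * y ^ v`. -/
def expo (u v : ℕ) : Fin 2 →₀ ℕ := Finsupp.single 0 u + Finsupp.single 1 v

@[simp] theorem expo_zero (u v : ℕ) : expo u v 0 = u := by simp [expo]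

@[simp] theorem expo_one (u v : ℕ) : expo u v 1 = v := by simp [expo]

theorem expo_self (d : Fin 2 →₀ ℕ) : expo (d 0) (d 1) = d := by
  ext k; fin_cases k <;> simp

theorem expo_add (u v u' v' : ℕ) : expo u v + expo u' v' = expo (u + u') (v + v') := by
  ext k; fin_cases k <;> simp

/-- The monomial `x ^ u * y ^ v`. -/
def mono (u v : ℕ) : Poly := monomial (expo u v) 1

theorem mono_mul (u v u' v' : ℕ) : mono u v * mono u' v' = mono (u + u') (v + v') := by
  rw [mono, mono, monomial_mul, expo_add, one_mul, mono]

theorem mono_zero : mono 0 0 = 1 := by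
  rw [mono, show expo 0 0 = 0 by ext k; fin_cases k <;> simp]; rfl

theorem mono_ne_zero (u v : ℕ) : mono u v ≠ 0 := by simp [mono]

theorem substitute_mul (g h : GL (Fin 2) ℂ) :
    substitute (g * h) = (substitute g).comp (substitute h) := by
  ext1 k
  simp only [substitute, aeval_X, AlgHom.comp_apply, map_sum, map_mul, algHom_C,
    Units.val_mul, Matrix.mul_apply, algebraMap_eq, Finset.sum_mul, Finset.mul_sum]
  rw [Finset.sum_comm]
  refine Finset.sum_congr rfl fun x _ => Finset.sum_congr rfl fun y _ => ?_
  ring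

theorem substitute_one : substitute 1 = AlgHom.id ℂ Poly := by
  ext1 k
  fin_cases k <;> simp [substitute, Matrix.one_apply]

variable {ε : ℂˣ} {a r : ℕ}

/-- The stabiliser of `f` is a subgroup, so it suffices to test the generator. -/
theorem mem_invariants_of_zeta {f : Poly} (h : substitute (zeta ε a) f = f) :
    f ∈ invariants (cyclicGroup ε a) := by
  let H : Subgroup (GL (Fin 2) ℂ) :=
    { carrier := {g | substitute g f = f}
      mul_mem' := fun {g g'} hg hg' => by
        change substitute (g * g') f = f
        rw [substitute_mul, AlgHom.comp_apply, show substitute g' f = f from hg']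
        exact hg
      one_mem' := by change substitute 1 f = f; rw [substitute_one]; rfl
      inv_mem' := fun {g} hg => by
        change substitute g⁻¹ f = f
        conv_lhs => rw [← show substitute g f = f from hg]
        rw [← AlgHom.comp_apply, ← substitute_mul, inv_mul_cancel, substitute_one]; rfl }
  exact fun g hg => (Subgroup.zpowers_le (H := H)).2 h hg

theorem coeff_substitute (f : Poly) (d : Fin 2 →₀ ℕ) :
    coeff d (substitute (zeta ε a) f) = (ε : ℂ) ^ (d 0 + a * d 1) * coeff d f := by
  induction f using MvPolynomial.induction_on' with
  | monomial e c =>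
    have : substitute (zeta ε a) (monomial e c) = C ((ε : ℂ) ^ (e 0 + a * e 1)) * monomial e c := by
      have h0 : (zeta ε a).1 = Matrix.diagonal ![(ε : ℂ), (ε : ℂ) ^ a] := by
        ext k l
        fin_cases k <;> fin_cases l <;> simp [zeta, Matrix.diagonal]
      rw [substitute, aeval_monomial, h0, monomial_eq, Finsupp.prod_fintype _ _ (by simp),
        Finsupp.prod_fintype _ _ (by simp)]
      simp [Fin.sum_univ_two, Matrix.diagonal, mul_pow, pow_add, pow_mul, algebraMap_eq]
      ring
    rw [this, coeff_C_mul, coeff_monomial]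
    split_ifs with h
    · rw [h]
    · simp
  | add p q hp hq => rw [map_add, coeff_add, coeff_add, hp, hq, mul_add]

/-- `ζ` is diagonal on monomials, so being semi-invariant is a congruence on each exponent that
occurs. -/
theorem mem_semiInvariants_iff (hε : IsPrimitiveRoot ε r) {t : ℤ} {f : Poly} :
    f ∈ semiInvariants ε a t ↔ ∀ d, coeff d f ≠ 0 → (r : ℤ) ∣ d 0 + a * d 1 - t := by
  have key : ∀ d : Fin 2 →₀ ℕ, (ε : ℂ) ^ (d 0 + a * d 1) = ((ε ^ t : ℂˣ) : ℂ) ↔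
      (r : ℤ) ∣ d 0 + a * d 1 - t := by
    intro d
    rw [← hε.zpow_eq_one_iff_dvd, zpow_sub, mul_inv_eq_one, ← Units.val_pow_eq_pow_val,
      Units.val_inj, ← zpow_natCast]
    push_cast
    rfl
  change substitute (zeta ε a) f = C ((ε ^ t : ℂˣ) : ℂ) * f ↔ _
  rw [MvPolynomial.ext_iff]
  refine forall_congr' fun d => ?_
  rw [coeff_substitute, coeff_C_mul, ← key d, mul_eq_mul_right_iff]
  tauto

theorem mono_mem_semiInvariants (hε : IsPrimitiveRoot ε r) {t : ℤ} {u v : ℕ}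
    (h : (r : ℤ) ∣ u + a * v - t) : mono u v ∈ semiInvariants ε a t := by
  rw [mem_semiInvariants_iff hε]
  intro d hd
  rw [mono, coeff_monomial] at hd
  obtain rfl : expo u v = d := by by_contra h; simp [h] at hd
  simpa using h

theorem mul_mem_semiInvariants {s t : ℤ} {f g : Poly} (hf : f ∈ semiInvariants ε a s)
    (hg : g ∈ semiInvariants ε a t) : f * g ∈ semiInvariants ε a (s + t) := by
  change substitute _ _ = _
  change substitute _ _ = _ at hf hg
  rw [map_mul, hf, hg, zpow_add, Units.val_mul, C_mul]; ring

theorem mem_invariants_of_semiInvariants (hε : IsPrimitiveRoot ε r) {t : ℤ} {f : Poly}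
    (hf : f ∈ semiInvariants ε a t) (ht : (r : ℤ) ∣ t) : f ∈ invariants (cyclicGroup ε a) := by
  apply mem_invariants_of_zeta
  have h : substitute _ _ = _ := hf
  rw [h, (hε.zpow_eq_one_iff_dvd t).2 ht, Units.val_one, C_1, one_mul]

end Monomials

section Homs

variable {ε : ℂˣ} {a r : ℕ}

set_option synthInstance.maxHeartbeats 400000

/-! ## Homomorphisms between modules of semi-invariants -/

theorem mono_dvd_of_dvd_mul {u v : ℕ} {f : Poly} (h : mono u 0 ∣ mono 0 v * f) :
    mono u 0 ∣ f := by
  rw [mono, monomial_one_dvd_iff_modMonomial_eq_zero] at h ⊢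
  ext d
  by_cases hd : expo u 0 ≤ d
  · rw [coeff_modMonomial_of_le _ hd, coeff_zero]
  · have hd' : ¬ expo u 0 ≤ expo 0 v + d := by
      refine fun h1 => hd fun k => ?_
      have := h1 k
      fin_cases k
      · simpa using this
      · simp
    rw [coeff_modMonomial_of_not_le _ hd, ← one_mul (coeff d f), ← coeff_monomial_mul,
      ← coeff_modMonomial_of_not_le _ hd', ← mono, h, coeff_zero, coeff_zero]

/-- Linearity gives `f φ(g) = g φ(f)`, so `φ` is multiplication by the fraction `φ(x^ix) / x^ix`.
Comparing with `y^jy`, which is coprime to `x^ix`, shows that the fraction is a polynomial. -/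
theorem exists_eq_mul_of_linearMap (hε : IsPrimitiveRoot ε r) (hr : r ≠ 0) {s : ℤ} {ix jy : ℕ}
    (hx : mono ix 0 ∈ semiInvariants ε a s) (hy : mono 0 jy ∈ semiInvariants ε a s)
    (φ : semiInvariants ε a s →ₗ[invariants (cyclicGroup ε a)] Poly) :
    ∃ h : Poly, ∀ f, φ f = f * h := by
  have hcomm : ∀ f g : semiInvariants ε a s, (f : Poly) * φ g = g * φ f := by
    intro f g
    -- Multiplying by `x^(ix (r-1))` gives `f` the character `r s`, which is trivial; only then can
    -- it be moved through `φ` as a scalar.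
    have hk : ∀ f : semiInvariants ε a s,
        mono ix 0 ^ (r - 1) * (f : Poly) ∈ invariants (cyclicGroup ε a) := by
      intro f
      have hp : ∀ k : ℕ, mono ix 0 ^ k ∈ semiInvariants ε a (k * s) := by
        intro k
        induction k with
        | zero =>
          rw [pow_zero, ← mono_zero]
          exact mono_mem_semiInvariants hε (by simp)
        | succ k ih =>
          have := mul_mem_semiInvariants ih hx
          rw [pow_succ]
          convert this using 2
          push_cast; ring
      refine mem_invariants_of_semiInvariants hε (mul_mem_semiInvariants (hp _) f.2) ⟨s, ?_⟩
      rw [Nat.cast_sub (Nat.one_le_iff_ne_zero.2 hr)]; push_cast; ring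
    have h1 : φ ((⟨_, hk f⟩ : invariants (cyclicGroup ε a)) • g) =
        φ ((⟨_, hk g⟩ : invariants (cyclicGroup ε a)) • f) := by
      congr 1
      ext1
      simp only [Submodule.coe_smul, Subalgebra.smul_def, smul_eq_mul]
      ring
    rw [map_smul, map_smul, Subalgebra.smul_def, Subalgebra.smul_def, smul_eq_mul,
      smul_eq_mul, mul_assoc, mul_assoc] at h1
    exact mul_left_cancel₀ (pow_ne_zero _ (mono_ne_zero _ _)) h1
  have hdvd : mono ix 0 ∣ φ ⟨_, hx⟩ :=
    mono_dvd_of_dvd_mul ⟨_, (hcomm ⟨_, hx⟩ ⟨_, hy⟩).symm⟩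
  obtain ⟨h, hh⟩ := hdvd
  refine ⟨h, fun f => ?_⟩
  have := hcomm ⟨_, hx⟩ f
  rw [hh, mul_left_comm] at this
  exact mul_left_cancel₀ (mono_ne_zero _ _) this

/-- A family of modules of semi-invariants, each of which contains a power of `x` and a power
of `y`. -/
structure GoodFamily (ε : ℂˣ) (a r k : ℕ) (s : Fin k → ℤ) (ix jy : Fin k → ℕ) : Prop where
  prim : IsPrimitiveRoot ε r
  ne_zero : r ≠ 0
  x_mem : ∀ p, mono (ix p) 0 ∈ semiInvariants ε a (s p)
  y_mem : ∀ p, mono 0 (jy p) ∈ semiInvariants ε a (s p)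

section Endomorphisms

variable {k : ℕ} {s : Fin k → ℤ} {ix jy : Fin k → ℕ}

/-- The direct sum of a family of modules of semi-invariants. -/
abbrev SumModule (ε : ℂˣ) (a : ℕ) {k : ℕ} (s : Fin k → ℤ) : Type :=
  DirectSum (Fin k) fun p => semiInvariants ε a (s p)

/-- The endomorphism ring of the sum. -/
abbrev EndSum (ε : ℂˣ) (a : ℕ) {k : ℕ} (s : Fin k → ℤ) : Type :=
  Module.End (invariants (cyclicGroup ε a)) (SumModule ε a s)

/-- The inclusion of a summand. -/
def incl (p : Fin k) (f : semiInvariants ε a (s p)) : SumModule ε a s :=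
  DirectSum.lof (invariants (cyclicGroup ε a)) (Fin k) (fun p => semiInvariants ε a (s p)) p f

theorem GoodFamily.exists_entry (h : GoodFamily ε a r k s ix jy) (φ : EndSum ε a s)
    (p q : Fin k) : ∃ g : Poly, ∀ f, ((φ (incl p f) q : semiInvariants ε a (s q)) : Poly) = f * g :=
  exists_eq_mul_of_linearMap h.prim h.ne_zero (h.x_mem p) (h.y_mem p)
    ((semiInvariants ε a (s q)).subtype ∘ₗ DirectSum.component (invariants (cyclicGroup ε a))
      (Fin k) (fun p => semiInvariants ε a (s p)) q ∘ₗ φ ∘ₗ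
      DirectSum.lof (invariants (cyclicGroup ε a)) (Fin k) (fun p => semiInvariants ε a (s p)) p)

/-- The polynomial by which an endomorphism multiplies the summand `p` into the summand `q`. -/
def GoodFamily.entry (h : GoodFamily ε a r k s ix jy) (φ : EndSum ε a s) (p q : Fin k) : Poly :=
  (h.exists_entry φ p q).choose

theorem GoodFamily.entry_spec (h : GoodFamily ε a r k s ix jy) (φ : EndSum ε a s)
    (p q : Fin k) (f : semiInvariants ε a (s p)) :
    ((φ (incl p f) q : semiInvariants ε a (s q)) : Poly) = f * h.entry φ p q :=
  (h.exists_entry φ p q).choose_spec f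

theorem GoodFamily.entry_eq (h : GoodFamily ε a r k s ix jy) (φ : EndSum ε a s) (p q : Fin k)
    (g : Poly) (hg : ∀ f, ((φ (incl p f) q : semiInvariants ε a (s q)) : Poly) = f * g) :
    h.entry φ p q = g := by
  have h1 := hg ⟨_, h.x_mem p⟩
  rw [h.entry_spec] at h1
  exact mul_left_cancel₀ (mono_ne_zero _ _) h1

theorem incl_apply_self (p : Fin k) (f : semiInvariants ε a (s p)) : (incl p f) p = f := by
  simp [incl, DirectSum.lof_eq_of]

theorem incl_apply_ne {p q : Fin k} (hpq : p ≠ q) (f : semiInvariants ε a (s p)) :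
    (incl p f) q = 0 := by
  simp only [incl, DirectSum.lof_eq_of]
  exact DirectSum.of_eq_of_ne _ _ _ hpq.symm

theorem sum_incl (x : SumModule ε a s) : ∑ p, incl p (x p) = x := by
  simp only [incl, DirectSum.lof_eq_of]
  exact DirectSum.sum_univ_of x

/-- The matrix of an endomorphism; the product of endomorphisms being read from left to
right. -/
def GoodFamily.toMatrix (h : GoodFamily ε a r k s ix jy) :
    (EndSum ε a s)ᵐᵒᵖ →ₐ[ℂ] Matrix (Fin k) (Fin k) Poly where
  toFun φ := Matrix.of fun p q => h.entry φ.unop p q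
  map_one' := by
    ext1 p q
    refine h.entry_eq _ _ _ _ fun f => ?_
    rw [Matrix.one_apply, MulOpposite.unop_one, Module.End.one_apply]
    split_ifs with hpq
    · subst hpq; rw [incl_apply_self, mul_one]
    · rw [incl_apply_ne hpq, mul_zero]; rfl
  map_mul' φ ψ := by
    ext1 p q
    refine h.entry_eq _ _ _ _ fun f => ?_
    rw [MulOpposite.unop_mul, Module.End.mul_apply, ← sum_incl (φ.unop (incl p f)), map_sum,
      DFinsupp.finsetSum_apply, Submodule.coe_sum, Matrix.mul_apply, Finset.mul_sum]
    refine Finset.sum_congr rfl fun l _ => ?_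
    rw [h.entry_spec, h.entry_spec, Matrix.of_apply, Matrix.of_apply, mul_assoc]
  map_zero' := by
    ext1 p q
    refine h.entry_eq _ _ _ _ fun f => ?_
    simp
  map_add' φ ψ := by
    ext1 p q
    refine h.entry_eq _ _ _ _ fun f => ?_
    rw [MulOpposite.unop_add, LinearMap.add_apply, DFinsupp.add_apply, Submodule.coe_add,
      h.entry_spec, h.entry_spec, ← mul_add]
    rfl
  commutes' c := by
    ext1 p q
    refine h.entry_eq _ _ _ _ fun f => ?_
    rw [MulOpposite.algebraMap_apply, MulOpposite.unop_op, Module.algebraMap_end_apply,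
      Matrix.algebraMap_matrix_apply]
    split_ifs with hpq
    · subst hpq
      rw [DFinsupp.smul_apply, incl_apply_self, mul_comm, ← Algebra.smul_def]; rfl
    · rw [DFinsupp.smul_apply, incl_apply_ne hpq, mul_zero, smul_zero]; rfl

theorem GoodFamily.toMatrix_apply (h : GoodFamily ε a r k s ix jy) (φ : (EndSum ε a s)ᵐᵒᵖ)
    (p q : Fin k) : h.toMatrix φ p q = h.entry φ.unop p q := rfl

theorem GoodFamily.toMatrix_injective (h : GoodFamily ε a r k s ix jy) :
    Function.Injective h.toMatrix := by
  intro φ ψ hφψ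
  apply MulOpposite.unop_injective
  refine LinearMap.ext fun x => ?_
  rw [← sum_incl x, map_sum, map_sum]
  refine Finset.sum_congr rfl fun p _ => DFinsupp.ext fun q => Subtype.ext ?_
  rw [h.entry_spec, h.entry_spec, ← h.toMatrix_apply, hφψ, h.toMatrix_apply]

/-- Evaluate at the power of `x` in the summand `p`: multiplication by it only shifts exponents, so
the congruence for the image carries over to the entry. -/
theorem GoodFamily.toMatrix_mem (h : GoodFamily ε a r k s ix jy) (φ : (EndSum ε a s)ᵐᵒᵖ)
    (p q : Fin k) (d : Fin 2 →₀ ℕ) (hd : coeff d (h.toMatrix φ p q) ≠ 0) :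
    (r : ℤ) ∣ s p + d 0 + a * d 1 - s q := by
  have h1 := h.entry_spec φ.unop p q ⟨_, h.x_mem p⟩
  have h2 := (mem_semiInvariants_iff h.prim).1 (Subtype.prop (φ.unop (incl p ⟨_, h.x_mem p⟩) q))
    (expo (ix p) 0 + d)
  rw [h1] at h2
  simp only [mono] at h2
  rw [coeff_monomial_mul, one_mul] at h2
  have h3 := h2 hd
  have h4 := (mem_semiInvariants_iff h.prim).1 (h.x_mem p) (expo (ix p) 0) (by simp [mono])
  have := dvd_sub h3 h4
  refine this.trans (dvd_of_eq ?_)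
  simp
  ring

theorem GoodFamily.single_mem_range (h : GoodFamily ε a r k s ix jy) (p q : Fin k) (u v : ℕ)
    (huv : (r : ℤ) ∣ s p + u + a * v - s q) :
    Matrix.single p q (mono u v) ∈ h.toMatrix.range := by
  have hm : mono u v ∈ semiInvariants ε a (s q - s p) :=
    mono_mem_semiInvariants h.prim (huv.trans (dvd_of_eq (by ring)))
  let μ : Poly →ₗ[invariants (cyclicGroup ε a)] Poly := LinearMap.mulLeft _ (mono u v)
  let ν : semiInvariants ε a (s p) →ₗ[invariants (cyclicGroup ε a)] semiInvariants ε a (s q) :=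
    μ.restrict fun f hf => by
      have := mul_mem_semiInvariants hm hf
      rwa [sub_add_cancel] at this
  refine ⟨MulOpposite.op (DirectSum.lof _ _ _ q ∘ₗ ν ∘ₗ DirectSum.component _ _ _ p), ?_⟩
  ext1 p' q'
  refine h.entry_eq _ _ _ _ fun f => ?_
  change ((incl q (ν ((incl p' f) p)) q' : semiInvariants ε a (s q')) : Poly) = _
  by_cases hp : p' = p
  · subst hp
    rw [incl_apply_self]
    by_cases hq : q = q'
    · subst hq
      rw [incl_apply_self, Matrix.single_apply_same]
      exact mul_comm _ _
    · rw [incl_apply_ne hq, Matrix.single_apply_of_ne _ _ _ _ _ (by tauto), mul_zero]; rfl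
  · rw [incl_apply_ne hp, map_zero, Matrix.single_apply_of_ne _ _ _ _ _ (by tauto), mul_zero]
    simp [incl]

end Endomorphisms

end Homs

/-! ## The series of a Jung–Hirzebruch continued fraction -/

/-- The `i`-series as natural numbers. -/
def iNat (r a : ℕ) (α : List ℕ) (t : ℕ) : ℕ := (iSeries r a α t).toNat

/-- The `j`-series `j_0 = 0`, `j_1 = 1`, `j_t = α_{t-1} j_{t-1} - j_{t-2}`. -/
def jSeries (α : List ℕ) : ℕ → ℕ
  | 0 => 0
  | 1 => 1
  | t + 2 => label α (t + 1) * jSeries α (t + 1) - jSeries α t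

theorem label_cons_succ (x : ℕ) (l : List ℕ) (t : ℕ) :
    label (x :: l) (t + 2) = label l (t + 1) := by
  simp [label]

/-- One division step `r/a = x - 1/(a/b)` shifts the series, which allows induction on the continued
fraction. -/
theorem iSeries_cons (r a x : ℕ) (l : List ℕ) (b : ℕ) (hb : (b : ℤ) = x * a - r) (t : ℕ) :
    iSeries r a (x :: l) (t + 1) = iSeries a b l t := by
  induction t using Nat.twoStepInduction with
  | zero => simp [iSeries]
  | one => simp [iSeries, label, hb]
  | more t ih1 ih2 =>
    rw [show t + 2 + 1 = (t + 1) + 2 by ring, iSeries, ih1, ih2, iSeries, label_cons_succ]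

theorem one_lt_fractionValue : ∀ {α : List ℕ}, α ≠ [] → (∀ x ∈ α, 2 ≤ x) → 1 < fractionValue α
  | [x], _, h => by
    have : 2 ≤ x := h x (by simp)
    simp only [fractionValue]; exact_mod_cast this
  | x :: y :: l, _, h => by
    have h1 := one_lt_fractionValue (α := y :: l) (by simp) fun z hz => h z (by simp_all)
    have h2 : (2 : ℚ) ≤ x := by exact_mod_cast h x (by simp)
    have h3 : 1 / fractionValue (y :: l) < 1 := by
      rw [div_lt_one (by linarith)]; exact h1
    simp only [fractionValue]; linarith

theorem iSeries_spec {α : List ℕ} (hne : α ≠ []) {r a : ℕ} (ha : 0 < a) (har : a < r)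
    (hcop : Nat.Coprime r a) (hα : IsJungHirzebruch r a α) :
    iSeries r a α (α.length + 1) = 0 ∧ iSeries r a α α.length = 1 ∧
      ∀ t ≤ α.length, iSeries r a α (t + 1) < iSeries r a α t := by
  induction α generalizing r a with
  | nil => exact absurd rfl hne
  | cons x l ih =>
    obtain ⟨h2, hr⟩ := hα
    have ha0 : (a : ℚ) ≠ 0 := by exact_mod_cast ha.ne'
    cases l with
    | nil =>
      simp only [fractionValue] at hr
      rw [div_eq_iff ha0] at hr
      have hr : r = x * a := by exact_mod_cast hr
      -- The last division is exact, and coprimality forces the divisor to be `1`; this is why the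
      -- series ends with `1, 0`.
      obtain rfl : a = 1 := by
        have := Nat.dvd_gcd (Dvd.intro_left x hr.symm) (dvd_refl a)
        rw [hcop] at this
        exact Nat.dvd_one.1 this
      refine ⟨by simp [iSeries, label, hr], by simp [iSeries], fun t ht => ?_⟩
      simp at ht
      interval_cases t
      · simpa [iSeries] using har
      · simp [iSeries, label, hr]
    | cons y l =>
      have h1 : 1 < fractionValue (y :: l) :=
        one_lt_fractionValue (by simp) fun z hz => h2 z (by simp_all)
      simp only [fractionValue] at hr
      -- The tail has value `a / (x a - r)`. As it exceeds `1`, the next remainder lies strictly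
      -- between `0` and `a`.
      have hF : (x * a - r : ℚ) * fractionValue (y :: l) = a := by
        field_simp at hr ⊢
        linarith
      have hb0 : (0 : ℚ) < x * a - r := by
        by_contra h
        have : (0 : ℚ) < a := by exact_mod_cast ha
        nlinarith
      have hb : r < x * a := by
        have : (r : ℚ) < x * a := by linarith
        exact_mod_cast this
      obtain ⟨b, hb⟩ := Nat.exists_eq_add_of_lt hb
      have hbq : ((b + 1 : ℕ) : ℚ) = x * a - r := by
        have : ((x * a : ℕ) : ℚ) = (r + b + 1 : ℕ) := by rw [hb]
        push_cast at *; linarith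
      have hbz : ((b + 1 : ℕ) : ℤ) = x * a - r := by
        have : ((x * a : ℕ) : ℤ) = (r + b + 1 : ℕ) := by rw [hb]
        push_cast at *; linarith
      have hba : b + 1 < a := by
        have : ((b + 1 : ℕ) : ℚ) < a := by
          rw [hbq, ← hF]; nlinarith
        exact_mod_cast this
      have hc : Nat.Coprime a (b + 1) := by
        rw [Nat.coprime_comm]
        have h3 : (b + 1).gcd a ∣ x * a := (Nat.gcd_dvd_right _ _).mul_left x
        rw [hb, add_assoc] at h3
        have h4 := Nat.dvd_gcd ((Nat.dvd_add_left (Nat.gcd_dvd_left _ _)).1 h3)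
          (Nat.gcd_dvd_right _ _)
        rw [hcop.gcd_eq_one] at h4
        exact Nat.dvd_one.1 h4
      obtain ⟨e1, e2, e3⟩ := ih (by simp) (Nat.succ_pos b) hba hc
        ⟨fun z hz => h2 z (List.mem_cons_of_mem _ hz), by
          rw [hbq, div_eq_iff hb0.ne', mul_comm, hF]⟩
      have hs := iSeries_cons r a x (y :: l) (b + 1) hbz
      refine ⟨by rw [List.length_cons, hs, e1], by rw [List.length_cons, hs, e2], fun t ht => ?_⟩
      cases t with
      | zero => simp only [iSeries]; exact_mod_cast har
      | succ t => rw [hs, hs]; exact e3 t (by simpa using ht)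

theorem two_le_label {α : List ℕ} (h : ∀ x ∈ α, 2 ≤ x) {t : ℕ} (ht : 1 ≤ t)
    (htn : t ≤ α.length) : 2 ≤ label α t := by
  rw [label, List.getD_eq_getElem _ _ (by omega)]
  exact h _ (List.getElem_mem _)

theorem jSeries_lt {α : List ℕ} (h : ∀ x ∈ α, 2 ≤ x) {t : ℕ} (ht : t ≤ α.length) :
    jSeries α t < jSeries α (t + 1) := by
  induction t with
  | zero => simp [jSeries]
  | succ t ih =>
    have h1 := ih (by omega)
    have h2 : 2 * jSeries α (t + 1) ≤ label α (t + 1) * jSeries α (t + 1) :=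
      Nat.mul_le_mul_right _ (two_le_label h (by omega) ht)
    rw [jSeries]; omega

theorem IsJungHirzebruch.ne_nil {r a : ℕ} {α : List ℕ} (ha : 0 < a) (har : a < r)
    (hα : IsJungHirzebruch r a α) : α ≠ [] := by
  rintro rfl
  have h := hα.2
  simp only [fractionValue, div_eq_zero_iff, Nat.cast_eq_zero] at h
  omega

theorem iNat_cast {r a : ℕ} {α : List ℕ} (ha : 0 < a) (har : a < r)
    (hcop : Nat.Coprime r a) (hα : IsJungHirzebruch r a α) {t : ℕ} (ht : t ≤ α.length + 1) :
    (iNat r a α t : ℤ) = iSeries r a α t := by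
  obtain ⟨h1, h2, h3⟩ := iSeries_spec (hα.ne_nil ha har) ha har hcop hα
  refine Int.toNat_of_nonneg ?_
  induction ht using Nat.decreasingInduction with
  | self => rw [h1]
  | of_succ t ht ih => exact ih.trans (h3 t (by omega)).le

theorem seriesData {r a : ℕ} {α : List ℕ} (ha : 0 < a) (har : a < r)
    (hcop : Nat.Coprime r a) (hα : IsJungHirzebruch r a α) :
    SeriesData α.length r (label α) (iNat r a α) (jSeries α) := by
  have hc := fun t ht => iNat_cast ha har hcop hα (t := t) ht
  obtain ⟨h1, h2, h3⟩ := iSeries_spec (hα.ne_nil ha har) ha har hcop hα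
  have hn : 1 ≤ α.length := List.length_pos_iff.2 (hα.ne_nil ha har)
  have hlt : ∀ t, t ≤ α.length → iNat r a α (t + 1) < iNat r a α t := by
    intro t ht
    zify
    rw [hc _ (by omega), hc _ (by omega)]; exact h3 t ht
  have hir : ∀ t, 1 ≤ t → t ≤ α.length →
      iNat r a α (t + 1) + iNat r a α (t - 1) = label α t * iNat r a α t := by
    intro t ht htn
    obtain ⟨t, rfl⟩ := Nat.exists_eq_add_of_le' ht
    zify
    rw [hc _ (by omega), hc _ (by omega), hc _ (by omega), Nat.add_sub_cancel, iSeries]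
    ring
  have hjr : ∀ t, 1 ≤ t → t ≤ α.length →
      jSeries α (t + 1) + jSeries α (t - 1) = label α t * jSeries α t := by
    intro t ht htn
    obtain ⟨t, rfl⟩ := Nat.exists_eq_add_of_le' ht
    have h4 := jSeries_lt hα.1 (t := t) (by omega)
    have h5 : 2 * jSeries α (t + 1) ≤ label α (t + 1) * jSeries α (t + 1) :=
      Nat.mul_le_mul_right _ (two_le_label hα.1 (by omega) htn)
    rw [Nat.add_sub_cancel, jSeries]; omega
  have h0 : iNat r a α 0 = r := by simp [iNat, iSeries]
  have ha' : iNat r a α 1 = a := by simp [iNat, iSeries]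
  have hlast : iNat r a α (α.length + 1) = 0 := by
    zify; rw [hc _ le_rfl, h1]
  have hone : iNat r a α α.length = 1 := by
    zify; rw [hc _ (by omega), h2]
  -- Both series satisfy the same recursion, so their determinant is constant and equals its initial
  -- value `r`.
  have hdet : ∀ t, t ≤ α.length → iNat r a α t * jSeries α (t + 1) =
      iNat r a α (t + 1) * jSeries α t + r := by
    intro t ht
    induction t with
    | zero => simp [jSeries, h0]
    | succ t ih =>
      have e1 := ih (by omega)
      have e2 := hir (t + 1) (by omega) ht
      have e3 := hjr (t + 1) (by omega) ht
      rw [Nat.add_sub_cancel] at e2 e3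
      zify at *
      linear_combination e1 + iNat r a α (t + 1) * e3 - jSeries α (t + 1) * e2
  refine ⟨hn, fun t => two_le_label hα.1, hir, hjr, hlt, fun t => jSeries_lt hα.1, h0, hone, hlast,
    rfl, rfl, hdet, ?_⟩
  intro t ht
  induction t using Nat.twoStepInduction with
  | zero => simp [jSeries, h0]
  | one => simp [jSeries]
  | more t ih1 ih2 =>
    obtain ⟨b, hb⟩ := ih1 (by omega)
    obtain ⟨c, hc⟩ := ih2 (by omega)
    have e2 := hir (t + 1) (by omega) (by omega)
    have e3 := hjr (t + 1) (by omega) (by omega)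
    rw [Nat.add_sub_cancel] at e2 e3
    refine ⟨label α (t + 1) * c - b, ?_⟩
    zify at e2 e3
    linear_combination (iNat r a α 1 : ℤ) * e3 - e2 + label α (t + 1) * hc - hb

/-! ## Weights of paths -/

section Weights

variable {α : List ℕ} (wt : Arrow α → ℕ × ℕ)

/-- The weight of a path, the sum of the weights of its arrows. -/
def pathWeight {P : Vertex α} : ∀ {Q : Vertex α}, Quiver.Path P Q → ℕ × ℕ
  | _, .nil => 0
  | _, .cons p f => pathWeight p + wt f.1

theorem pathWeight_comp {P Q R : Vertex α} (p : Quiver.Path P Q) (q : Quiver.Path Q R) :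
    pathWeight wt (p.comp q) = pathWeight wt p + pathWeight wt q := by
  induction q with
  | nil => rw [Quiver.Path.comp_nil, pathWeight, add_zero]
  | cons q f ih => rw [Quiver.Path.comp_cons, pathWeight, ih, pathWeight, add_assoc]

/-- The linear map sending a path from `P` to `Q` of weight `(u, v)` to the matrix with entry
`x ^ u * y ^ v` at `(P, Q)`. -/
def weightLin : FreePaths α →ₗ[ℂ] Matrix (Vertex α) (Vertex α) Poly :=
  Finsupp.linearCombination ℂ fun p : AnyPath (Vertex α) =>
    Matrix.single p.1 p.2.1 (mono (pathWeight wt p.2.2).1 (pathWeight wt p.2.2).2)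

theorem weightLin_ofPath (p : AnyPath (Vertex α)) :
    weightLin wt (PathAlgebra.ofPath ℂ p) =
      Matrix.single p.1 p.2.1 (mono (pathWeight wt p.2.2).1 (pathWeight wt p.2.2).2) := by
  rw [weightLin, PathAlgebra.ofPath]
  erw [Finsupp.linearCombination_single, one_smul]

theorem weightLin_mul (f g : FreePaths α) :
    weightLin wt (f * g) = weightLin wt f * weightLin wt g := by
  refine PathAlgebra.induction_paths
    (P := fun f => weightLin wt (f * g) = weightLin wt f * weightLin wt g) ?_ ?_ ?_ ?_ f
  · simp
  · intro a b ha hb; rw [add_mul, map_add, ha, hb, map_add, add_mul]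
  · intro c a ha; rw [smul_mul_assoc, map_smul, ha, map_smul, smul_mul_assoc]
  intro p
  refine PathAlgebra.induction_paths (P := fun g => weightLin wt (PathAlgebra.ofPath ℂ p * g) =
    weightLin wt (PathAlgebra.ofPath ℂ p) * weightLin wt g) ?_ ?_ ?_ ?_ g
  · simp
  · intro a b ha hb; rw [mul_add, map_add, ha, hb, map_add, mul_add]
  · intro c a ha; rw [mul_smul_comm, map_smul, ha, map_smul, mul_smul_comm]
  intro q
  obtain ⟨P, Q, p⟩ := p
  obtain ⟨Q', R, q⟩ := q
  by_cases h : Q = Q'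
  · subst h
    rw [PathAlgebra.ofPath_mul_of_eq, weightLin_ofPath, weightLin_ofPath, weightLin_ofPath,
      Matrix.single_mul_single_same, mono_mul, pathWeight_comp]
    rfl
  · rw [PathAlgebra.ofPath_mul_of_ne _ _ h, weightLin_ofPath, weightLin_ofPath,
      Matrix.single_mul_single_of_ne _ _ _ _ h, map_zero]

/-- The weight of paths as a homomorphism of algebras. -/
def weightHom : FreePaths α →ₐ[ℂ] Matrix (Vertex α) (Vertex α) Poly :=
  AlgHom.ofLinearMap (weightLin wt) (by
    rw [PathAlgebra.one_def, map_sum]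
    simp only [weightLin_ofPath, pathWeight, Prod.fst_zero, Prod.snd_zero, mono_zero]
    ext1 P Q
    rw [Matrix.sum_apply, Matrix.one_apply]
    simp [Matrix.single_apply, ite_and]) (weightLin_mul wt)

/-- `z` is a path from `P` to `Q` of weight `w`. -/
def IsWord (P Q : Vertex α) (w : ℕ × ℕ) (z : FreePaths α) : Prop :=
  ∃ p : Quiver.Path P Q, z = PathAlgebra.ofPath ℂ ⟨P, Q, p⟩ ∧ pathWeight wt p = w

/-- The trivial path. -/
def idem (P : Vertex α) : FreePaths α := PathAlgebra.ofPath ℂ ⟨P, P, .nil⟩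

variable {wt}

theorem IsWord.idem (P : Vertex α) : IsWord wt P P 0 (idem P) := ⟨.nil, rfl, rfl⟩

theorem IsWord.arrow (e : Arrow α) : IsWord wt e.start e.finish (wt e) (arrow e) :=
  ⟨_, rfl, zero_add _⟩

theorem IsWord.mul {P Q R : Vertex α} {w w' : ℕ × ℕ} {z z' : FreePaths α}
    (h : IsWord wt P Q w z) (h' : IsWord wt Q R w' z') : IsWord wt P R (w + w') (z * z') := by
  obtain ⟨p, rfl, rfl⟩ := h
  obtain ⟨q, rfl, rfl⟩ := h'
  exact ⟨_, PathAlgebra.ofPath_mul_of_eq p q, pathWeight_comp wt p q⟩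

theorem IsWord.idem_mul {P Q : Vertex α} {w : ℕ × ℕ} {z : FreePaths α}
    (h : IsWord wt P Q w z) : Reconstruction.idem P * z = z := by
  obtain ⟨p, rfl, rfl⟩ := h
  rw [Reconstruction.idem, PathAlgebra.ofPath_mul_of_eq, Quiver.Path.nil_comp]

theorem IsWord.mul_idem {P Q : Vertex α} {w : ℕ × ℕ} {z : FreePaths α}
    (h : IsWord wt P Q w z) : z * Reconstruction.idem Q = z := by
  obtain ⟨p, rfl, rfl⟩ := h
  rw [Reconstruction.idem, PathAlgebra.ofPath_mul_of_eq, Quiver.Path.comp_nil]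

theorem IsWord.weightHom {P Q : Vertex α} {w : ℕ × ℕ} {z : FreePaths α}
    (h : IsWord wt P Q w z) : weightHom wt z = Matrix.single P Q (mono w.1 w.2) := by
  obtain ⟨p, rfl, rfl⟩ := h
  exact weightLin_ofPath wt _

theorem IsWord.congr {P Q P' Q' : Vertex α} {w w' : ℕ × ℕ} {z z' : FreePaths α}
    (h : IsWord wt P Q w z) (hP : P = P') (hQ : Q = Q') (hw : w = w') (hz : z = z') :
    IsWord wt P' Q' w' z' := by
  subst hP hQ hw hz; exact h

/-- A nonzero matrix unit times a monomial determines the exponents. -/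
theorem IsWord.weight_eq {P Q P' Q' : Vertex α} {w w' : ℕ × ℕ} {z z' : FreePaths α}
    (h : IsWord wt P Q w z) (h' : IsWord wt P' Q' w' z')
    (hz : Reconstruction.weightHom wt z = Reconstruction.weightHom wt z') : w = w' := by
  rw [h.weightHom, h'.weightHom] at hz
  have h1 := congr_fun (congr_fun hz P) Q
  rw [Matrix.single_apply_same, Matrix.single_apply] at h1
  split_ifs at h1
  · rw [mono, mono, monomial_left_inj one_ne_zero] at h1
    have h2 := DFunLike.congr_fun h1 0
    have h3 := DFunLike.congr_fun h1 1
    simp only [expo_zero, expo_one] at h2 h3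
    exact Prod.ext h2 h3
  · exact absurd h1 (mono_ne_zero _ _)

end Weights

/-! ## The numbering of the extra arrows -/

section Numbering

variable {α : List ℕ}

/-- The number of extra arrows leaving a vertex smaller than `t`. -/
def offset (α : List ℕ) (t : ℕ) : ℕ := numExtra (α.take (t - 1))

theorem offset_one : offset α 1 = 0 := by simp [offset, numExtra]

theorem offset_succ {t : ℕ} (ht : 1 ≤ t) (htn : t ≤ α.length) :
    offset α (t + 1) = offset α t + (label α t - 2) := by
  obtain ⟨t, rfl⟩ := Nat.exists_eq_add_of_le' ht
  rw [offset, offset, Nat.add_sub_cancel, Nat.add_sub_cancel, label,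
    List.getD_eq_getElem _ _ (by omega), List.take_add_one, List.getElem?_eq_getElem (by omega)]
  rw [numExtra, numExtra, List.map_append, List.sum_append]
  simp only [Option.toList_some, List.map_cons, List.map_nil, List.sum_singleton,
    Nat.add_sub_cancel]

theorem offset_last : offset α (α.length + 1) = numExtra α := by simp [offset]

theorem offset_mono {s t : ℕ} (hs : 1 ≤ s) (hst : s ≤ t) (ht : t ≤ α.length + 1) :
    offset α s ≤ offset α t := by
  induction t, hst using Nat.le_induction with
  | base => exact le_rfl
  | succ t hst ih => rw [offset_succ (by omega) (by omega)]; exact (ih (by omega)).trans (by omega)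

theorem offset_le {t : ℕ} (ht : 1 ≤ t) (htn : t ≤ α.length + 1) : offset α t ≤ numExtra α := by
  rw [← offset_last]; exact offset_mono ht htn le_rfl

/-- This translates the global numbering of the extra arrows into pairs (vertex, place in its
chain). -/
theorem kTail_offset {t m : ℕ} (ht : 1 ≤ t) (htn : t ≤ α.length) (hm : 1 ≤ m)
    (hm' : m ≤ label α t - 2) : kTail α (offset α t + m) = t := by
  have h1 := offset_succ ht htn
  have h2 := offset_le (α := α) (t := t + 1) (by omega) (by omega)
  rw [kTail, if_neg (by omega), if_neg (by omega)]
  refine IsLeast.csInf_eq ⟨?_, fun s hs => ?_⟩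
  · have : offset α (t + 1) = numExtra (α.take t) := by rw [offset, Nat.add_sub_cancel]
    change offset α t + m ≤ numExtra (α.take t); omega
  · by_contra h
    have h3 : offset α (s + 1) = numExtra (α.take s) := by rw [offset, Nat.add_sub_cancel]
    have h4 := offset_mono (α := α) (s := s + 1) (t := t) (by omega) (by omega) (by omega)
    change offset α t + m ≤ numExtra (α.take s) at hs; omega

theorem kTail_zero : kTail α 0 = 1 := by simp [kTail]

theorem kTail_last : kTail α (numExtra α + 1) = α.length := by simp [kTail]

theorem exists_offset {k s : ℕ} (hk : k ≤ α.length) (hs : 1 ≤ s) (hsk : s ≤ offset α (k + 1)) :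
    ∃ t m, 1 ≤ t ∧ t ≤ k ∧ 1 ≤ m ∧ m ≤ label α t - 2 ∧ s = offset α t + m := by
  induction k with
  | zero => rw [offset_one] at hsk; omega
  | succ k ih =>
    by_cases h : s ≤ offset α (k + 1)
    · obtain ⟨t, m, h1, h2, h3⟩ := ih (by omega) h
      exact ⟨t, m, h1, by omega, h3⟩
    · rw [offset_succ (by omega) hk] at hsk
      exact ⟨k + 1, s - offset α (k + 1), by omega, le_rfl, by omega, by omega, by omega⟩

theorem cases_index {s : ℕ} (hs : s ≤ numExtra α + 1) : s = 0 ∨ s = numExtra α + 1 ∨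
    ∃ t m, 1 ≤ t ∧ t ≤ α.length ∧ 1 ≤ m ∧ m ≤ label α t - 2 ∧ s = offset α t + m := by
  by_cases h0 : s = 0
  · exact Or.inl h0
  by_cases h1 : s = numExtra α + 1
  · exact Or.inr (Or.inl h1)
  exact Or.inr (Or.inr (exists_offset le_rfl (by omega) (by rw [offset_last]; omega)))

theorem uIdx_eq {t : ℕ} (ht : 1 ≤ t) (htn : t < α.length) (h : 2 < label α t) :
    uIdx α t = offset α (t + 1) := by
  have h1 := offset_succ ht htn.le
  have h2 := offset_le (α := α) (t := t + 1) (by omega) (by omega)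
  refine IsGreatest.csSup_eq ⟨⟨by omega, ?_⟩, fun s hs => ?_⟩
  · rw [h1]; exact kTail_offset ht htn.le (by omega) le_rfl
  · obtain ⟨hs, hst⟩ := hs
    rcases cases_index hs with rfl | rfl | ⟨t', m, h3, h4, h5, h6, rfl⟩
    · omega
    · rw [kTail_last] at hst; omega
    · rw [kTail_offset h3 h4 h5 h6] at hst; subst hst; omega

theorem uIdx_last : uIdx α α.length = numExtra α + 1 :=
  IsGreatest.csSup_eq ⟨⟨le_rfl, kTail_last⟩, fun _ hs => hs.1⟩

theorem vIdx_eq {t : ℕ} (ht : 2 ≤ t) (htn : t ≤ α.length) (h : 2 < label α t) :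
    vIdx α t = offset α t + 1 := by
  have h2 := offset_le (α := α) (t := t) (by omega) (by omega)
  refine IsLeast.csInf_eq ⟨⟨by omega, ?_⟩, fun s hs => ?_⟩
  · exact kTail_offset (by omega) htn le_rfl (by omega)
  · obtain ⟨hs, hst⟩ := hs
    rcases cases_index hs with rfl | rfl | ⟨t', m, h3, h4, h5, h6, rfl⟩
    · rw [kTail_zero] at hst; omega
    · omega
    · rw [kTail_offset h3 h4 h5 h6] at hst; subst hst; omega

/-- When no extra arrow leaves a vertex before `t`, the value is `0`, in accordance with `k_0`
starting at `1 < t`. -/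
theorem VIdx_eq {t : ℕ} (ht : 2 ≤ t) (htn : t ≤ α.length) : VIdx α t = offset α t := by
  have h2 := offset_le (α := α) (t := t) (by omega) (by omega)
  rw [VIdx, if_neg (by omega)]
  refine IsGreatest.csSup_eq ⟨⟨by omega, ?_⟩, fun s hs => ?_⟩
  · rcases Nat.eq_zero_or_pos (offset α t) with h0 | h0
    · rw [h0, kTail_zero]; omega
    · obtain ⟨t', m, h3, h4, h5, h6, h7⟩ := exists_offset (α := α) (k := t - 1) (by omega) h0
        (by rw [Nat.sub_add_cancel (by omega)])
      rw [h7, kTail_offset h3 (by omega) h5 h6]; omega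
  · obtain ⟨hs, hst⟩ := hs
    rcases cases_index hs with rfl | rfl | ⟨t', m, h3, h4, h5, h6, rfl⟩
    · omega
    · rw [kTail_last] at hst; omega
    · rw [kTail_offset h3 h4 h5 h6] at hst
      have := offset_succ h3 h4
      have := offset_mono (α := α) (s := t' + 1) (t := t) (by omega) (by omega) (by omega)
      omega

/-- Vertices of label `2` carry no extra arrows, so skipping them leaves the numbering unchanged.
This finds the vertex whose relation links the last extra arrow at one vertex with its successor. -/
theorem exists_next {t : ℕ} (ht : 1 ≤ t) (htn : t ≤ α.length) :
    ∃ t', t ≤ t' ∧ t' ≤ α.length ∧ (2 < label α t' ∨ t' = α.length) ∧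
      offset α t' = offset α t := by
  induction htn using Nat.decreasingInduction with
  | self => exact ⟨_, le_rfl, le_rfl, Or.inr rfl, rfl⟩
  | of_succ t htn ih =>
    by_cases h : 2 < label α t
    · exact ⟨t, le_rfl, htn.le, Or.inl h, rfl⟩
    · obtain ⟨t', h1, h2, h3, h4⟩ := ih (by omega)
      exact ⟨t', by omega, h2, h3, by rw [h4, offset_succ ht htn.le]; omega⟩

end Numbering

/-! ### The arrows of the quiver as chains of weighted arrows. -/

section Arrows

variable {α : List ℕ} {i j : ℕ → ℕ} {r : ℕ}

/-- The weights of the arrows of the reconstruction algebra. -/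
def arrowWeight (α : List ℕ) (i j : ℕ → ℕ) : Arrow α → ℕ × ℕ
  | .clock k => if k.val = 0 then (1, 0) else (wx i k.val 0, wy j k.val 0)
  | .anti k =>
    if k.val = 0 then (0, 1)
    else if α.length = 1 then (wx i 1 1, wy j 1 1)
    else (wx i k.val (label α k.val - 1), wy j k.val (label α k.val - 1))
  | .extra s =>
    if α.length = 1 then (wx i 1 (s + 2), wy j 1 (s + 2))
    else (wx i (kTail α (s + 1)) (s + 1 - offset α (kTail α (s + 1))),
      wy j (kTail α (s + 1)) (s + 1 - offset α (kTail α (s + 1))))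

/-- The `m`-th arrow leaving the vertex `t`, for `0 ≤ m < α_t`. -/
def chainArrow (α : List ℕ) (t m : ℕ) : FreePaths α :=
  if α.length = 1 then (if m = 0 then cl α 1 else if m = 1 then an α 1 else kk α (m - 1))
  else if m = 0 then cl α t else if m = label α t - 1 then an α t else kk α (offset α t + m)

theorem val_ofNat {t : ℕ} (ht : t ≤ α.length) : (Fin.ofNat (α.length + 1) t).val = t :=
  Nat.mod_eq_of_lt (by omega)

theorem vertex_last : vertex α (α.length + 1) = vertex α 0 :=
  Fin.ext (by simp [vertex])

theorem clock_start (t : ℕ) :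
    (Arrow.clock (Fin.ofNat _ t) : Arrow α).start = vertex α t := rfl

theorem anti_start (t : ℕ) :
    (Arrow.anti (Fin.ofNat _ t) : Arrow α).start = vertex α t := rfl

theorem anti_finish (t : ℕ) :
    (Arrow.anti (Fin.ofNat _ t) : Arrow α).finish = vertex α (t + 1) := by
  refine Fin.ext ?_
  simp [vertex, Arrow.finish, Fin.val_add]

theorem clock_finish_succ (t : ℕ) :
    (Arrow.clock (Fin.ofNat _ (t + 1)) : Arrow α).finish = vertex α t := by
  have h : (Fin.ofNat (α.length + 1) t + 1) = Fin.ofNat _ (t + 1) := by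
    refine Fin.ext ?_
    simp [Fin.val_add]
  change (Fin.ofNat (α.length + 1) (t + 1) - 1 : Fin (α.length + 1)) = _
  rw [← h, add_sub_cancel_right]
  rfl

theorem clock_finish_zero :
    (Arrow.clock (Fin.ofNat _ 0) : Arrow α).finish = vertex α α.length := by
  rw [← clock_finish_succ]
  congr 2
  exact Fin.ext (by simp)

/-- `e` is the `m`-th arrow leaving the vertex `t`. -/
structure Represents (i j : ℕ → ℕ) (e : Arrow α) (t m : ℕ) : Prop where
  arrow_eq : arrow e = chainArrow α t m
  start_eq : e.start = vertex α t
  finish_eq : e.finish = vertex α (target α.length (label α) t m)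
  weight_eq : arrowWeight α i j e = (wx i t m, wy j t m)

theorem represents_clock {t : ℕ} (ht : 1 ≤ t)
    (htn : t ≤ α.length) : Represents i j (Arrow.clock (Fin.ofNat _ t) : Arrow α) t 0 := by
  refine ⟨?_, rfl, ?_, ?_⟩
  · by_cases h : α.length = 1
    · obtain rfl : t = 1 := by omega
      simp [chainArrow, h, cl]
    · simp [chainArrow, h, cl]
  · obtain ⟨t, rfl⟩ := Nat.exists_eq_add_of_le' ht
    rw [clock_finish_succ, target, if_pos rfl]
    split_ifs with h
    · obtain rfl : t = 0 := by omega
      rw [vertex_last]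
    · rfl
  · rw [arrowWeight, val_ofNat htn, if_neg (by omega)]

theorem represents_anti (hd : SeriesData α.length r (label α) i j) (hn : α.length ≠ 1) {t : ℕ}
    (ht : 1 ≤ t) (htn : t ≤ α.length) :
    Represents i j (Arrow.anti (Fin.ofNat _ t) : Arrow α) t (label α t - 1) := by
  have h2 := hd.two_le t ht htn
  refine ⟨?_, rfl, ?_, ?_⟩
  · rw [chainArrow, if_neg hn, if_neg (by omega), if_pos rfl]; rfl
  · rw [anti_finish, target, if_neg (by omega), if_pos rfl]
  · rw [arrowWeight, val_ofNat htn, if_neg (by omega), if_neg hn]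

theorem represents_anti_one (hn : α.length = 1) :
    Represents i j (Arrow.anti (Fin.ofNat _ 1) : Arrow α) 1 1 := by
  refine ⟨?_, rfl, ?_, ?_⟩
  · simp [chainArrow, hn, an]
  · rw [anti_finish, target, if_neg (by omega)]
    split_ifs
    · rfl
    · rw [hn]
  · rw [arrowWeight, val_ofNat hn.ge, if_neg (by omega), if_pos hn]

theorem kk_extra (s : Fin (numExtra α)) : kk α (s + 1) = arrow (Arrow.extra s) := by
  rw [kk, if_neg (by omega), dif_pos (by simp)]
  rfl

theorem represents_extra (hn : α.length ≠ 1) {t m : ℕ} (ht : 1 ≤ t) (htn : t ≤ α.length)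
    (hm : 1 ≤ m) (hm' : m ≤ label α t - 2) (s : Fin (numExtra α))
    (hs : s.val + 1 = offset α t + m) : Represents i j (Arrow.extra s) t m := by
  have hk := kTail_offset ht htn hm hm'
  refine ⟨?_, ?_, ?_, ?_⟩
  · rw [chainArrow, if_neg hn, if_neg (by omega), if_neg (by omega), ← hs, kk_extra]
  · rw [Arrow.start, hs, hk]
  · rw [Arrow.finish, target, if_neg (by omega), if_neg (by omega), vertex_last]
  · rw [arrowWeight, if_neg hn, hs, hk, Nat.add_sub_cancel_left]

theorem numExtra_of_length_eq_one (hn : α.length = 1) : numExtra α = label α 1 - 2 := by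
  obtain ⟨x, rfl⟩ := List.length_eq_one_iff.1 hn
  simp [numExtra, label]

/-- The shift by `2` leaves the places `0` and `1` of the chain to `c_1` and `c_2`. -/
theorem represents_extra_one (hn : α.length = 1) (s : Fin (numExtra α)) :
    Represents i j (Arrow.extra s) 1 (s + 2) := by
  have hs := s.2
  have hk : kTail α (s + 1) = 1 := by
    have := kTail_offset (α := α) (t := 1) (m := s + 1) le_rfl hn.ge (by omega)
      (by rw [← numExtra_of_length_eq_one hn]; omega)
    rwa [offset_one, zero_add] at this
  refine ⟨?_, ?_, ?_, ?_⟩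
  · rw [chainArrow, if_pos hn, if_neg (by omega), if_neg (by omega), ← kk_extra]; rfl
  · rw [Arrow.start, hk]
  · rw [Arrow.finish, target, if_neg (by omega)]
    split_ifs
    · rw [← vertex_last, hn]
    · rw [vertex_last]
  · rw [arrowWeight, if_pos hn]

theorem exists_represents (hd : SeriesData α.length r (label α) i j) {t m : ℕ} (ht : 1 ≤ t)
    (htn : t ≤ α.length) (hm : m < label α t) : ∃ e : Arrow α, Represents i j e t m := by
  rcases Nat.eq_zero_or_pos m with rfl | h0
  · exact ⟨_, represents_clock ht htn⟩
  by_cases hn : α.length = 1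
  · obtain rfl : t = 1 := by omega
    by_cases h1 : m = 1
    · subst h1; exact ⟨_, represents_anti_one hn⟩
    · have := represents_extra_one (i := i) (j := j) hn
        ⟨m - 2, by rw [numExtra_of_length_eq_one hn]; omega⟩
      rw [Fin.val_mk, Nat.sub_add_cancel (by omega)] at this
      exact ⟨_, this⟩
  · by_cases h1 : m = label α t - 1
    · subst h1; exact ⟨_, represents_anti hd hn ht htn⟩
    · have h2 := offset_le (α := α) (t := t + 1) (by omega) (by omega)
      rw [offset_succ ht htn] at h2
      exact ⟨_, represents_extra hn ht htn h0 (by omega) ⟨offset α t + m - 1, by omega⟩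
        (Nat.sub_add_cancel (by omega))⟩

theorem arrow_cases (hd : SeriesData α.length r (label α) i j) (e : Arrow α) :
    e = Arrow.clock (Fin.ofNat _ 0) ∨ e = Arrow.anti (Fin.ofNat _ 0) ∨
      ∃ t m, 1 ≤ t ∧ t ≤ α.length ∧ m < label α t ∧ Represents i j e t m := by
  have hn0 := hd.n_pos
  have hof : ∀ k : Fin (α.length + 1), k = Fin.ofNat _ k.val := fun k => by simp
  cases e with
  | clock k =>
    rcases Nat.eq_zero_or_pos k.val with h | h
    · left; rw [hof k, h]
    · right; right
      refine ⟨k.val, 0, h, by omega, ?_, ?_⟩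
      · have := hd.two_le k.val h (by omega); omega
      · have := represents_clock (α := α) (i := i) (j := j) h (by omega)
        rwa [← hof k] at this
  | anti k =>
    rcases Nat.eq_zero_or_pos k.val with h | h
    · right; left; rw [hof k, h]
    · right; right
      have h2 := hd.two_le k.val h (by omega)
      by_cases hn : α.length = 1
      · have hk : k.val = 1 := by omega
        rw [hk] at h2
        refine ⟨1, 1, le_rfl, hn0, by omega, ?_⟩
        rw [hof k, hk]
        exact represents_anti_one hn
      · have := represents_anti hd hn h (by omega)
        rw [← hof k] at this
        exact ⟨k.val, _, h, by omega, by omega, this⟩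
  | extra s =>
    right; right
    by_cases hn : α.length = 1
    · have := s.2
      refine ⟨1, _, le_rfl, hn0, ?_, represents_extra_one hn s⟩
      have := numExtra_of_length_eq_one hn
      omega
    · obtain ⟨t, m, h1, h2, h3, h4, h5⟩ := exists_offset (α := α) (s := s.val + 1) le_rfl
        (by omega) (by rw [offset_last]; omega)
      exact ⟨t, m, h1, h2, by omega, represents_extra hn h1 h2 h3 h4 s h5⟩

/-! ## Words in the arrows -/

theorem isWord_chainArrow (hd : SeriesData α.length r (label α) i j) {t m : ℕ} (ht : 1 ≤ t)
    (htn : t ≤ α.length) (hm : m < label α t) :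
    IsWord (arrowWeight α i j) (vertex α t) (vertex α (target α.length (label α) t m))
      (wx i t m, wy j t m) (chainArrow α t m) := by
  obtain ⟨e, he⟩ := exists_represents hd ht htn hm
  exact (IsWord.arrow e).congr he.start_eq he.finish_eq he.weight_eq he.arrow_eq

theorem isWord_cl_zero (α : List ℕ) (i j : ℕ → ℕ) :
    IsWord (arrowWeight α i j) (vertex α 0) (vertex α α.length) (1, 0) (cl α 0) :=
  (IsWord.arrow (Arrow.clock (Fin.ofNat _ 0))).congr rfl clock_finish_zero
    (by simp [arrowWeight]) rfl

theorem isWord_an_zero (α : List ℕ) (i j : ℕ → ℕ) :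
    IsWord (arrowWeight α i j) (vertex α 0) (vertex α 1) (0, 1) (an α 0) :=
  (IsWord.arrow (Arrow.anti (Fin.ofNat _ 0))).congr rfl (anti_finish 0)
    (by simp [arrowWeight]) rfl

theorem isWord_cl {t : ℕ} (ht : 1 ≤ t)
    (htn : t ≤ α.length) : IsWord (arrowWeight α i j) (vertex α t) (vertex α (t - 1))
      (i (t - 1) - i t, 0) (cl α t) := by
  have h := represents_clock (α := α) (i := i) (j := j) ht htn
  refine (IsWord.arrow _).congr rfl ?_ (h.weight_eq.trans ?_) rfl
  · obtain ⟨t, rfl⟩ := Nat.exists_eq_add_of_le' ht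
    rw [clock_finish_succ]; rfl
  · rw [SeriesData.wx_zero, SeriesData.wy_zero]

theorem isWord_an (hd : SeriesData α.length r (label α) i j) {t : ℕ}
    (ht : t < α.length ∨ t = α.length ∧ 2 ≤ α.length) :
    IsWord (arrowWeight α i j) (vertex α t) (vertex α (t + 1)) (0, j (t + 1) - j t) (an α t) := by
  rcases Nat.eq_zero_or_pos t with rfl | h0
  · rw [zero_add, hd.j_one, hd.j_zero]; exact isWord_an_zero α i j
  have h := represents_anti hd (by omega) h0 (by omega)
  have h2 := hd.two_le t h0 (by omega)
  refine (IsWord.arrow _).congr rfl (anti_finish t) (h.weight_eq.trans ?_) rfl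
  rw [hd.wx_last h0 (by omega) (by omega), hd.wy_last h0 (by omega) (by omega)]

/-- The first arrow is split off because the exchange law at vertex `0` compares products beginning
with `Y` and `X`. -/
theorem exists_anPath_eq (hd : SeriesData α.length r (label α) i j) {t : ℕ} (ht : 1 ≤ t)
    (htn : t ≤ α.length) : ∃ y, IsWord (arrowWeight α i j) (vertex α 1) (vertex α t)
      (0, j t - 1) y ∧ anPath α t = an α 0 * y := by
  induction t, ht using Nat.le_induction with
  | base =>
    refine ⟨_, (IsWord.idem _).congr rfl rfl ?_ rfl, ?_⟩
    · rw [hd.j_one]; rfl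
    · rw [(isWord_an_zero α i j).mul_idem]; simp [anPath]
  | succ t ht ih =>
    obtain ⟨y, hy, hyt⟩ := ih (by omega)
    refine ⟨_, (hy.mul (isWord_an hd (Or.inl htn))).congr rfl rfl ?_ rfl, ?_⟩
    · have h1 := hd.j_le ht (by omega)
      have h2 := hd.j_lt t (by omega)
      rw [hd.j_one] at h1
      exact Prod.ext rfl (by simp only [Prod.snd_add]; omega)
    · rw [← mul_assoc, ← hyt, anPath, anPath, List.range_succ, List.map_append, List.prod_append]
      simp

theorem exists_clPath_eq (hd : SeriesData α.length r (label α) i j) {t : ℕ} (ht : 1 ≤ t)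
    (htn : t ≤ α.length) : ∃ x, IsWord (arrowWeight α i j) (vertex α α.length) (vertex α t)
      (i t - 1, 0) x ∧ clPath α t = cl α 0 * x := by
  induction htn using Nat.decreasingInduction with
  | self =>
    refine ⟨_, (IsWord.idem _).congr rfl rfl ?_ rfl, ?_⟩
    · rw [hd.i_n]; rfl
    · rw [(isWord_cl_zero α i j).mul_idem]; simp [clPath]
  | of_succ t htn ih =>
    obtain ⟨x, hx, hxt⟩ := ih (by omega)
    refine ⟨_, (hx.mul (isWord_cl (t := t + 1) (by omega) htn)).congr rfl rfl ?_ rfl, ?_⟩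
    · have h1 := hd.i_le (s := t + 1) htn (by omega)
      have h2 := hd.i_lt t (by omega)
      rw [hd.i_n] at h1
      exact Prod.ext (by simp only [Prod.fst_add, Nat.add_sub_cancel]; omega) rfl
    · rw [← mul_assoc, ← hxt, clPath, clPath, mul_assoc,
        show α.length - t = α.length - (t + 1) + 1 by omega, List.range_succ, List.map_append,
        List.prod_append]
      simp [show α.length - (α.length - (t + 1)) = t + 1 by omega]

theorem isWord_anPath (hd : SeriesData α.length r (label α) i j) {t : ℕ} (ht : 1 ≤ t)
    (htn : t ≤ α.length) : IsWord (arrowWeight α i j) (vertex α 0) (vertex α t)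
      (0, j t) (anPath α t) := by
  obtain ⟨y, hy, h⟩ := exists_anPath_eq hd ht htn
  have h1 := hd.j_le ht (by omega)
  rw [hd.j_one] at h1
  exact ((isWord_an_zero α i j).mul hy).congr rfl rfl
    (Prod.ext rfl (by simp only [Prod.snd_add]; omega)) h.symm

theorem isWord_clPath (hd : SeriesData α.length r (label α) i j) {t : ℕ} (ht : 1 ≤ t)
    (htn : t ≤ α.length) : IsWord (arrowWeight α i j) (vertex α 0) (vertex α t)
      (i t, 0) (clPath α t) := by
  obtain ⟨x, hx, h⟩ := exists_clPath_eq hd ht htn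
  have h1 := hd.i_le htn (by omega)
  rw [hd.i_n] at h1
  exact ((isWord_cl_zero α i j).mul hx).congr rfl rfl
    (Prod.ext (by simp only [Prod.fst_add]; omega) rfl) h.symm

/-- The indices `(t, m)` for which the `m`-th arrow leaving `t` is one of `k_0, k_1, …`. -/
def IsExtraIndex (α : List ℕ) (t m : ℕ) : Prop :=
  1 ≤ t ∧ t ≤ α.length ∧ m < label α t ∧ (1 ≤ m ∨ t = 1) ∧ (m + 1 < label α t ∨ t = α.length)

/-- The conventions for `k_0` and for the arrow after the last extra one fit the formula: they are
the first arrow of the chain at `1` and the last one of the chain at `n`. -/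
theorem kk_offset (hd : SeriesData α.length r (label α) i j) (hn : 2 ≤ α.length) {t m : ℕ}
    (h : IsExtraIndex α t m) : kk α (offset α t + m) = chainArrow α t m := by
  obtain ⟨ht, htn, hm, h1, h2⟩ := h
  have h3 := hd.two_le t ht htn
  rw [chainArrow, if_neg (by omega)]
  split_ifs with h4 h5
  · obtain rfl : t = 1 := by omega
    rw [offset_one, h4]; rfl
  · obtain rfl : t = α.length := by omega
    have h6 := offset_succ ht htn
    rw [offset_last] at h6
    rw [kk, if_neg (by omega), dif_neg (by omega)]
  · rfl

theorem isWord_kk (hd : SeriesData α.length r (label α) i j) (hn : 2 ≤ α.length) {t m : ℕ}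
    (h : IsExtraIndex α t m) : IsWord (arrowWeight α i j) (vertex α t) (vertex α 0)
      (wx i t m, wy j t m) (kk α (offset α t + m)) := by
  refine (isWord_chainArrow hd h.1 h.2.1 h.2.2.1).congr rfl ?_ rfl (kk_offset hd hn h).symm
  rw [target]
  obtain ⟨ht, htn, hm, h1, h2⟩ := h
  split_ifs
  · exact vertex_last
  · omega
  · obtain rfl : t = α.length := by omega
    exact vertex_last
  · exact vertex_last

end Arrows

/-! ### Homogeneity of the defining relations. -/

section Relations

variable {α : List ℕ} {i j : ℕ → ℕ} {r : ℕ}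

theorem IsExtraIndex.wx_cast (hd : SeriesData α.length r (label α) i j) {t m : ℕ}
    (h : IsExtraIndex α t m) : (wx i t m : ℤ) = i (t - 1) - (m + 1) * i t := by
  obtain ⟨ht, htn, hm, h1, h2⟩ := h
  by_cases h3 : m + 1 < label α t
  · exact hd.wx_cast ht htn h3
  · obtain rfl : t = α.length := by omega
    have h4 := hd.i_rec _ ht htn
    have h5 : m + 1 = label α α.length := by omega
    rw [hd.wx_last ht htn h5]
    rw [hd.i_last, ← h5] at h4
    zify at h4
    push_cast
    linarith

theorem IsExtraIndex.wy_cast (hd : SeriesData α.length r (label α) i j) {t m : ℕ}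
    (h : IsExtraIndex α t m) : (wy j t m : ℤ) = m * j t - j (t - 1) := by
  obtain ⟨ht, htn, hm, h1, h2⟩ := h
  rcases Nat.eq_zero_or_pos m with rfl | h3
  · obtain rfl : t = 1 := by omega
    simp [SeriesData.wy_zero, hd.j_zero]
  · exact hd.wy_cast htn h3

theorem IsExtraIndex.weight_succ (hd : SeriesData α.length r (label α) i j) {t m : ℕ}
    (h : IsExtraIndex α t m) (h' : IsExtraIndex α t (m + 1)) :
    wx i t m = wx i t (m + 1) + i t ∧ wy j t (m + 1) = wy j t m + j t := by
  have h1 := h.wx_cast hd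
  have h2 := h.wy_cast hd
  have h3 := h'.wx_cast hd
  have h4 := h'.wy_cast hd
  push_cast at h3 h4
  constructor
  · zify; linarith
  · zify; linarith

theorem weight_first (hd : SeriesData α.length r (label α) i j) {t : ℕ} (ht : 1 ≤ t)
    (htn : t ≤ α.length) (h : 2 < label α t) :
    wx i t 1 + i t = i (t - 1) - i t ∧ wy j t 1 = j t - j (t - 1) := by
  refine ⟨?_, by rw [wy, one_mul]⟩
  have h1 := hd.wx_cast ht htn (m := 1) (by omega)
  have h2 := hd.i_le (Nat.sub_le t 1) (by omega)
  zify [h2]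
  rw [h1]; push_cast; ring

theorem weight_last (hd : SeriesData α.length r (label α) i j) {t : ℕ} (ht : 1 ≤ t)
    (htn : t ≤ α.length) (h : 2 < label α t ∨ t = 1) :
    wx i t (label α t - 2) = i t - i (t + 1) ∧
      wy j t (label α t - 2) + j t = j (t + 1) - j t := by
  have h1 := hd.two_le t ht htn
  have h2 := hd.wx_cast ht htn (m := label α t - 2) (by omega)
  have h3 := hd.i_rec t ht htn
  have h4 := hd.j_rec t ht htn
  have h5 := hd.i_lt t htn
  have h6 := hd.j_lt t htn
  constructor
  · zify [h5.le, h1] at *; rw [h2]; linarith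
  · rcases h.symm with rfl | h
    · rw [Nat.sub_self, hd.j_zero, hd.j_one] at *
      rw [wy, Nat.sub_self, hd.j_zero, hd.j_one]; omega
    · have h7 := hd.wy_cast htn (m := label α t - 2) (by omega)
      zify [h6.le, h1] at *; rw [h7]; linarith

theorem weight_two (hd : SeriesData α.length r (label α) i j) {t : ℕ} (ht : 1 ≤ t)
    (htn : t ≤ α.length) (h : label α t = 2) :
    i (t - 1) - i t = i t - i (t + 1) ∧ j t - j (t - 1) = j (t + 1) - j t := by
  have h3 := hd.i_rec t ht htn
  have h4 := hd.j_rec t ht htn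
  rw [h] at h3 h4
  omega

theorem isWord_anPath_kk (hd : SeriesData α.length r (label α) i j) (hn : 2 ≤ α.length)
    {t m : ℕ} (h : IsExtraIndex α t m) : IsWord (arrowWeight α i j) (vertex α 0) (vertex α 0)
      (wx i t m, j t + wy j t m) (anPath α t * kk α (offset α t + m)) :=
  ((isWord_anPath hd h.1 h.2.1).mul (isWord_kk hd hn h)).congr rfl rfl
    (Prod.ext (zero_add _) rfl) rfl

theorem isExtraIndex_last (hd : SeriesData α.length r (label α) i j) {t : ℕ} (ht : 1 ≤ t)
    (htn : t ≤ α.length) (h : 2 < label α t ∨ t = 1) : IsExtraIndex α t (label α t - 2) := by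
  have h1 := hd.two_le t ht htn
  refine ⟨ht, htn, by omega, by omega, by omega⟩

theorem kTail_offset_last {t : ℕ} (ht : 1 ≤ t) (htn : t ≤ α.length)
    (h : 2 < label α t ∨ t = 1) : kTail α (offset α t + (label α t - 2)) = t := by
  rcases Nat.eq_zero_or_pos (label α t - 2) with h0 | h0
  · obtain rfl : t = 1 := by omega
    rw [h0, offset_one, kTail_zero]
  · exact kTail_offset ht htn h0 le_rfl

/-- Going back from `t`, the differences `i_{t-1} - i_t` and `j_t - j_{t-1}` do not change across a
label `2`, until a vertex with an extra arrow, or vertex `1` with `k_0`, is reached. -/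
theorem isWord_anPath_kk_offset (hd : SeriesData α.length r (label α) i j) (hn : 2 ≤ α.length)
    {t : ℕ} (ht : 2 ≤ t) (htn : t ≤ α.length) :
    IsWord (arrowWeight α i j) (vertex α 0) (vertex α 0)
      (i (t - 1) - i t, j t - j (t - 1))
      (anPath α (kTail α (offset α t)) * kk α (offset α t)) := by
  obtain ⟨t, rfl⟩ := Nat.exists_eq_add_of_le' (show 1 ≤ t by omega)
  have ht : 1 ≤ t := by omega
  induction t, ht using Nat.le_induction with
  | base =>
    have h := isWord_anPath_kk hd hn (isExtraIndex_last hd le_rfl (by omega) (Or.inr rfl))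
    rw [offset_succ le_rfl (by omega), kTail_offset_last le_rfl (by omega) (Or.inr rfl)]
    have h1 := weight_last hd le_rfl (by omega) (Or.inr rfl)
    refine h.congr rfl rfl (Prod.ext ?_ ?_) rfl
    · exact h1.1
    · exact (add_comm _ _).trans h1.2
  | succ t ht0 ih =>
    by_cases h : 2 < label α (t + 1)
    · have h2 := isWord_anPath_kk hd hn (isExtraIndex_last hd (by omega) (by omega) (Or.inl h))
      rw [offset_succ (by omega) (by omega), kTail_offset_last (by omega) (by omega) (Or.inl h)]
      have h1 := weight_last hd (t := t + 1) (by omega) (by omega) (Or.inl h)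
      refine h2.congr rfl rfl (Prod.ext ?_ ?_) rfl
      · exact h1.1
      · exact (add_comm _ _).trans h1.2
    · have h2 : label α (t + 1) = 2 := by
        have := hd.two_le (t + 1) (by omega) (by omega); omega
      have h1 := weight_two hd (by omega) (by omega) h2
      rw [offset_succ (by omega) (by omega), h2]
      exact (ih (by omega) (by omega)).congr rfl rfl (Prod.ext h1.1 h1.2) rfl

theorem IsWord.weightHom_eq {wt : Arrow α → ℕ × ℕ} {P Q : Vertex α} {w w' : ℕ × ℕ}
    {z z' : FreePaths α} (h : IsWord wt P Q w z) (h' : IsWord wt P Q w' z')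
    (h1 : w.1 = w'.1) (h2 : w.2 = w'.2) :
    Reconstruction.weightHom wt z = Reconstruction.weightHom wt z' := by
  rw [h.weightHom, h'.weightHom, h1, h2]

theorem isWord_chainArrow_of_length_eq_one (hd : SeriesData α.length r (label α) i j)
    (hn : α.length = 1) {m : ℕ} (hm : m < label α 1) :
    IsWord (arrowWeight α i j) (vertex α 1) (vertex α 0) (wx i 1 m, wy j 1 m)
      (chainArrow α 1 m) := by
  refine (isWord_chainArrow hd le_rfl hn.ge hm).congr rfl ?_ rfl rfl
  rw [← vertex_last, target]
  split_ifs <;> first | rfl | omega | rw [hn]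

theorem chainArrow_one_zero (hn : α.length = 1) : chainArrow α 1 0 = cl α 1 := by
  simp [chainArrow, hn]

theorem chainArrow_one_one (hn : α.length = 1) : chainArrow α 1 1 = an α 1 := by
  simp [chainArrow, hn]

theorem chainArrow_one_succ (hn : α.length = 1) {s : ℕ} (hs : 1 ≤ s) :
    chainArrow α 1 (s + 1) = kk α s := by
  rw [chainArrow, if_pos hn, if_neg (by omega), if_neg (by omega), Nat.add_sub_cancel]

theorem weightHom_chainArrow_mul_of_length_eq_one (hd : SeriesData α.length r (label α) i j)
    (hn : α.length = 1) {m : ℕ} (hm : m + 1 < label α 1) :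
    weightHom (arrowWeight α i j) (chainArrow α 1 m * an α 0) =
      weightHom (arrowWeight α i j) (chainArrow α 1 (m + 1) * cl α 0) ∧
    weightHom (arrowWeight α i j) (an α 0 * chainArrow α 1 m) =
      weightHom (arrowWeight α i j) (cl α 0 * chainArrow α 1 (m + 1)) := by
  have h := IsExtraIndex.weight_succ hd (t := 1) (m := m)
    ⟨le_rfl, hn.ge, by omega, Or.inr rfl, by omega⟩ ⟨le_rfl, hn.ge, by omega, Or.inr rfl, by omega⟩
  have h1 := hd.i_n
  have h2 := hd.j_one
  have hx := isWord_cl_zero α i j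
  have hy := isWord_an_zero α i j
  have w := isWord_chainArrow_of_length_eq_one hd hn (m := m) (by omega)
  have w' := isWord_chainArrow_of_length_eq_one hd hn hm
  rw [hn] at h1 hx
  rw [h1, h2] at h
  constructor
  · exact (w.mul hy).weightHom_eq (w'.mul hx) (by simp [h]) (by simp [h])
  · exact (hy.mul w).weightHom_eq (hx.mul w') (by simp [h, add_comm]) (by simp [h, add_comm])

theorem weightHom_swap (hd : SeriesData α.length r (label α) i j) (hn : 2 ≤ α.length)
    {t m : ℕ} (h : IsExtraIndex α t m) (h' : IsExtraIndex α t (m + 1)) :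
    weightHom (arrowWeight α i j) (kk α (offset α t + m) * anPath α t) =
      weightHom (arrowWeight α i j) (kk α (offset α t + m + 1) * clPath α t) ∧
    weightHom (arrowWeight α i j) (anPath α t * kk α (offset α t + m)) =
      weightHom (arrowWeight α i j) (clPath α t * kk α (offset α t + m + 1)) := by
  have hw := h.weight_succ hd h'
  have hx := isWord_clPath hd h.1 h.2.1
  have hy := isWord_anPath hd h.1 h.2.1
  have w := isWord_kk hd hn h
  have w' := isWord_kk hd hn h'
  constructor
  · exact (w.mul hy).weightHom_eq (w'.mul hx) (by simp [hw]) (by simp [hw])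
  · exact (hy.mul w).weightHom_eq (hx.mul w') (by simp [hw, add_comm]) (by simp [hw, add_comm])

theorem weightHom_swap_last (hd : SeriesData α.length r (label α) i j) (hn : 2 ≤ α.length)
    {t : ℕ} (ht : 1 ≤ t) (htn : t < α.length) (h : 2 < label α t) :
    weightHom (arrowWeight α i j) (kk α (uIdx α t) * anPath α t) =
      weightHom (arrowWeight α i j) (an α t * cl α (t + 1)) := by
  have hw := weight_last hd ht htn.le (Or.inl h)
  have w := isWord_kk hd hn (isExtraIndex_last hd ht htn.le (Or.inl h))
  rw [uIdx_eq ht htn h, offset_succ ht htn.le]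
  exact (w.mul (isWord_anPath hd ht htn.le)).weightHom_eq
    ((isWord_an hd (Or.inl htn)).mul (isWord_cl (by omega) htn)) (by simp [hw]) (by simp [hw])

theorem weightHom_two (hd : SeriesData α.length r (label α) i j) {t : ℕ}
    (ht : 1 ≤ t) (htn : t < α.length) (h : label α t = 2) :
    weightHom (arrowWeight α i j) (cl α t * an α (t - 1)) =
      weightHom (arrowWeight α i j) (an α t * cl α (t + 1)) := by
  have hw := weight_two hd ht htn.le h
  have w := isWord_an (α := α) hd (t := t - 1) (Or.inl (by omega))
  rw [Nat.sub_add_cancel ht] at w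
  exact ((isWord_cl ht htn.le).mul w).weightHom_eq
    ((isWord_an hd (Or.inl htn)).mul (isWord_cl (by omega) htn)) (by simp [hw]) (by simp [hw])

theorem weightHom_swap_first (hd : SeriesData α.length r (label α) i j) (hn : 2 ≤ α.length)
    {t : ℕ} (ht : 2 ≤ t) (htn : t ≤ α.length) (h : 2 < label α t) :
    weightHom (arrowWeight α i j) (cl α t * an α (t - 1)) =
      weightHom (arrowWeight α i j) (kk α (vIdx α t) * clPath α t) ∧
    weightHom (arrowWeight α i j) (clPath α t * kk α (vIdx α t)) =
      weightHom (arrowWeight α i j) (anPath α (kTail α (VIdx α t)) * kk α (VIdx α t)) := by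
  have ht1 : 1 ≤ t := by omega
  have hw := weight_first hd ht1 htn h
  have w := isWord_an (α := α) hd (t := t - 1) (Or.inl (by omega))
  rw [Nat.sub_add_cancel ht1] at w
  have wk := isWord_kk hd hn (t := t) (m := 1)
    ⟨ht1, htn, by omega, Or.inl le_rfl, by omega⟩
  have hx := isWord_clPath hd ht1 htn
  rw [vIdx_eq ht htn h, VIdx_eq ht htn]
  refine ⟨((isWord_cl ht1 htn).mul w).weightHom_eq (wk.mul hx) (by simp [← hw]) (by simp [← hw]),
    (hx.mul wk).weightHom_eq (isWord_anPath_kk_offset hd hn ht htn) ?_ ?_⟩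
  · simp [← hw, add_comm]
  · simp [← hw]

theorem anPath_one (α : List ℕ) : anPath α 1 = an α 0 := by simp [anPath]

theorem clPath_length (α : List ℕ) : clPath α α.length = cl α 0 := by simp [clPath]

theorem weightHom_rel (hd : SeriesData α.length r (label α) i j) {x y : FreePaths α}
    (h : Rel α x y) :
    weightHom (arrowWeight α i j) x = weightHom (arrowWeight α i j) y := by
  -- The three ranges of indices in the relations become statements about two neighbouring places in
  -- the chain of one vertex.
  have hmid : ∀ {t s}, 2 ≤ α.length → 2 ≤ t → t < α.length → 2 < label α t → vIdx α t ≤ s →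
      s < uIdx α t → ∃ m, s = offset α t + m ∧ IsExtraIndex α t m ∧ IsExtraIndex α t (m + 1) := by
    intro t s hn ht htn h2 hv hu
    rw [vIdx_eq ht htn.le h2] at hv
    rw [uIdx_eq (by omega) htn h2, offset_succ (by omega) htn.le] at hu
    exact ⟨s - offset α t, by omega, ⟨by omega, htn.le, by omega, by omega, by omega⟩,
      by omega, htn.le, by omega, by omega, by omega⟩
  have hlast : ∀ {s}, 2 ≤ α.length → 2 < label α α.length → vIdx α α.length ≤ s →
      s < uIdx α α.length → ∃ m, s = offset α α.length + m ∧ IsExtraIndex α α.length m ∧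
        IsExtraIndex α α.length (m + 1) := by
    intro s hn h2 hv hu
    have h3 := offset_succ (α := α) hd.n_pos le_rfl
    rw [offset_last] at h3
    rw [vIdx_eq hn le_rfl h2] at hv
    rw [uIdx_last, h3] at hu
    exact ⟨s - offset α α.length, by omega, ⟨by omega, le_rfl, by omega, by omega, by omega⟩,
      by omega, le_rfl, by omega, by omega, by omega⟩
  have hfirst : ∀ {s}, 2 ≤ α.length → 2 < label α 1 → s < uIdx α 1 →
      s = offset α 1 + s ∧ IsExtraIndex α 1 s ∧ IsExtraIndex α 1 (s + 1) := by
    intro s hn h2 hu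
    rw [uIdx_eq le_rfl (by omega) h2, offset_succ le_rfl (by omega)] at hu
    rw [offset_one] at hu ⊢
    exact ⟨by omega, ⟨le_rfl, by omega, by omega, by omega, by omega⟩,
      le_rfl, by omega, by omega, by omega, by omega⟩
  cases h with
  | one_a hn =>
    have h2 := hd.two_le 1 le_rfl hn.ge
    rw [← chainArrow_one_zero hn, ← chainArrow_one_one hn]
    exact (weightHom_chainArrow_mul_of_length_eq_one hd hn h2).1.symm
  | one_b hn =>
    have h2 := hd.two_le 1 le_rfl hn.ge
    rw [← chainArrow_one_zero hn, ← chainArrow_one_one hn]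
    exact (weightHom_chainArrow_mul_of_length_eq_one hd hn h2).2.symm
  | one_c hn h =>
    rw [← chainArrow_one_succ hn le_rfl, ← chainArrow_one_one hn]
    exact (weightHom_chainArrow_mul_of_length_eq_one hd hn (by omega)).1.symm
  | one_d hn h =>
    rw [← chainArrow_one_succ hn le_rfl, ← chainArrow_one_one hn]
    exact (weightHom_chainArrow_mul_of_length_eq_one hd hn (by omega)).2.symm
  | one_e hn t h₁ h₂ =>
    obtain ⟨t, rfl⟩ := Nat.exists_eq_add_of_le' h₁
    rw [← chainArrow_one_succ hn (by omega), ← chainArrow_one_succ hn (by omega)]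
    exact (weightHom_chainArrow_mul_of_length_eq_one hd hn (by omega)).1.symm
  | one_f hn t h₁ h₂ =>
    obtain ⟨t, rfl⟩ := Nat.exists_eq_add_of_le' h₁
    rw [← chainArrow_one_succ hn (by omega), ← chainArrow_one_succ hn (by omega)]
    exact (weightHom_chainArrow_mul_of_length_eq_one hd hn (by omega)).2.symm
  | first_a hn h => exact weightHom_two hd le_rfl (by omega) h
  | first_b hn h s hs =>
    obtain ⟨h1, h2, h3⟩ := hfirst hn h hs
    rw [h1, ← anPath_one]
    exact (weightHom_swap hd hn h2 h3).1
  | first_c hn h s hs =>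
    obtain ⟨h1, h2, h3⟩ := hfirst hn h hs
    rw [h1, ← anPath_one]
    exact (weightHom_swap hd hn h2 h3).2
  | first_d hn h =>
    rw [← anPath_one]
    exact weightHom_swap_last hd hn le_rfl (by omega) h
  | mid_a t h₁ hn h => exact weightHom_two hd (by omega) hn h
  | mid_b t h₁ hn h => exact (weightHom_swap_first hd (by omega) h₁ hn.le h).1
  | mid_c t h₁ hn h => exact (weightHom_swap_first hd (by omega) h₁ hn.le h).2
  | mid_d t h₁ hn h s hv hu =>
    obtain ⟨m, rfl, h2, h3⟩ := hmid (by omega) h₁ hn h hv hu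
    exact (weightHom_swap hd (by omega) h2 h3).1
  | mid_e t h₁ hn h s hv hu =>
    obtain ⟨m, rfl, h2, h3⟩ := hmid (by omega) h₁ hn h hv hu
    exact (weightHom_swap hd (by omega) h2 h3).2
  | mid_f t h₁ hn h => exact weightHom_swap_last hd (by omega) (by omega) hn h
  | last_a n hn h₁ h =>
    subst hn
    have hw := weight_two hd (by omega) le_rfl h
    have w := isWord_an (α := α) hd (t := α.length - 1) (Or.inl (by omega))
    rw [Nat.sub_add_cancel (by omega)] at w
    have w' := isWord_an (α := α) hd (t := α.length) (Or.inr ⟨rfl, h₁⟩)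
    rw [vertex_last] at w'
    refine ((isWord_cl (by omega) le_rfl).mul w).weightHom_eq
      (w'.mul (isWord_cl_zero α i j)) ?_ (by simp [hw])
    rw [hd.i_last, hd.i_n] at hw
    simp [hw, hd.i_n]
  | last_b n hn h₁ h =>
    subst hn
    have hw := weight_two hd (by omega) le_rfl h
    have w' := isWord_an (α := α) hd (t := α.length) (Or.inr ⟨rfl, h₁⟩)
    rw [vertex_last] at w'
    rw [VIdx_eq h₁ le_rfl]
    refine ((isWord_cl_zero α i j).mul w').weightHom_eq
      (isWord_anPath_kk_offset hd h₁ h₁ le_rfl) ?_ (by simp [hw])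
    rw [hd.i_last, hd.i_n] at hw
    simp [hw, hd.i_n]
  | last_c n hn h₁ h =>
    subst hn
    rw [← clPath_length]
    exact (weightHom_swap_first hd h₁ h₁ le_rfl h).1
  | last_d n hn h₁ h =>
    subst hn
    rw [← clPath_length]
    exact (weightHom_swap_first hd h₁ h₁ le_rfl h).2
  | last_e n hn h₁ h s hv hu =>
    subst hn
    obtain ⟨m, rfl, h2, h3⟩ := hlast h₁ h hv hu
    rw [← clPath_length]
    exact (weightHom_swap hd h₁ h2 h3).1
  | last_f n hn h₁ h s hv hu =>
    subst hn
    obtain ⟨m, rfl, h2, h3⟩ := hlast h₁ h hv hu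
    rw [← clPath_length]
    exact (weightHom_swap hd h₁ h2 h3).2

end Relations

/-! ### The reconstruction algebra satisfies the exchange laws. -/

section Laws

variable {α : List ℕ} {i j : ℕ → ℕ} {r : ℕ}

/-- The projection onto the reconstruction algebra. -/
def toQuot (α : List ℕ) : FreePaths α →ₐ[ℂ] ReconstructionAlgebra α :=
  RingQuot.mkAlgHom ℂ (Rel α)

theorem toQuot_rel {x y : FreePaths α} (h : Rel α x y) : toQuot α x = toQuot α y :=
  RingQuot.mkAlgHom_rel ℂ h

/-- The arrows of the reconstruction algebra. -/
def arrowSystem (α : List ℕ) : ArrowSystem (ReconstructionAlgebra α) where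
  e p := toQuot α (idem (vertex α p))
  X := toQuot α (cl α 0)
  Y := toQuot α (an α 0)
  arr t m := toQuot α (chainArrow α t m)

/-- The weight of paths as a homomorphism on the reconstruction algebra. -/
def quotWeightHom (hd : SeriesData α.length r (label α) i j) :
    ReconstructionAlgebra α →ₐ[ℂ] Matrix (Vertex α) (Vertex α) Poly :=
  RingQuot.liftAlgHom ℂ ⟨weightHom (arrowWeight α i j), fun _ _ h => weightHom_rel hd h⟩

theorem quotWeightHom_toQuot (hd : SeriesData α.length r (label α) i j) (x : FreePaths α) :
    quotWeightHom hd (toQuot α x) = weightHom (arrowWeight α i j) x :=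
  RingQuot.liftAlgHom_mkAlgHom_apply ℂ _ _ x

theorem IsWord.weight_eq_of_toQuot (hd : SeriesData α.length r (label α) i j)
    {P Q P' Q' : Vertex α} {w w' : ℕ × ℕ} {z z' : FreePaths α}
    (h : IsWord (arrowWeight α i j) P Q w z) (h' : IsWord (arrowWeight α i j) P' Q' w' z')
    (hz : toQuot α z = toQuot α z') : w = w' :=
  h.weight_eq h' (by rw [← quotWeightHom_toQuot hd, hz, quotWeightHom_toQuot])

/-- The number in `1, …, n + 1` of a vertex. -/
def vertexNumber (P : Vertex α) : ℕ := if P = vertex α 0 then α.length + 1 else Fin.val P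

theorem vertexNumber_vertex {p : ℕ} (hp : 1 ≤ p) (hpn : p ≤ α.length + 1) :
    vertexNumber (vertex α p) = p := by
  have hz : (vertex α 0).val = 0 := by simp [vertex]
  rcases hpn.eq_or_lt with rfl | h
  · rw [vertexNumber, if_pos vertex_last]
  · have h1 : (vertex α p).val = p := val_ofNat (by omega)
    rw [vertexNumber, if_neg, h1]
    intro h2
    rw [h2, hz] at h1
    omega

theorem vertexNumber_zero : vertexNumber (vertex α 0) = α.length + 1 := if_pos rfl

theorem vertexNumber_mem (P : Vertex α) :
    1 ≤ vertexNumber P ∧ vertexNumber P ≤ α.length + 1 := by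
  rw [vertexNumber]
  split_ifs with h
  · omega
  · have h1 := Fin.is_lt P
    refine ⟨?_, by omega⟩
    by_contra h2
    exact h (Fin.ext (by simp [vertex]; omega))

theorem vertex_vertexNumber (P : Vertex α) : vertex α (vertexNumber P) = P := by
  rw [vertexNumber]
  split_ifs with h
  · rw [h, vertex_last]
  · exact Fin.ext (Nat.mod_eq_of_lt (Fin.is_lt P))

theorem unitLaws (hd : SeriesData α.length r (label α) i j) :
    (arrowSystem α).UnitLaws α.length (label α) where
  e_mul_e p _ _ := by
    simp only [arrowSystem, ← map_mul]
    rw [(IsWord.idem (wt := arrowWeight α i j) _).idem_mul]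
  e_mul_X := by
    simp only [arrowSystem, ← map_mul, vertex_last]
    rw [(isWord_cl_zero α i j).idem_mul]
  e_mul_Y := by
    simp only [arrowSystem, ← map_mul, vertex_last]
    rw [(isWord_an_zero α i j).idem_mul]
  e_mul_arr t m ht htn hm := by
    simp only [arrowSystem, ← map_mul]
    rw [(isWord_chainArrow hd ht htn hm).idem_mul]

theorem isPath_arrow (hd : SeriesData α.length r (label α) i j) (e : Arrow α) :
    IsPath α.length (label α) i j (arrowSystem α) (vertexNumber e.start) (vertexNumber e.finish)
      (arrowWeight α i j e).1 (arrowWeight α i j e).2 (toQuot α (arrow e)) := by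
  have hn := hd.n_pos
  rcases arrow_cases hd e with rfl | rfl | ⟨t, m, ht, htn, hm, he⟩
  · have h := isWord_cl_zero α i j
    have h1 := IsPath.consX (i := i) (j := j) _ _ _ _
      (.nil (S := arrowSystem α) (α := label α) α.length hn (by omega))
    rw [clock_start, clock_finish_zero, vertexNumber_zero, vertexNumber_vertex hn (by omega)]
    have h2 : (arrowSystem α).X * (arrowSystem α).e α.length =
        toQuot α (arrow (Arrow.clock (Fin.ofNat _ 0))) := by
      simp only [arrowSystem, ← map_mul]
      rw [h.mul_idem]; rfl
    rw [h2] at h1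
    simpa [arrowWeight] using h1
  · have h := isWord_an_zero α i j
    have h1 := IsPath.consY (i := i) (j := j) _ _ _ _
      (.nil (S := arrowSystem α) (α := label α) (n := α.length) 1 le_rfl (by omega))
    rw [anti_start, anti_finish, vertexNumber_zero, vertexNumber_vertex (by omega) (by omega)]
    have h2 : (arrowSystem α).Y * (arrowSystem α).e 1 =
        toQuot α (arrow (Arrow.anti (Fin.ofNat _ 0))) := by
      simp only [arrowSystem, ← map_mul]
      rw [h.mul_idem]; rfl
    rw [h2] at h1
    simpa [arrowWeight] using h1
  · have hT := SeriesData.target_mem (α := label α) (m := m) ht htn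
    have h := isWord_chainArrow hd ht htn hm
    have h1 := IsPath.cons t m _ _ _ _ ht htn hm
      (.nil (S := arrowSystem α) (i := i) (j := j) _ hT.1 hT.2)
    rw [he.start_eq, he.finish_eq, he.weight_eq, he.arrow_eq,
      vertexNumber_vertex ht (by omega), vertexNumber_vertex hT.1 hT.2]
    have h2 : (arrowSystem α).arr t m * (arrowSystem α).e (target α.length (label α) t m) =
        toQuot α (chainArrow α t m) := by
      simp only [arrowSystem, ← map_mul]
      rw [h.mul_idem]
    rw [h2] at h1
    exact h1.congr (zero_add _) (zero_add _)

/-- Quiver paths grow at their end and `IsPath` at its beginning; `IsPath.mul` bridges the two. -/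
theorem IsWord.isPath (hd : SeriesData α.length r (label α) i j) {P Q : Vertex α} {w : ℕ × ℕ}
    {z : FreePaths α} (h : IsWord (arrowWeight α i j) P Q w z) :
    IsPath α.length (label α) i j (arrowSystem α) (vertexNumber P) (vertexNumber Q)
      w.1 w.2 (toQuot α z) := by
  obtain ⟨p, rfl, rfl⟩ := h
  induction p with
  | nil =>
    have := IsPath.nil (S := arrowSystem α) (α := label α) (i := i) (j := j) _
      (vertexNumber_mem P).1 (vertexNumber_mem P).2
    simp only [arrowSystem, vertex_vertexNumber] at this
    exact this
  | cons p f ih =>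
    obtain ⟨e, rfl, rfl⟩ := f
    have := ih.mul (unitLaws hd) (isPath_arrow hd e)
    rw [← map_mul, Reconstruction.arrow, PathAlgebra.ofPath_mul_of_eq] at this
    exact this

theorem IsWord.isPath_vertex (hd : SeriesData α.length r (label α) i j) {p q u v : ℕ}
    {z : FreePaths α} (h : IsWord (arrowWeight α i j) (vertex α p) (vertex α q) (u, v) z)
    (hp : 1 ≤ p) (hpn : p ≤ α.length + 1) (hq : 1 ≤ q) (hqn : q ≤ α.length + 1) :
    IsPath α.length (label α) i j (arrowSystem α) p q u v (toQuot α z) := by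
  have := h.isPath hd
  rwa [vertexNumber_vertex hp hpn, vertexNumber_vertex hq hqn] at this

/-! ## The relations of the reconstruction algebra in uniform notation -/

theorem toQuot_chainArrow_of_length_eq_one (hn : α.length = 1) {m : ℕ} (hm : m + 1 < label α 1) :
    toQuot α (chainArrow α 1 m * an α 0) = toQuot α (chainArrow α 1 (m + 1) * cl α 0) ∧
    toQuot α (an α 0 * chainArrow α 1 m) = toQuot α (cl α 0 * chainArrow α 1 (m + 1)) := by
  match m with
  | 0 =>
    rw [chainArrow_one_zero hn, chainArrow_one_one hn]
    exact ⟨(toQuot_rel (.one_a hn)).symm, (toQuot_rel (.one_b hn)).symm⟩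
  | 1 =>
    rw [chainArrow_one_succ hn le_rfl, chainArrow_one_one hn]
    exact ⟨(toQuot_rel (.one_c hn hm)).symm, (toQuot_rel (.one_d hn hm)).symm⟩
  | m + 2 =>
    rw [chainArrow_one_succ hn (by omega), chainArrow_one_succ hn (by omega)]
    exact ⟨(toQuot_rel (.one_e hn (m + 2) (by omega) (by omega))).symm,
      (toQuot_rel (.one_f hn (m + 2) (by omega) (by omega))).symm⟩

theorem toQuot_swap (hn : 2 ≤ α.length) {t m : ℕ} (h : IsExtraIndex α t m)
    (h' : IsExtraIndex α t (m + 1)) :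
    toQuot α (kk α (offset α t + m) * anPath α t) =
      toQuot α (kk α (offset α t + m + 1) * clPath α t) ∧
    toQuot α (anPath α t * kk α (offset α t + m)) =
      toQuot α (clPath α t * kk α (offset α t + m + 1)) := by
  obtain ⟨ht, htn, hm, h3, h4⟩ := h
  obtain ⟨-, -, hm', -, h5⟩ := h'
  have h6 := offset_succ ht htn
  by_cases h1 : t = 1
  · subst h1
    have h7 : 2 < label α 1 := by omega
    have h8 := uIdx_eq le_rfl (show 1 < α.length by omega) h7
    rw [anPath_one]
    exact ⟨toQuot_rel (.first_b hn h7 _ (by omega)), toQuot_rel (.first_c hn h7 _ (by omega))⟩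
  · have h7 : 2 < label α t := by omega
    have h8 := vIdx_eq (show 2 ≤ t by omega) htn h7
    rcases htn.eq_or_lt with htn' | htn'
    · subst htn'
      have h9 := uIdx_last (α := α)
      rw [offset_last] at h6
      rw [clPath_length]
      exact ⟨toQuot_rel (.last_e _ rfl hn h7 _ (by omega) (by omega)),
        toQuot_rel (.last_f _ rfl hn h7 _ (by omega) (by omega))⟩
    · have h9 := uIdx_eq ht htn' h7
      exact ⟨toQuot_rel (.mid_d t (by omega) htn' h7 _ (by omega) (by omega)),
        toQuot_rel (.mid_e t (by omega) htn' h7 _ (by omega) (by omega))⟩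

theorem toQuot_swap_first {t : ℕ} (ht : 2 ≤ t) (htn : t ≤ α.length) (h : 2 < label α t) :
    toQuot α (cl α t * an α (t - 1)) = toQuot α (kk α (offset α t + 1) * clPath α t) ∧
    toQuot α (clPath α t * kk α (offset α t + 1)) =
      toQuot α (anPath α (kTail α (offset α t)) * kk α (offset α t)) := by
  rw [← vIdx_eq ht htn h, ← VIdx_eq ht htn]
  rcases htn.eq_or_lt with htn' | htn'
  · rw [htn'] at ht h ⊢
    rw [clPath_length]
    exact ⟨toQuot_rel (.last_c _ rfl ht h), toQuot_rel (.last_d _ rfl ht h)⟩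
  · exact ⟨toQuot_rel (.mid_b t ht htn' h), toQuot_rel (.mid_c t ht htn' h)⟩

theorem toQuot_swap_last (hn : 2 ≤ α.length) {t : ℕ} (ht : 1 ≤ t) (htn : t < α.length)
    (h : 2 < label α t) : toQuot α (kk α (offset α t + (label α t - 2)) * anPath α t) =
      toQuot α (an α t * cl α (t + 1)) := by
  rw [← offset_succ ht htn.le, ← uIdx_eq ht htn h]
  by_cases h1 : t = 1
  · subst h1
    rw [anPath_one]
    exact toQuot_rel (.first_d hn h)
  · exact toQuot_rel (.mid_f t (by omega) htn h)

theorem toQuot_two (hn : 2 ≤ α.length) {t : ℕ} (ht : 1 ≤ t) (htn : t ≤ α.length)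
    (h : label α t = 2) : toQuot α (cl α t * an α (t - 1)) =
      toQuot α (an α t * if t = α.length then cl α 0 else cl α (t + 1)) := by
  split_ifs with h1
  · rw [h1] at h ⊢
    exact toQuot_rel (.last_a _ rfl hn h)
  · by_cases h2 : t = 1
    · subst h2
      exact toQuot_rel (.first_a hn h)
    · exact toQuot_rel (.mid_a t (by omega) (by omega) h)

theorem vertex_target {t m : ℕ} (h : IsExtraIndex α t m) :
    vertex α (target α.length (label α) t m) = vertex α 0 := by
  rw [target]
  obtain ⟨ht, htn, hm, h1, h2⟩ := h
  split_ifs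
  · exact vertex_last
  · omega
  · obtain rfl : t = α.length := by omega
    exact vertex_last
  · exact vertex_last

/-- Apart from `n = 1`, the cases are label `2` (clockwise against anticlockwise), clockwise against
the first extra arrow, the last extra arrow against anticlockwise, and two neighbouring arrows of
the `k`-numbering. Each is one defining relation at `t`. -/
theorem exists_swap (hd : SeriesData α.length r (label α) i j) {t m : ℕ} (ht : 1 ≤ t)
    (htn : t ≤ α.length) (hm : m + 1 < label α t) : ∃ y x v u,
      IsWord (arrowWeight α i j) (vertex α (target α.length (label α) t m)) (vertex α t) (0, v) y ∧
      IsWord (arrowWeight α i j) (vertex α (target α.length (label α) t (m + 1))) (vertex α t)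
        (u, 0) x ∧
      toQuot α (chainArrow α t m * y) = toQuot α (chainArrow α t (m + 1) * x) := by
  by_cases hn : α.length = 1
  · obtain rfl : t = 1 := by omega
    have hx := isWord_cl_zero α i j
    rw [hn] at hx
    rw [vertex_target ⟨le_rfl, htn, by omega, Or.inr rfl, by omega⟩,
      vertex_target ⟨le_rfl, htn, by omega, Or.inr rfl, by omega⟩]
    exact ⟨_, _, _, _, isWord_an_zero α i j, hx, (toQuot_chainArrow_of_length_eq_one hn hm).1⟩
  have hn : 2 ≤ α.length := by have := hd.n_pos; omega
  have hx := isWord_clPath hd ht htn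
  have hy := isWord_anPath hd ht htn
  have wa := isWord_an (α := α) hd (t := t - 1) (Or.inl (by omega))
  rw [Nat.sub_add_cancel ht] at wa
  have hzero : vertex α (target α.length (label α) t 0) = vertex α (t - 1) := by
    rw [target, if_pos rfl]
    split_ifs with h1
    · rw [vertex_last, h1]
    · rfl
  have hlast : target α.length (label α) t (label α t - 1) = t + 1 := by
    rw [target, if_neg (by omega), if_pos rfl]
  have ca : chainArrow α t (label α t - 1) = an α t := by
    rw [chainArrow, if_neg (by omega), if_neg (by omega), if_pos rfl]
  have cc : chainArrow α t 0 = cl α t := by rw [chainArrow, if_neg (by omega), if_pos rfl]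
  have hcl : ∀ h : t < α.length, IsWord (arrowWeight α i j) (vertex α (t + 1)) (vertex α t)
      (i t - i (t + 1), 0) (cl α (t + 1)) := fun h => isWord_cl (by omega) h
  by_cases h2 : label α t = 2
  · obtain rfl : m = 0 := by omega
    have h3 : 0 + 1 = label α t - 1 := by omega
    rw [h3, hlast, hzero, ca, cc]
    refine ⟨_, _, _, if t = α.length then 1 else i t - i (t + 1), wa, ?_, toQuot_two hn ht htn h2⟩
    split_ifs with h4
    · rw [h4, vertex_last]; exact isWord_cl_zero α i j
    · exact hcl (by omega)
  by_cases h3 : m = 0 ∧ 2 ≤ t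
  · obtain ⟨rfl, h3⟩ := h3
    have hE : IsExtraIndex α t 1 := ⟨ht, htn, by omega, Or.inl le_rfl, by omega⟩
    rw [zero_add, hzero, vertex_target hE, cc, ← kk_offset hd hn hE]
    exact ⟨_, _, _, _, wa, hx, (toQuot_swap_first h3 htn (by omega)).1⟩
  have hE : IsExtraIndex α t m := ⟨ht, htn, by omega, by omega, by omega⟩
  rw [vertex_target hE, ← kk_offset hd hn hE]
  by_cases h4 : m + 2 = label α t ∧ t < α.length
  · obtain ⟨h4, h5⟩ := h4
    have h6 : m + 1 = label α t - 1 := by omega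
    rw [h6, hlast, ca, show m = label α t - 2 by omega]
    exact ⟨_, _, _, _, hy, hcl h5, toQuot_swap_last hn ht h5 (by omega)⟩
  · have hE' : IsExtraIndex α t (m + 1) := ⟨ht, htn, by omega, by omega, by omega⟩
    rw [vertex_target hE', ← kk_offset hd hn hE']
    exact ⟨_, _, _, _, hy, hx, (toQuot_swap hn hE hE').1⟩

/-- The loop `A_{0,t} k_s` must be rewritten to begin with `c_{0,n}`, that is, as a loop through
`k_{s+1}`. This successor may leave a later vertex. -/
theorem exists_swap_XY (hd : SeriesData α.length r (label α) i j) {t m : ℕ} (ht : 1 ≤ t)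
    (htn : t ≤ α.length) (hm : m + 1 < label α t) (hmt : 1 ≤ m ∨ t = 1) : ∃ y z w,
      IsWord (arrowWeight α i j) (vertex α 1) (vertex α t) (0, j t - 1) y ∧
      IsWord (arrowWeight α i j) (vertex α α.length) (vertex α 0) w z ∧
      toQuot α (an α 0 * (y * chainArrow α t m)) = toQuot α (cl α 0 * z) := by
  have hE : IsExtraIndex α t m := ⟨ht, htn, by omega, hmt, by omega⟩
  obtain ⟨y, hy, hyt⟩ := exists_anPath_eq hd ht htn
  refine ⟨y, ?_⟩
  rw [← mul_assoc, ← hyt]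
  by_cases hn : α.length = 1
  · obtain rfl : t = 1 := by omega
    have hc := isWord_chainArrow_of_length_eq_one hd hn hm
    rw [anPath_one, hn]
    exact ⟨_, _, hy, hc, (toQuot_chainArrow_of_length_eq_one hn hm).2⟩
  have hn : 2 ≤ α.length := by have := hd.n_pos; omega
  rw [← kk_offset hd hn hE]
  by_cases h1 : m + 2 < label α t ∨ t = α.length
  · have hE' : IsExtraIndex α t (m + 1) := ⟨ht, htn, by omega, by omega, by omega⟩
    obtain ⟨x, hx, hxt⟩ := exists_clPath_eq hd ht htn
    refine ⟨_, _, hy, hx.mul (isWord_kk hd hn hE'), ?_⟩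
    rw [← mul_assoc, ← hxt]
    exact (toQuot_swap hn hE hE').2
  -- Here `k_s` is the last one at `t`. Its successor is the first extra arrow at the next vertex
  -- `t'` of label greater than `2`, or `a_{n,0}` if there is none.
  obtain rfl : m = label α t - 2 := by omega
  obtain ⟨t', h2, h3, h4, h5⟩ := exists_next (α := α) (t := t + 1) (by omega) (by omega)
  have h6 := kTail_offset_last ht htn (by omega)
  rw [← offset_succ ht htn] at h6 ⊢
  rw [← h5] at h6 ⊢
  by_cases h7 : 2 < label α t'
  · have hE' : IsExtraIndex α t' 1 := ⟨by omega, h3, by omega, by omega, by omega⟩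
    obtain ⟨x, hx, hxt⟩ := exists_clPath_eq hd (t := t') (by omega) h3
    refine ⟨_, _, hy, hx.mul (isWord_kk hd hn hE'), ?_⟩
    have h8 := (toQuot_swap_first (by omega) h3 h7).2
    rw [h6] at h8
    rw [← mul_assoc, ← hxt, h8]
  · obtain rfl : t' = α.length := by omega
    have h8 := toQuot_rel (Rel.last_b (α := α) _ rfl hn
      (by have := hd.two_le _ hd.n_pos le_rfl; omega))
    rw [VIdx_eq hn le_rfl, h6] at h8
    have h9 := isWord_an hd (Or.inr ⟨rfl, hn⟩)
    rw [vertex_last] at h9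
    exact ⟨_, _, hy, h9, h8.symm⟩

theorem laws (hd : SeriesData α.length r (label α) i j) :
    (arrowSystem α).Laws α.length (label α) i j where
  toUnitLaws := unitLaws hd
  swap t m ht htn hm := by
    obtain ⟨y, x, v, u, hy, hx, h⟩ := exists_swap hd ht htn hm
    have hT := SeriesData.target_mem (n := α.length) (α := label α) (m := m) ht htn
    have hT' := SeriesData.target_mem (n := α.length) (α := label α) (m := m + 1) ht htn
    -- The weights of the two sides agree because the weight homomorphism is already defined on the
    -- quotient, so they need not be computed again.
    have hw := ((isWord_chainArrow hd ht htn (by omega)).mul hy).weight_eq_of_toQuot hd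
      ((isWord_chainArrow hd ht htn hm).mul hx) h
    simp only [Prod.mk_add_mk, add_zero, Prod.mk.injEq] at hw
    refine ⟨_, _, v, u, hy.isPath_vertex hd hT.1 hT.2 ht (by omega),
      hx.isPath_vertex hd hT'.1 hT'.2 ht (by omega), by omega, by omega, ?_⟩
    simp only [arrowSystem, ← map_mul]
    exact h
  swap_XY t m ht htn hm hmt := by
    have hE : IsExtraIndex α t m := ⟨ht, htn, by omega, hmt, by omega⟩
    obtain ⟨y, z, w, hy, hz, h⟩ := exists_swap_XY hd ht htn hm hmt
    have hw := ((isWord_an_zero α i j).mul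
      (hy.mul (isWord_chainArrow hd ht htn (by omega)))).weight_eq_of_toQuot hd
      ((isWord_cl_zero α i j).mul hz) h
    have hj := hd.j_le ht (by omega)
    rw [hd.j_one] at hj
    obtain ⟨u, v⟩ := w
    simp only [Prod.mk_add_mk, zero_add, Prod.mk.injEq] at hw
    rw [← vertex_last] at hz
    refine ⟨_, _, u, v, hy.isPath_vertex hd le_rfl (by omega) ht (by omega),
      hz.isPath_vertex hd hd.n_pos (by omega) (by omega) le_rfl, by omega, by omega, ?_⟩
    simp only [arrowSystem, ← map_mul]
    exact h

end Laws

/-! ### Injectivity of the weight homomorphism. -/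

section Injectivity

variable {α : List ℕ} {i j : ℕ → ℕ} {r : ℕ}

theorem coeff_linearCombination_single {V : Type*} [DecidableEq V]
    (l : (V × V × ℕ × ℕ) →₀ ℂ) (P Q : V) (u v : ℕ) :
    coeff (expo u v) (Finsupp.linearCombination ℂ
      (fun c : V × V × ℕ × ℕ => Matrix.single c.1 c.2.1 (mono c.2.2.1 c.2.2.2)) l P Q) =
      l (P, Q, u, v) := by
  induction l using Finsupp.induction_linear with
  | zero => simp
  | add f g hf hg => rw [map_add, Matrix.add_apply, coeff_add, hf, hg, Finsupp.add_apply]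
  | single c x =>
    obtain ⟨P', Q', u', v'⟩ := c
    rw [Finsupp.linearCombination_single, Matrix.smul_apply, coeff_smul, Matrix.single_apply,
      Finsupp.single_apply]
    by_cases h : P' = P ∧ Q' = Q
    · obtain ⟨rfl, rfl⟩ := h
      rw [if_pos ⟨rfl, rfl⟩, mono, coeff_monomial]
      by_cases h : expo u' v' = expo u v
      · have h0 := DFunLike.congr_fun h 0
        have h1 := DFunLike.congr_fun h 1
        simp only [expo_zero, expo_one] at h0 h1
        subst h0 h1
        simp
      · have : ¬ (u' = u ∧ v' = v) := fun h' => h (by rw [h'.1, h'.2])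
        simp [h, this]
    · have : ¬ (P', Q', u', v') = (P, Q, u, v) := by simp only [Prod.mk.injEq]; tauto
      rw [if_neg h, if_neg this]
      simp

/-- By `IsPath.unique` the class of a path depends only on its ends and weight, recorded by `κ`. So
an element of the quotient is determined by the coefficients collected along `κ`, and these are
exactly the coefficients of its matrix. -/
theorem quotWeightHom_injective (hd : SeriesData α.length r (label α) i j) :
    Function.Injective (quotWeightHom hd) := by
  classical
  let κ : AnyPath (Vertex α) → Vertex α × Vertex α × ℕ × ℕ :=
    fun p => (p.1, p.2.1, pathWeight (arrowWeight α i j) p.2.2)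
  -- A choice of one path for each value of `κ`; the value `0` is used where no path exists.
  let ζ : Vertex α × Vertex α × ℕ × ℕ → ReconstructionAlgebra α := fun c =>
    if h : ∃ p, κ p = c then toQuot α (PathAlgebra.ofPath ℂ h.choose) else 0
  have hζ : ∀ p, ζ (κ p) = toQuot α (PathAlgebra.ofPath ℂ p) := by
    intro p
    have h : ∃ q, κ q = κ p := ⟨p, rfl⟩
    have hspec := h.choose_spec
    have h1 : ζ (κ p) = toQuot α (PathAlgebra.ofPath ℂ h.choose) := dif_pos h
    rw [h1]
    generalize h.choose = q at hspec
    obtain ⟨P, Q, p⟩ := p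
    obtain ⟨P', Q', q⟩ := q
    simp only [κ, Prod.mk.injEq] at hspec
    obtain ⟨rfl, rfl, hw⟩ := hspec
    have wp : IsWord (arrowWeight α i j) P' Q' _ _ := ⟨p, rfl, rfl⟩
    have wq : IsWord (arrowWeight α i j) P' Q' _ _ := ⟨q, rfl, hw⟩
    exact (wq.isPath hd).unique hd (laws hd) (wp.isPath hd)
  have hA : ∀ f : AnyPath (Vertex α) →₀ ℂ,
      toQuot α f = Finsupp.linearCombination ℂ ζ (Finsupp.mapDomain κ f) := by
    intro f
    refine PathAlgebra.induction_paths (k := ℂ) (V := Vertex α)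
      (P := fun f => toQuot α f = Finsupp.linearCombination ℂ ζ (Finsupp.mapDomain κ f))
      ?_ ?_ ?_ ?_ f
    · erw [map_zero, Finsupp.mapDomain_zero, map_zero]
    · intro f g hf hg
      erw [map_add, Finsupp.mapDomain_add, map_add, hf, hg]
    · intro c f hf
      erw [map_smul, Finsupp.mapDomain_smul, map_smul, hf]
    · intro p
      rw [← hζ]
      erw [Finsupp.mapDomain_single, Finsupp.linearCombination_single, one_smul]
  have hB : ∀ f : AnyPath (Vertex α) →₀ ℂ,
      quotWeightHom hd (toQuot α f) = Finsupp.linearCombination ℂ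
        (fun c : Vertex α × Vertex α × ℕ × ℕ =>
          (Matrix.single c.1 c.2.1 (mono c.2.2.1 c.2.2.2) : Matrix (Vertex α) (Vertex α) Poly))
        (Finsupp.mapDomain κ f) := by
    intro f
    refine (quotWeightHom_toQuot hd f).trans ?_
    rw [Finsupp.linearCombination_mapDomain]
    rfl
  rw [injective_iff_map_eq_zero]
  intro a ha
  obtain ⟨f, rfl⟩ := RingQuot.mkAlgHom_surjective ℂ (Rel α) a
  have h1 := hB f
  erw [ha] at h1
  have h2 : Finsupp.mapDomain κ f = 0 := by
    ext ⟨P, Q, u, v⟩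
    rw [← coeff_linearCombination_single, ← h1]
    simp
  exact (hA f).trans (by rw [h2, map_zero])

end Injectivity

/-! ### Comparison of the two images in the matrix algebra. -/

section Final

variable {r a : ℕ} {ε : ℂˣ} {α : List ℕ}

/-- `S_{i_p}` contains `x^(i_p)`, and also `y^(j_p)` because `a j_p ≡ i_p` mod `r`. -/
theorem goodFamily (ha : 0 < a) (har : a < r) (hcop : Nat.Coprime r a)
    (hε : IsPrimitiveRoot ε r) (hα : IsJungHirzebruch r a α) :
    GoodFamily ε a r (α.length + 1) (fun p => iSeries r a α (p + 1))
      (fun p => iNat r a α (p + 1)) (fun p => jSeries α (p + 1)) where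
  prim := hε
  ne_zero := by omega
  x_mem p := mono_mem_semiInvariants hε (by
    rw [iNat_cast ha har hcop hα (by omega)]; simp)
  y_mem p := mono_mem_semiInvariants hε (by
    have h := (seriesData ha har hcop hα).cong (p + 1) (by omega)
    rw [iNat_cast ha har hcop hα (by omega), iNat_cast ha har hcop hα (by omega)] at h
    simpa [iSeries] using h)

/-- The summand `S_{i_p}` belongs to the vertex `p`, and `S_{i_{n+1}}` to the vertex `0`. -/
def summandEquiv (α : List ℕ) : Vertex α ≃ Fin (α.length + 1) :=
  (Equiv.addRight (1 : Fin (α.length + 1))).symm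

theorem summandEquiv_symm_apply (p : Fin (α.length + 1)) :
    (summandEquiv α).symm p = vertex α (p + 1) := by
  refine Fin.ext ?_
  change (p + 1 : Fin (α.length + 1)).val = (p.val + 1) % (α.length + 1)
  simp [Fin.val_add]

theorem vertexNumber_summandEquiv (P : Vertex α) :
    vertexNumber P = (summandEquiv α P).val + 1 := by
  obtain ⟨p, rfl⟩ := (summandEquiv α).symm.surjective P
  rw [Equiv.apply_symm_apply, summandEquiv_symm_apply,
    vertexNumber_vertex (by omega) (by omega)]

/-- The weight homomorphism, with matrices indexed by the summands. -/
def summandWeightHom {i j : ℕ → ℕ} (hd : SeriesData α.length r (label α) i j) :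
    ReconstructionAlgebra α →ₐ[ℂ] Matrix (Fin (α.length + 1)) (Fin (α.length + 1)) Poly :=
  (Matrix.reindexAlgEquiv ℂ Poly (summandEquiv α)).toAlgHom.comp (quotWeightHom hd)

theorem summandWeightHom_isWord {i j : ℕ → ℕ} (hd : SeriesData α.length r (label α) i j)
    {P Q : Vertex α} {w : ℕ × ℕ} {z : FreePaths α}
    (h : IsWord (arrowWeight α i j) P Q w z) : summandWeightHom hd (toQuot α z) =
      Matrix.single (summandEquiv α P) (summandEquiv α Q) (mono w.1 w.2) := by
  change Matrix.reindexAlgEquiv ℂ Poly (summandEquiv α) (quotWeightHom hd (toQuot α z)) = _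
  rw [quotWeightHom_toQuot, h.weightHom, Matrix.coe_reindexAlgEquiv, Matrix.reindex_apply,
    Matrix.submatrix_single_equiv, Equiv.symm_symm]

theorem summandWeightHom_isPath {i j : ℕ → ℕ} (hd : SeriesData α.length r (label α) i j)
    {p q u v : ℕ} {z : ReconstructionAlgebra α}
    (h : IsPath α.length (label α) i j (arrowSystem α) p q u v z) : summandWeightHom hd z =
      Matrix.single (summandEquiv α (vertex α p)) (summandEquiv α (vertex α q)) (mono u v) := by
  induction h with
  | nil p hp hpn =>
    have h := summandWeightHom_isWord hd
      (IsWord.idem (wt := arrowWeight α i j) (vertex α p))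
    simp only [Prod.fst_zero, Prod.snd_zero] at h
    exact h
  | consX q u v z h ih =>
    rw [map_mul, ih, show (arrowSystem α).X = toQuot α (cl α 0) from rfl,
      summandWeightHom_isWord hd (isWord_cl_zero α i j), Matrix.single_mul_single_same, mono_mul,
      vertex_last, zero_add, add_comm u]
  | consY q u v z h ih =>
    rw [map_mul, ih, show (arrowSystem α).Y = toQuot α (an α 0) from rfl,
      summandWeightHom_isWord hd (isWord_an_zero α i j), Matrix.single_mul_single_same, mono_mul,
      vertex_last, zero_add, add_comm v]
  | cons t m q u v z ht htn hm h ih =>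
    rw [map_mul, ih, show (arrowSystem α).arr t m = toQuot α (chainArrow α t m) from rfl,
      summandWeightHom_isWord hd (isWord_chainArrow hd ht htn hm), Matrix.single_mul_single_same,
      mono_mul, add_comm u, add_comm v]

-- Both images are spanned by the admissible monomial matrix units: weights of paths are admissible,
-- and conversely every entry of an endomorphism splits into admissible monomials, each realised by
-- a path through `exists_isPath`.
set_option synthInstance.maxHeartbeats 400000 in
theorem range_summandWeightHom (ha : 0 < a) (har : a < r) (hcop : Nat.Coprime r a)
    (hε : IsPrimitiveRoot ε r) (hα : IsJungHirzebruch r a α) :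
    (summandWeightHom (seriesData ha har hcop hα)).range =
      (goodFamily ha har hcop hε hα).toMatrix.range := by
  have hd := seriesData ha har hcop hα
  have hi : ∀ p : Fin (α.length + 1),
      (iNat r a α (p + 1) : ℤ) = iSeries r a α (p + 1) :=
    fun p => iNat_cast ha har hcop hα (by omega)
  have ha1 : iNat r a α 1 = a := by simp [iNat, iSeries]
  apply le_antisymm
  · rintro _ ⟨x, rfl⟩
    obtain ⟨f, rfl⟩ := RingQuot.mkAlgHom_surjective ℂ (Rel α) x
    refine PathAlgebra.induction_paths (k := ℂ) (V := Vertex α)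
      (P := fun f => summandWeightHom hd (toQuot α f) ∈
        (goodFamily ha har hcop hε hα).toMatrix.range) ?_ ?_ ?_ ?_ f
    · rw [map_zero, map_zero]; exact zero_mem _
    · intro f g hf hg
      rw [map_add, map_add]; exact add_mem hf hg
    · intro c f hf
      rw [map_smul, map_smul]; exact Subalgebra.smul_mem _ hf c
    · rintro ⟨P, Q, p⟩
      have hw : IsWord (arrowWeight α (iNat r a α) (jSeries α)) P Q _
        (PathAlgebra.ofPath ℂ ⟨P, Q, p⟩) := ⟨p, rfl, rfl⟩
      have hadm := (hw.isPath hd).admissible hd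
      rw [Admissible, vertexNumber_summandEquiv, vertexNumber_summandEquiv, hi, hi, ha1] at hadm
      rw [summandWeightHom_isWord hd hw]
      exact (goodFamily ha har hcop hε hα).single_mem_range _ _ _ _ hadm
  · rintro _ ⟨φ, rfl⟩
    rw [Matrix.matrix_eq_sum_single (((goodFamily ha har hcop hε hα).toMatrix :
      _ →ₐ[ℂ] _).toRingHom φ)]
    refine sum_mem fun p _ => sum_mem fun q _ => ?_
    change Matrix.single p q ((goodFamily ha har hcop hε hα).toMatrix φ p q) ∈ _
    have hmem := (goodFamily ha har hcop hε hα).toMatrix_mem φ p q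
    generalize (goodFamily ha har hcop hε hα).toMatrix φ p q = g at hmem
    have hg : Matrix.single p q g = ∑ d ∈ g.support,
        coeff d g • (Matrix.single p q (mono (d 0) (d 1)) :
          Matrix (Fin (α.length + 1)) (Fin (α.length + 1)) Poly) := by
      simp only [Matrix.smul_single, mono, expo_self, smul_monomial, smul_eq_mul, mul_one]
      conv_lhs => rw [g.as_sum]
      exact map_sum (Matrix.singleAddMonoidHom p q) _ _
    rw [hg]
    refine sum_mem fun d hdg => Subalgebra.smul_mem _ ?_ _
    have h1 := hmem d (mem_support_iff.1 hdg)
    rw [← hi, ← hi, ← ha1] at h1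
    obtain ⟨z, hz⟩ := exists_isPath (S := arrowSystem α) hd (p := p + 1) (q := q + 1)
      (by omega) (by omega) (by omega) (by omega) h1
    refine ⟨z, (summandWeightHom_isPath hd hz).trans ?_⟩
    rw [← summandEquiv_symm_apply, ← summandEquiv_symm_apply, Equiv.apply_symm_apply,
      Equiv.apply_symm_apply]

set_option synthInstance.maxHeartbeats 400000 in
theorem nonempty_algEquiv (ha : 0 < a) (har : a < r) (hcop : Nat.Coprime r a)
    (hε : IsPrimitiveRoot ε r) (hα : IsJungHirzebruch r a α) :
    Nonempty (ReconstructionAlgebra α ≃ₐ[ℂ]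
      (Module.End (invariants (cyclicGroup ε a)) (specialSum r a ε α))ᵐᵒᵖ) := by
  have hd := seriesData ha har hcop hα
  have h1 : Function.Injective (summandWeightHom hd) :=
    (Matrix.reindexAlgEquiv ℂ Poly (summandEquiv α)).injective.comp (quotWeightHom_injective hd)
  exact ⟨(AlgEquiv.ofInjective _ h1).trans ((Subalgebra.equivOfEq _ _
    (range_summandWeightHom ha har hcop hε hα)).trans
    (AlgEquiv.ofInjective _ (goodFamily ha har hcop hε hα).toMatrix_injective).symm)⟩

end Final

end Reconstruction

end

theorem mainTheorem1 (r a : ℕ) (ha : 0 < a) (har : a < r) (hcop : Nat.Coprime r a)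
    (ε : ℂˣ) (hε : IsPrimitiveRoot ε r)
    (α : List ℕ) (hα : Reconstruction.IsJungHirzebruch r a α) :
    Nonempty (Reconstruction.ReconstructionAlgebra α ≃ₐ[ℂ]
      (Module.End (Reconstruction.invariants (Reconstruction.cyclicGroup ε a))
        (Reconstruction.specialSum r a ε α))ᵐᵒᵖ) := by
  exact Reconstruction.nonempty_algEquiv ha har hcop hε hα
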